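/- **Definitions.** All weighted graphs have nonnegative edge weights and may have self loops; a self loop contributes its weight once to the degree of its vertex. For a weighted graph $G$ on $V$ and $S\subseteq V$, let $w_G(S,\bar S)$ be the total weight of the edges between $S$ and $\bar S=V\setminus S$, let $\mathrm{Vol}_G(S)=\sum_{v\in S}\deg_G(v)$, and let $G\{S\}$ be the graph with vertex set $S$ that keeps all edges of $G$ inside $S$ and in which every $v\in S$ receives additional self loops so that its degree is the same as in $G$. A weighted graph $H$ on $V$ is a $(\delta,\epsilon)$-cut sparsifier of $G$ if for every $S\subseteq V$ $$(1-\delta)\,w_G(S,\bar S)-\epsilon\,\mathrm{Vol}_G(S)\le w_H(S,\bar S)\le(1+\delta)\,w_G(S,\bar S)+\epsilon\,\mathrm{Vol}_G(S).$$ A probability distribution over weighted (that is, arbitrarily reweighted) subgraphs $H$ of $G$ is a $(\delta,\epsilon,p)$-power cut sparsifier distribution for $G$ if for every partition $\mathcal C$ of $V$, with probability at least $1-p$, for all $C'\in\mathcal C$ the graph $H\{C'\}$ is a $(\delta,\epsilon)$-cut sparsifier of $G\{C'\}$. A dynamic stream for a simple unweighted graph $G$ on $\{0,\dots,n-1\}$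 is a finite sequence of updates that starts from the empty graph, each update inserting an absent edge or deleting a present one, such that $G$ is the graph at the end. The model of computation is a randomized random access machine with logarithmic instruction costs that can flip fair coins; space is the number of bits of memory in use (addresses and contents of the nonzero cells), random bits that are needed again have to be stored, and the output is write-only. **Theorem.** There are absolute constants $K,k\in\mathbb N$ such that for all real $C>0$ and $\epsilon,\delta\in(0,1)$ there is a randomized streaming algorithm (a program that does not depend on $n$ or on the input) with the following property. Let $n\ge1$ and let a dynamic stream be given for a graph $G$ on $n$ vertices. The algorithm, which receives $n$ before the stream and then the updates one after the other, * uses, for every outcome of the coins and at every moment, at most $$K\cdot\frac{n\max\{C,1\}}{\epsilon\delta}\cdot\log^{k}(n+1)$$ bits of memory, that is, $\tilde O\!\left(n\cdot\frac{\max\{C,1\}}{\epsilon\delta}\right)$ space; * takes, for every outcome of the coins, time at most $K\left(\frac{n\max\{C,1\}}{\epsilon\delta}\right)^{k}$ for its initialization, for processing each single update, and for computing the output after the stream; * outputs a weighted graph whose distribution is a $(\delta,\epsilon,n^{-C})$-power cut sparsifier distribution for $G$. -/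

import Mathlib

open MeasureTheory

noncomputable section

/-! ### Weighted graphs, induced graphs with self loops, power cut sparsifiers -/

/-- An undirected graph on `V` with nonnegative real edge weights; weight `0` means that the edge
is absent, and `wt v v` is the total weight of the self loops at `v`. -/
structure WGraph (V : Type) where
  wt : V → V → ℝ
  symm : ∀ u v, wt u v = wt v u
  nonneg : ∀ u v, 0 ≤ wt u v

namespace WGraph

/-- Distributions over weighted graphs are measures for the discrete σ-algebra. -/
instance (V : Type) : MeasurableSpace (WGraph V) := ⊤

open scoped Classical in
/-- An unweighted simple graph, all of whose edges have weight one. -/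
def ofSimple {V : Type} (G : SimpleGraph V) : WGraph V where
  wt u v := if G.Adj u v then 1 else 0
  symm u v := by simp only [G.adj_comm]
  nonneg u v := by split_ifs <;> norm_num

variable {V : Type} [Fintype V]

/-- The weighted degree; a self loop contributes its weight once. -/
def degree (G : WGraph V) (v : V) : ℝ := ∑ u, G.wt v u

/-- `Vol(S)`, the sum of the degrees of the vertices of `S`. -/
def vol (G : WGraph V) (S : Finset V) : ℝ := ∑ v ∈ S, G.degree v

open scoped Classical in
/-- `w(S, V ∖ S)`, the total weight of the edges between `S` and its complement. -/
def cut (G : WGraph V) (S : Finset V) : ℝ := ∑ u ∈ S, ∑ v ∈ Sᶜ, G.wt u v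

open scoped Classical in
/-- `G{S}`: the vertex set is `S`, all edges inside `S` are kept, and every vertex of `S` gets
additional self loops whose weight is the total weight of its edges leaving `S`. -/
def induceLoops (G : WGraph V) (S : Finset V) : WGraph S where
  wt u v := G.wt u v + if u = v then ∑ x ∈ Sᶜ, G.wt u x else 0
  symm u v := by
    rw [G.symm]
    by_cases h : u = v
    · subst h; rfl
    · rw [if_neg h, if_neg (Ne.symm h)]
  nonneg u v := by
    refine add_nonneg (G.nonneg _ _) ?_
    split_ifs
    · exact Finset.sum_nonneg fun x _ => G.nonneg _ _
    · exact le_rfl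

/-- `H` is a `(δ, ε)`-cut sparsifier of `G`. -/
def IsCutSparsifier (δ ε : ℝ) (H G : WGraph V) : Prop :=
  ∀ S : Finset V,
    (1 - δ) * G.cut S - ε * G.vol S ≤ H.cut S ∧ H.cut S ≤ (1 + δ) * G.cut S + ε * G.vol S

/-- `H` is a (reweighted) subgraph of `G`: every edge of `H` is an edge of `G`. -/
def IsSubgraph {V : Type} (H G : WGraph V) : Prop := ∀ u v, G.wt u v = 0 → H.wt u v = 0

open scoped Classical in
/-- `D` is a `(δ, ε, p)`-power cut sparsifier distribution for `G`: a probability distribution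
over weighted subgraphs `H` of `G` such that for every partition `P` of the vertex set, with
probability at least `1 - p`, `H{C}` is a `(δ, ε)`-cut sparsifier of `G{C}` for all `C` in `P`. -/
def IsPowerCutSparsifierDist (δ ε p : ℝ) (G : WGraph V) (D : Measure (WGraph V)) : Prop :=
  IsProbabilityMeasure D ∧ (∀ᵐ H ∂D, IsSubgraph H G) ∧
    ∀ P : Finpartition (Finset.univ : Finset V),
      1 - p ≤ D.real {H | ∀ C ∈ P.parts, IsCutSparsifier δ ε (H.induceLoops C) (G.induceLoops C)}

end WGraph

/-! ### Dynamic graph streams -/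

/-- One update of a dynamic graph stream on the vertex set `{0, …, n-1}`. -/
inductive Update (n : ℕ)
  | insert (u v : Fin n)
  | delete (u v : Fin n)

/-- `IsDynamicStream σ G`: the sequence of updates `σ` starts from the empty graph, inserts only
edges that are absent, deletes only edges that are present, and ends with the graph `G`. -/
inductive IsDynamicStream {n : ℕ} : List (Update n) → SimpleGraph (Fin n) → Prop
  | nil : IsDynamicStream [] ⊥
  | insert {σ : List (Update n)} {G : SimpleGraph (Fin n)} {u v : Fin n} :
      IsDynamicStream σ G → u ≠ v → ¬ G.Adj u v →
        IsDynamicStream (σ ++ [Update.insert u v]) (G ⊔ SimpleGraph.fromEdgeSet {s(u, v)})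
  | delete {σ : List (Update n)} {G : SimpleGraph (Fin n)} {u v : Fin n} :
      IsDynamicStream σ G → G.Adj u v →
        IsDynamicStream (σ ++ [Update.delete u v]) (G.deleteEdges {s(u, v)})

/-! ### A randomized random access machine with logarithmic cost and space counted in bits -/

/-- Arithmetic operations on natural numbers (subtraction is truncated, division rounds down). -/
inductive ArithOp
  | add | sub | mul | div | mod

/-- The value of an arithmetic operation. -/
def ArithOp.eval : ArithOp → ℕ → ℕ → ℕ
  | add, a, b => a + b
  | sub, a, b => a - b
  | mul, a, b => a * b
  | div, a, b => a / b
  | mod, a, b => a % b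

/-- Elementary instructions; `M` denotes the memory, an array of natural numbers. -/
inductive Instr
  /-- `M[d] := k` -/
  | const (d k : ℕ)
  /-- `M[d] := M[a] op M[b]` -/
  | arith (op : ArithOp) (d a b : ℕ)
  /-- `M[d] := M[M[a]]` -/
  | load (d a : ℕ)
  /-- `M[M[d]] := M[a]` -/
  | store (d a : ℕ)
  /-- `M[d] :=` a fresh fair coin (`0` or `1`) -/
  | flip (d : ℕ)
  /-- append `M[a]` to the write-only output -/
  | emit (a : ℕ)

/-- Programs. Conditions test whether a memory cell is nonzero. -/
inductive Program
  | skip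
  | instr (i : Instr)
  | seq (P Q : Program)
  | ite (x : ℕ) (P Q : Program)
  | loop (x : ℕ) (P : Program)

/-- A machine configuration: the memory (all but finitely many cells are zero), the number of
coins used so far, and the output written so far. -/
structure Config where
  mem : ℕ →₀ ℕ
  coins : ℕ
  out : List ℕ

namespace Config

/-- The number of bits of memory in use: each nonzero cell is charged the length of its address
plus the length of its content. -/
def bits (s : Config) : ℕ := s.mem.sum fun a v => Nat.size a + Nat.size v

/-- Write `v` into the cell `a`. -/
def write (s : Config) (a v : ℕ) : Config := { s with mem := s.mem.update a v }

end Config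

/-- The effect of an instruction; `ω` is the sequence of coins, which can be read only once and
in order, so that coins that are needed again have to be kept in memory. -/
def Instr.run (ω : ℕ → Bool) (s : Config) : Instr → Config
  | const d k => s.write d k
  | arith op d a b => s.write d (op.eval (s.mem a) (s.mem b))
  | load d a => s.write d (s.mem (s.mem a))
  | store d a => s.write (s.mem d) (s.mem a)
  | flip d => { s.write d (ω s.coins).toNat with coins := s.coins + 1 }
  | emit a => { s with out := s.out ++ [s.mem a] }

/-- The logarithmic cost of an instruction: one plus the lengths of the numbers it handles. -/
def Instr.cost (s : Config) : Instr → ℕ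
  | const _ k => 1 + Nat.size k
  | arith _ _ a b => 1 + Nat.size (s.mem a) + Nat.size (s.mem b)
  | load _ a => 1 + Nat.size (s.mem a) + Nat.size (s.mem (s.mem a))
  | store d a => 1 + Nat.size (s.mem d) + Nat.size (s.mem a)
  | flip _ => 1
  | emit a => 1 + Nat.size (s.mem a)

/-- `Exec ω P s t b s'`: with the coins `ω`, the program `P` started in `s` halts in `s'` after
time `t`, and `b` is the maximal number of bits of memory in use at any moment of the run. -/
inductive Exec (ω : ℕ → Bool) : Program → Config → ℕ → ℕ → Config → Prop
  | skip (s : Config) : Exec ω .skip s 1 s.bits s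
  | instr (i : Instr) (s : Config) :
      Exec ω (.instr i) s (i.cost s) (max s.bits (i.run ω s).bits) (i.run ω s)
  | seq {P Q : Program} {s₁ s₂ s₃ : Config} {t₁ t₂ b₁ b₂ : ℕ} :
      Exec ω P s₁ t₁ b₁ s₂ → Exec ω Q s₂ t₂ b₂ s₃ →
        Exec ω (.seq P Q) s₁ (t₁ + t₂) (max b₁ b₂) s₃
  | ite_true {x : ℕ} {P Q : Program} {s s' : Config} {t b : ℕ} :
      s.mem x ≠ 0 → Exec ω P s t b s' →
        Exec ω (.ite x P Q) s (1 + Nat.size (s.mem x) + t) b s'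
  | ite_false {x : ℕ} {P Q : Program} {s s' : Config} {t b : ℕ} :
      s.mem x = 0 → Exec ω Q s t b s' → Exec ω (.ite x P Q) s (1 + t) b s'
  | loop_done {x : ℕ} {P : Program} {s : Config} :
      s.mem x = 0 → Exec ω (.loop x P) s 1 s.bits s
  | loop_step {x : ℕ} {P : Program} {s₁ s₂ s₃ : Config} {t₁ t₂ b₁ b₂ : ℕ} :
      s₁.mem x ≠ 0 → Exec ω P s₁ t₁ b₁ s₂ → Exec ω (.loop x P) s₂ t₂ b₂ s₃ →
        Exec ω (.loop x P) s₁ (1 + Nat.size (s₁.mem x) + t₁ + t₂) (max b₁ b₂) s₃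

/-! ### Streaming algorithms -/

/-- A streaming algorithm: `setup` is run before the stream, `update` once for every stream
update, and `finish` after the stream. Only the memory is passed from one run to the next. -/
structure StreamAlg where
  setup : Program
  update : Program
  finish : Program

namespace StreamAlg

/-- At the start the memory is zero except that cell `0` holds the number `n` of vertices. -/
def start (n : ℕ) : Config := ⟨Finsupp.single 0 n, 0, []⟩

/-- A stream update is presented in cells `1`, `2`, `3`: its kind (`1` for an insertion and `0`
for a deletion) and the two endpoints of the edge. -/
def feed {n : ℕ} (s : Config) : Update n → Config
  | .insert u v => ((s.write 1 1).write 2 u).write 3 v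
  | .delete u v => ((s.write 1 0).write 2 u).write 3 v

/-- `A.Reads ω T S σ s`: the algorithm `A`, with the coins `ω`, reads the stream `σ` and is then
in the configuration `s`; the setup and the processing of every single update take time at most
`T`, and at no moment are more than `S` bits of memory in use. -/
inductive Reads (A : StreamAlg) {n : ℕ} (ω : ℕ → Bool) (T S : ℝ) : List (Update n) → Config → Prop
  | nil {t b : ℕ} {s : Config} :
      Exec ω A.setup (start n) t b s → (t : ℝ) ≤ T → (b : ℝ) ≤ S → Reads A ω T S [] s
  | snoc {σ : List (Update n)} {e : Update n} {t b : ℕ} {s s' : Config} :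
      Reads A ω T S σ s → Exec ω A.update (feed s e) t b s' → (t : ℝ) ≤ T → (b : ℝ) ≤ S →
        Reads A ω T S (σ ++ [e]) s'

/-- `A.Outputs ω T S σ l`: as before, and after the stream the algorithm computes the output `l`,
again in time at most `T` and using at most `S` bits of memory. -/
def Outputs (A : StreamAlg) {n : ℕ} (ω : ℕ → Bool) (T S : ℝ) (σ : List (Update n)) (l : List ℕ) :
    Prop :=
  ∃ (s s' : Config) (t b : ℕ), A.Reads ω T S σ s ∧ Exec ω A.finish { s with out := [] } t b s' ∧
    (t : ℝ) ≤ T ∧ (b : ℝ) ≤ S ∧ s'.out = l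

/-- The law of an infinite sequence of independent fair coins. -/
def coinLaw : Measure (ℕ → Bool) :=
  Measure.infinitePi fun _ => (PMF.uniformOfFintype Bool).toMeasure

/-- Split a list of numbers into consecutive blocks of four. -/
def blocks : List ℕ → List (ℕ × ℕ × ℕ × ℕ)
  | u :: v :: a :: b :: l => (u, v, a, b) :: blocks l
  | _ => []

/-- The weighted graph that is described by an output: a block `u, v, a, b` stands for an edge
`{u, v}` of weight `a / b` (weights of repeated edges add up). -/
def decode (n : ℕ) (l : List ℕ) : WGraph (Fin n) where
  wt x y := ((blocks l).map fun q =>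
    if (q.1 = (x : ℕ) ∧ q.2.1 = (y : ℕ)) ∨ (q.1 = (y : ℕ) ∧ q.2.1 = (x : ℕ)) then (q.2.2.1 : ℝ) / q.2.2.2 else 0).sum
  symm x y := by simp only [or_comm]
  nonneg x y := by
    refine List.sum_nonneg fun r hr => ?_
    obtain ⟨q, -, rfl⟩ := List.mem_map.1 hr
    split_ifs <;> positivity

end StreamAlg

end

/-!
The algorithm samples edges by a hash polynomial of high degree over a prime field and recovers the
sampled edges of every vertex from a sketch of small size.

**Sampling.** Let `p` be the least prime that is at least `2(n + 2)²` (`prm`), and let `λ` be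
`min (c (log n)²) n` (`lam`) for a constant `c` of order `max C 1 / (ε δ)`. Every ordered pair
`(v, u)` is hashed to the value at `v n + u` of a random polynomial over `ZMod p` with `2 n λ`
coefficients, which are stored. For a vertex `v` of degree `d` the pair `(v, u)` is sampled if its
hash value is below the threshold `T = p / 2 ^ k`, where `k` is least with `d T ≤ λ p`. Thus about
`λ` neighbours of `v` are sampled, or all of them if `d ≤ λ`. An edge is owned by its endpoint of
smaller degree; it is written if it is sampled there, and it then gets the weight `p / T`, so that
its expected weight is one.

**Sketches.** The degree is known only after the stream. For each of the `O(log n)` thresholds, and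
for each vertex, the memory therefore holds the number of the sampled neighbours and the values at
`2 λ + 1` points of the monic polynomial over `ZMod p` whose roots they are (`Holds`). An update
multiplies or divides these values by linear factors, a division being a power with exponent
`p - 2` (`updateCmd_wp`). If there are at most `2 λ` sampled neighbours, then Lagrange interpolation
evaluates the polynomial at every `u` and so decides whether `u` is one of them (`lagrange_eval`,
`finishCmd_wp`).

**Concentration.** The hash values of any `2 n λ` pairs are independent and uniform
(`ev_bijective`), so that moments of order `2 m ≤ 2 n λ` of a sum of deviations are those of
independent variables, which gives the tail bound `8 ^ (-m)` (`card_tail_le`, `card_dev_le`). It is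
used with `m` of order `max C 1 * log n` for the number of sampled neighbours of each vertex
(`card_heavy_le`), and with `m` of order `|S| * max C 1 * log n` for each set `S` inside a part
of the partition and each level `i`, the level being the edges whose owners have degree in
`[2 ^ i, 2 ^ (i + 1))` (`card_inaccurate_le`). The larger moments pay for the union bound over all
sets `S` (`card_bad_le`). They are available because only the vertices of `S` of degree at least
`2 ^ i` matter at level `i`: the owner of an edge has the smaller degree. Hence the weights at level
`i` are `O(2 ^ i / λ)`, while the volume of these vertices is at least `2 ^ i` times their number,
and the additive error `ε Vol(S) / log n` is large enough. Summing over the levels bounds every cut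
(`isCutSparsifier`).

**The machine.** Programs are written in a language with registers, arrays, expressions and bounded
loops (`Cmd`), which is compiled to the machine. A weakest-precondition calculus (`Cmd.wp`) proves
both that a program computes what it should and that all numbers stay within given bounds. The
bounds on the space and on the time follow for every such program (`Cmd.compile_runs`,
`Cmd.time_le`), because its running time is polynomial in the bounds by the nesting of its loops.
The coefficients are obtained by reducing blocks of coins modulo `p`; their law is within a factor
of three of the uniform one (`coinLaw_randomCoefs_le`).
-/

set_option linter.constructorNameAsVariable false

/-! ### A structured language that compiles to the random access machine -/

namespace Imp

/-- The scalar variables of the programs below. The first four are the cells in which the input is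
presented: the number of vertices, and the kind and the endpoints of an update. -/
inductive Reg
  | n | kind | u | v
  | len | lam | p | t | f | b | i | j | r | e | h | x | l | d | a | s | q
  deriving DecidableEq

/-- The memory cell of a scalar variable. -/
def Reg.cell : Reg → ℕ
  | n => 0 | kind => 1 | u => 2 | v => 3
  | len => 4 | lam => 5 | p => 6 | t => 7 | f => 8 | b => 9 | i => 10 | j => 11 | r => 12
  | e => 13 | h => 14 | x => 15 | l => 16 | d => 17 | a => 18 | s => 19 | q => 20

theorem Reg.cell_lt (x : Reg) : x.cell < 32 := by cases x <;> decide

theorem Reg.cell_injective : Function.Injective Reg.cell :=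
  Function.LeftInverse.injective (g := fun k => [n, kind, u, v, len, lam, p, t, f, b, i, j, r, e,
    h, x, l, d, a, s, q].getD k n) fun x => by cases x <;> rfl

/-- The three arrays: the coefficients of the hash polynomial, the counters and the sketches. -/
inductive Arr
  | coef | cnt | sk
  deriving DecidableEq

/-- The position of an array in the interleaving of the three arrays. -/
def Arr.idx : Arr → ℕ
  | coef => 0 | cnt => 1 | sk => 2

/-- The address of an array entry. Cells below `64` hold scalars and temporary values; the
arrays are interleaved behind them, so that none of them needs a length. -/
def Arr.addr (A : Arr) (k : ℕ) : ℕ := k * 3 + (64 + A.idx)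

theorem Arr.addr_inj {A B : Arr} {k l : ℕ} : A.addr k = B.addr l ↔ A = B ∧ k = l := by
  constructor
  · cases A <;> cases B <;> simp only [Arr.addr, Arr.idx, reduceCtorEq, false_and, true_and] <;>
      omega
  · rintro ⟨rfl, rfl⟩; rfl

theorem Arr.le_addr (A : Arr) (k : ℕ) : 64 ≤ A.addr k := by
  unfold Arr.addr; omega

/-- The memory as the structured language sees it. -/
structure Store where
  reg : Reg → ℕ
  arr : Arr → ℕ → ℕ
  coins : ℕ
  out : List ℕ

/-- Assign to a scalar variable. -/
def Store.set (σ : Store) (x : Reg) (k : ℕ) : Store :=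
  { σ with reg := fun y => if y = x then k else σ.reg y }

/-- Assign to an array entry. -/
def Store.put (σ : Store) (A : Arr) (a k : ℕ) : Store :=
  { σ with arr := fun B b => if B = A ∧ b = a then k else σ.arr B b }

@[simp] theorem Store.set_reg (σ : Store) (x y : Reg) (k : ℕ) :
    (σ.set x k).reg y = if y = x then k else σ.reg y := rfl
@[simp] theorem Store.set_arr (σ : Store) (x : Reg) (k : ℕ) : (σ.set x k).arr = σ.arr := rfl
@[simp] theorem Store.set_coins (σ : Store) (x : Reg) (k : ℕ) : (σ.set x k).coins = σ.coins := rfl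
@[simp] theorem Store.set_out (σ : Store) (x : Reg) (k : ℕ) : (σ.set x k).out = σ.out := rfl
@[simp] theorem Store.put_reg (σ : Store) (A : Arr) (a k : ℕ) : (σ.put A a k).reg = σ.reg := rfl
@[simp] theorem Store.put_arr (σ : Store) (A B : Arr) (a b k : ℕ) :
    (σ.put A a k).arr B b = if B = A ∧ b = a then k else σ.arr B b := rfl
@[simp] theorem Store.put_coins (σ : Store) (A : Arr) (a k : ℕ) :
    (σ.put A a k).coins = σ.coins := rfl
@[simp] theorem Store.put_out (σ : Store) (A : Arr) (a k : ℕ) : (σ.put A a k).out = σ.out := rfl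

/-- Expressions without side effects. -/
inductive Exp
  | reg (x : Reg)
  | lit (k : ℕ)
  | op (o : ArithOp) (a b : Exp)
  | get (A : Arr) (a : Exp)

instance : Coe Reg Exp := ⟨Exp.reg⟩
instance (k : ℕ) : OfNat Exp k := ⟨Exp.lit k⟩
instance : Add Exp := ⟨Exp.op .add⟩
instance : Sub Exp := ⟨Exp.op .sub⟩
instance : Mul Exp := ⟨Exp.op .mul⟩
instance : Div Exp := ⟨Exp.op .div⟩
instance : Mod Exp := ⟨Exp.op .mod⟩

/-- The value of an expression. -/
def Exp.eval (σ : Store) : Exp → ℕ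
  | reg x => σ.reg x
  | lit k => k
  | op o a b => o.eval (a.eval σ) (b.eval σ)
  | get A a => σ.arr A (a.eval σ)

/-- Bounds on the memory: scalars are less than `V`, only the first `A` entries of the arrays are
used, and they are less than `W`. -/
structure Lim where
  V : ℕ
  A : ℕ
  W : ℕ
  hV : 128 ≤ V
  hA : 3 * A + 64 ≤ V
  hW : W ≤ V

/-- Evaluating the expression stays within the bounds. Subtraction, division and remainder cannot
exceed their first operand, so that only sums and products carry a condition. -/
def Exp.safe (L : Lim) (σ : Store) : Exp → Prop
  | reg _ => True
  | lit k => k < L.V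
  | op o a b => a.safe L σ ∧ b.safe L σ ∧
      match o with
      | .add => a.eval σ + b.eval σ < L.V
      | .mul => a.eval σ * b.eval σ < L.V
      | _ => True
  | get _ a => a.safe L σ ∧ a.eval σ < L.A

/-- A store within the bounds. -/
structure Store.Bounded (L : Lim) (σ : Store) : Prop where
  reg : ∀ x, σ.reg x < L.V
  arr : ∀ A a, σ.arr A a ≠ 0 → a < L.A ∧ σ.arr A a < L.W

theorem Store.Bounded.arr_lt {L : Lim} {σ : Store} (h : σ.Bounded L) (A : Arr) (a : ℕ) :
    σ.arr A a < L.V := by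
  by_cases h0 : σ.arr A a = 0
  · have := L.hV; omega
  · exact (h.arr A a h0).2.trans_le L.hW

theorem Exp.eval_lt {L : Lim} {σ : Store} (h : σ.Bounded L) :
    ∀ e : Exp, e.safe L σ → e.eval σ < L.V
  | reg x, _ => h.reg x
  | lit _, hk => hk
  | get A _, _ => h.arr_lt A _
  | op .add _ _, hs => hs.2.2
  | op .mul _ _, hs => hs.2.2
  | op .sub a _, hs => (Nat.sub_le _ _).trans_lt (eval_lt h a hs.1)
  | op .div a _, hs => (Nat.div_le_self _ _).trans_lt (eval_lt h a hs.1)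
  | op .mod a _, hs => (Nat.mod_le _ _).trans_lt (eval_lt h a hs.1)

/-- Commands. The loop `down x e P` runs `P` with `x` going down from the value of `e` minus one
to zero. -/
inductive Cmd
  | asg (x : Reg) (e : Exp)
  | put (A : Arr) (a e : Exp)
  | flip (x : Reg)
  | emit (e : Exp)
  | skip
  | seq (P Q : Cmd)
  | ite (e : Exp) (P Q : Cmd)
  | down (x : Reg) (e : Exp) (P : Cmd)

/-- Sequential composition of a list of commands. -/
def Cmd.block : List Cmd → Cmd
  | [] => .skip
  | [P] => P
  | P :: l => .seq P (block l)

/-- Weakest preconditions: from the store `σ` the command stays within the bounds and establishes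
`Q`. A loop is described by an invariant that is indexed by the number of rounds that remain. -/
def Cmd.wp (ω : ℕ → Bool) (L : Lim) : Cmd → (Store → Prop) → Store → Prop
  | asg x e, Q, σ => e.safe L σ ∧ Q (σ.set x (e.eval σ))
  | put A a e, Q, σ => a.safe L σ ∧ e.safe L σ ∧ a.eval σ < L.A ∧ e.eval σ < L.W ∧
      Q (σ.put A (a.eval σ) (e.eval σ))
  | flip x, Q, σ => Q { σ.set x (ω σ.coins).toNat with coins := σ.coins + 1 }
  | emit e, Q, σ => e.safe L σ ∧ Q { σ with out := σ.out ++ [e.eval σ] }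
  | skip, Q, σ => Q σ
  | seq P R, Q, σ => P.wp ω L (R.wp ω L Q) σ
  | ite e P R, Q, σ => e.safe L σ ∧ (e.eval σ ≠ 0 → P.wp ω L Q σ) ∧ (e.eval σ = 0 → R.wp ω L Q σ)
  | .down x e P, Q, σ => e.safe L σ ∧ ∃ I : ℕ → Store → Prop,
      I (e.eval σ) (σ.set x (e.eval σ)) ∧
      (∀ k τ, k < e.eval σ → I (k + 1) τ →
        P.wp ω L (fun τ' => τ'.reg x = k ∧ I k τ') (τ.set x k)) ∧
      ∀ τ, τ.reg x = 0 → I 0 τ → Q τ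

/-! #### Compilation -/

/-- Multiply the cell `t` by three and add the offset of the array; the cell `t + 1` is used. -/
def addrCode (A : Arr) (t : ℕ) : Program :=
  .seq (.instr (.const (t + 1) 3)) (.seq (.instr (.arith .mul t t (t + 1)))
    (.seq (.instr (.const (t + 1) (64 + A.idx))) (.instr (.arith .add t t (t + 1)))))

/-- Compute an expression into the cell `t`, with the cells above `t` as temporaries. -/
def Exp.compile : Exp → ℕ → Program
  | reg x, t => .seq (.instr (.const t 0)) (.instr (.arith .add t x.cell t))
  | lit k, t => .instr (.const t k)
  | op o a b, t => .seq (a.compile t) (.seq (b.compile (t + 1)) (.instr (.arith o t t (t + 1))))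
  | get A a, t => .seq (a.compile t) (.seq (addrCode A t) (.instr (.load t t)))

/-- The number of temporary cells that are needed. -/
def Exp.depth : Exp → ℕ
  | reg _ => 1
  | lit _ => 1
  | op _ a b => max a.depth (b.depth + 1)
  | get _ a => max a.depth 2

/-- The number of instructions that are executed. -/
def Exp.time : Exp → ℕ
  | reg _ => 2
  | lit _ => 1
  | op _ a b => a.time + b.time + 1
  | get _ a => a.time + 5

/-- Compute an expression and move its value to a scalar variable. -/
def asgCode (x : Reg) (e : Exp) : Program :=
  .seq (e.compile 32) (.seq (.instr (.const 33 0)) (.instr (.arith .add x.cell 32 33)))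

/-- The program of a command. -/
def Cmd.compile : Cmd → Program
  | asg x e => asgCode x e
  | put A a e => .seq (a.compile 32) (.seq (addrCode A 32)
      (.seq (e.compile 33) (.instr (.store 32 33))))
  | flip x => .instr (.flip x.cell)
  | emit e => .seq (e.compile 32) (.instr (.emit 32))
  | skip => .skip
  | seq P Q => .seq P.compile Q.compile
  | ite e P Q => .seq (e.compile 32) (.ite 32 P.compile Q.compile)
  | .down x e P => .seq (asgCode x e) (.loop x.cell (.seq
      (.seq (.instr (.const 32 1)) (.instr (.arith .sub x.cell x.cell 32))) P.compile))

/-- All expressions fit into the temporary cells. -/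
def Cmd.fits : Cmd → Bool
  | asg _ e => e.depth ≤ 30
  | put _ a e => a.depth ≤ 30 && e.depth ≤ 30
  | flip _ => true
  | emit e => e.depth ≤ 30
  | skip => true
  | seq P Q => P.fits && Q.fits
  | ite e P Q => e.depth ≤ 30 && P.fits && Q.fits
  | .down _ e P => e.depth ≤ 30 && P.fits

/-- The number of instructions that are executed if every loop is run at most `V` times. -/
def Cmd.time (V : ℕ) : Cmd → ℕ
  | asg _ e => e.time + 2
  | put _ a e => a.time + e.time + 5
  | flip _ => 1
  | emit e => e.time + 1
  | skip => 1
  | seq P Q => P.time V + Q.time V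
  | ite e P Q => e.time + 1 + max (P.time V) (Q.time V)
  | .down _ e P => e.time + 3 + V * (P.time V + 3)

/-- The bound on the number of bits in use. -/
def Lim.bits (L : Lim) : ℕ :=
  64 * (6 + Nat.size L.V) + 3 * L.A * (Nat.size (3 * L.A + 64) + Nat.size L.W)

/-- The bound on the cost of a single instruction. -/
def Lim.unit (L : Lim) : ℕ := 1 + 2 * Nat.size L.V

/-- A configuration within the bounds. -/
structure Okay (L : Lim) (s : Config) : Prop where
  low : ∀ a < 64, s.mem a < L.V
  high : ∀ a, 64 ≤ a → s.mem a ≠ 0 → a < 3 * L.A + 64 ∧ s.mem a < L.W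

theorem Okay.lt {L : Lim} {s : Config} (h : Okay L s) (a : ℕ) : s.mem a < L.V := by
  by_cases h0 : a < 64
  · exact h.low a h0
  · by_cases h1 : s.mem a = 0
    · have := L.hV; omega
    · exact (h.high a (by omega) h1).2.trans_le L.hW

theorem Okay.size_le {L : Lim} {s : Config} (h : Okay L s) (a : ℕ) :
    Nat.size (s.mem a) ≤ Nat.size L.V := Nat.size_le_size (h.lt a).le

/-- A configuration within the bounds uses at most `L.bits` bits: the cells below `64` hold numbers
below `V`, and the `3 A` cells behind them hold numbers below `W`. -/
theorem Okay.bits_le {L : Lim} {s : Config} (h : Okay L s) : s.bits ≤ L.bits := by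
  classical
  have hsub : s.mem.support ⊆ Finset.range (3 * L.A + 64) := by
    intro a ha
    have ha : s.mem a ≠ 0 := Finsupp.mem_support_iff.1 ha
    by_cases h0 : a < 64
    · exact Finset.mem_range.2 (by omega)
    · exact Finset.mem_range.2 (h.high a (by omega) ha).1
  have h6 : Nat.size 63 = 6 := by decide
  let g : ℕ → ℕ := fun a => if s.mem a = 0 then 0 else Nat.size a + Nat.size (s.mem a)
  have h1 : s.bits ≤ ∑ a ∈ Finset.range (3 * L.A + 64), g a := by
    unfold Config.bits Finsupp.sum
    refine le_trans (Finset.sum_le_sum fun a ha => ?_)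
      (Finset.sum_le_sum_of_subset (f := g) hsub)
    simp [g, Finsupp.mem_support_iff.1 ha]
  refine h1.trans ?_
  rw [add_comm, Finset.sum_range_add]
  unfold Lim.bits
  have h2 : ∑ a ∈ Finset.range 64, g a ≤ ∑ a ∈ Finset.range 64, (6 + Nat.size L.V) := by
    refine Finset.sum_le_sum fun a ha => ?_
    have ha := Finset.mem_range.1 ha
    have : Nat.size a ≤ 6 := h6 ▸ Nat.size_le_size (by omega : a ≤ 63)
    have := h.size_le a
    dsimp only [g]; split_ifs <;> omega
  have h3 : ∑ a ∈ Finset.range (3 * L.A), g (64 + a) ≤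
      ∑ a ∈ Finset.range (3 * L.A), (Nat.size (3 * L.A + 64) + Nat.size L.W) := by
    refine Finset.sum_le_sum fun a ha => ?_
    dsimp only [g]; split_ifs with h0
    · omega
    · have h1 := h.high (64 + a) (by omega) h0
      exact add_le_add (Nat.size_le_size h1.1.le) (Nat.size_le_size h1.2.le)
  simp only [Finset.sum_const, Finset.card_range, smul_eq_mul] at h2 h3
  exact add_le_add h2 h3

/-- The program runs from `s` to `s'` in at most `N` instructions and within the bounds. -/
def Runs (L : Lim) (ω : ℕ → Bool) (P : Program) (s : Config) (N : ℕ) (s' : Config) : Prop :=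
  ∃ t b, Exec ω P s t b s' ∧ t ≤ N * L.unit ∧ b ≤ L.bits

theorem Runs.mono {L : Lim} {ω : ℕ → Bool} {P : Program} {s s' : Config} {N N' : ℕ}
    (h : Runs L ω P s N s') (hN : N ≤ N') : Runs L ω P s N' s' := by
  obtain ⟨t, b, h1, h2, h3⟩ := h
  exact ⟨t, b, h1, h2.trans (Nat.mul_le_mul_right _ hN), h3⟩

theorem Runs.seq {L : Lim} {ω : ℕ → Bool} {P Q : Program} {s₁ s₂ s₃ : Config} {M N : ℕ}
    (h1 : Runs L ω P s₁ M s₂) (h2 : Runs L ω Q s₂ N s₃) :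
    Runs L ω (.seq P Q) s₁ (M + N) s₃ := by
  obtain ⟨t, b, a1, a2, a3⟩ := h1
  obtain ⟨t', b', b1, b2, b3⟩ := h2
  exact ⟨_, _, .seq a1 b1, by rw [add_mul]; omega, max_le a3 b3⟩

theorem Runs.const {L : Lim} {ω : ℕ → Bool} {s : Config} (h : Okay L s) {d k : ℕ} (hk : k < L.V)
    (h' : Okay L (s.write d k)) : Runs L ω (.instr (.const d k)) s 1 (s.write d k) := by
  refine ⟨_, _, .instr _ s, ?_, max_le h.bits_le h'.bits_le⟩
  have := Nat.size_le_size hk.le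
  simp only [Instr.cost, Lim.unit]; omega

theorem Runs.arith {L : Lim} {ω : ℕ → Bool} {s : Config} (h : Okay L s) {o : ArithOp} {d a b : ℕ}
    (h' : Okay L (s.write d (o.eval (s.mem a) (s.mem b)))) :
    Runs L ω (.instr (.arith o d a b)) s 1 (s.write d (o.eval (s.mem a) (s.mem b))) := by
  refine ⟨_, _, .instr _ s, ?_, max_le h.bits_le h'.bits_le⟩
  have := h.size_le a
  have := h.size_le b
  simp only [Instr.cost, Lim.unit]; omega

theorem Runs.load {L : Lim} {ω : ℕ → Bool} {s : Config} (h : Okay L s) {d a : ℕ}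
    (h' : Okay L (s.write d (s.mem (s.mem a)))) :
    Runs L ω (.instr (.load d a)) s 1 (s.write d (s.mem (s.mem a))) := by
  refine ⟨_, _, .instr _ s, ?_, max_le h.bits_le h'.bits_le⟩
  have := h.size_le a
  have := h.size_le (s.mem a)
  simp only [Instr.cost, Lim.unit]; omega

theorem Runs.store {L : Lim} {ω : ℕ → Bool} {s : Config} (h : Okay L s) {d a : ℕ}
    (h' : Okay L (s.write (s.mem d) (s.mem a))) :
    Runs L ω (.instr (.store d a)) s 1 (s.write (s.mem d) (s.mem a)) := by
  refine ⟨_, _, .instr _ s, ?_, max_le h.bits_le h'.bits_le⟩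
  have := h.size_le d
  have := h.size_le a
  simp only [Instr.cost, Lim.unit]; omega

theorem write_mem (s : Config) (a k b : ℕ) :
    (s.write a k).mem b = if b = a then k else s.mem b := by
  classical
  simp only [Config.write, Finsupp.update_apply]

theorem Okay.write_low {L : Lim} {s : Config} (h : Okay L s) {a k : ℕ} (ha : a < 64)
    (hk : k < L.V) : Okay L (s.write a k) where
  low b hb := by
    rw [write_mem]; split_ifs
    exacts [hk, h.low b hb]
  high b hb := by
    rw [write_mem, if_neg (by omega)]
    exact h.high b hb

theorem Okay.write_high {L : Lim} {s : Config} (h : Okay L s) {a k : ℕ} (ha : 64 ≤ a)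
    (ha' : a < 3 * L.A + 64) (hk : k < L.W) : Okay L (s.write a k) where
  low b hb := by
    rw [write_mem, if_neg (by omega)]
    exact h.low b hb
  high b hb := by
    rw [write_mem]; split_ifs with h0
    · exact fun _ => ⟨h0 ▸ ha', hk⟩
    · exact h.high b hb

/-- The configuration `s` represents the store `σ`. -/
structure Repr (s : Config) (σ : Store) : Prop where
  reg : ∀ x : Reg, s.mem x.cell = σ.reg x
  arr : ∀ (A : Arr) k, s.mem (A.addr k) = σ.arr A k
  coins : s.coins = σ.coins
  out : s.out = σ.out

/-- The configurations differ at most in the temporary cells from `t` on. -/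
structure SameBelow (t : ℕ) (s s' : Config) : Prop where
  mem : ∀ a, a < t ∨ 64 ≤ a → s'.mem a = s.mem a
  coins : s'.coins = s.coins
  out : s'.out = s.out

theorem SameBelow.trans {t : ℕ} {s₁ s₂ s₃ : Config} (h : SameBelow t s₁ s₂)
    (h' : SameBelow t s₂ s₃) : SameBelow t s₁ s₃ :=
  ⟨fun a ha => (h'.mem a ha).trans (h.mem a ha), h'.coins.trans h.coins, h'.out.trans h.out⟩

theorem SameBelow.mono {t t' : ℕ} {s s' : Config} (h : SameBelow t' s s') (ht : t ≤ t') :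
    SameBelow t s s' :=
  ⟨fun a ha => h.mem a (by omega), h.coins, h.out⟩

theorem SameBelow.write {t a : ℕ} (s : Config) (k : ℕ) (h : t ≤ a) (h' : a < 64) :
    SameBelow t s (s.write a k) :=
  ⟨fun b hb => by rw [write_mem, if_neg (by omega)], rfl, rfl⟩

theorem SameBelow.repr {t : ℕ} {s s' : Config} {σ : Store} (h : SameBelow t s s') (ht : 32 ≤ t)
    (hs : Repr s σ) : Repr s' σ where
  reg x := (h.mem _ (Or.inl (x.cell_lt.trans_le ht))).trans (hs.reg x)
  arr A k := (h.mem _ (Or.inr (A.le_addr k))).trans (hs.arr A k)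
  coins := h.coins.trans hs.coins
  out := h.out.trans hs.out

theorem Repr.bounded {L : Lim} {s : Config} {σ : Store} (h : Repr s σ) (hs : Okay L s) :
    σ.Bounded L where
  reg x := h.reg x ▸ hs.low _ (x.cell_lt.trans (by norm_num))
  arr A k hk := by
    rw [← h.arr] at hk ⊢
    have := hs.high _ (A.le_addr k) hk
    refine ⟨?_, this.2⟩
    have := this.1
    unfold Arr.addr at this; omega

theorem addrCode_runs {L : Lim} {ω : ℕ → Bool} (A : Arr) {t : ℕ} {s : Config} (hs : Okay L s)
    (ht : t + 2 ≤ 64) (hk : s.mem t < L.A) :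
    ∃ s', Runs L ω (addrCode A t) s 4 s' ∧ Okay L s' ∧ SameBelow t s s' ∧
      s'.mem t = A.addr (s.mem t) := by
  have hA := L.hA
  have hV := L.hV
  have hi : A.idx ≤ 2 := by cases A <;> simp [Arr.idx]
  have o1 := hs.write_low (a := t + 1) (k := 3) (by omega) (by omega)
  have r1 := Runs.const (ω := ω) hs (d := t + 1) (k := 3) (by omega) o1
  have o2 := o1.write_low (a := t)
    (k := ArithOp.eval .mul ((s.write (t + 1) 3).mem t) ((s.write (t + 1) 3).mem (t + 1)))
    (by omega) (by simp [write_mem, ArithOp.eval]; omega)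
  have r2 := Runs.arith (ω := ω) o1 o2
  have o3 := o2.write_low (a := t + 1) (k := 64 + A.idx) (by omega) (by omega)
  have r3 := Runs.const (ω := ω) o2 (d := t + 1) (k := 64 + A.idx) (by omega) o3
  set s3 := Config.write _ (t + 1) (64 + A.idx) with hs3
  have hv : ArithOp.eval .add (s3.mem t) (s3.mem (t + 1)) = A.addr (s.mem t) := by
    simp [hs3, write_mem, ArithOp.eval, Arr.addr]
  have o4 := o3.write_low (a := t) (k := ArithOp.eval .add (s3.mem t) (s3.mem (t + 1)))
    (by omega) (by rw [hv]; unfold Arr.addr; omega)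
  have r4 := Runs.arith (ω := ω) o3 (a := t) (b := t + 1) o4
  refine ⟨_, r1.seq (r2.seq (r3.seq r4)), o4, ?_, ?_⟩
  · exact (((SameBelow.write _ _ (by omega) (by omega)).trans
      (SameBelow.write _ _ (by omega) (by omega))).trans
      (SameBelow.write _ _ (by omega) (by omega))).trans
      (SameBelow.write _ _ (by omega) (by omega))
  · rw [write_mem, if_pos rfl, hv]

/-- The code of an expression leaves its value in the cell `t` and does not change the cells
below `t`. -/
theorem Exp.compile_runs {L : Lim} {ω : ℕ → Bool} {σ : Store} (e : Exp) {t : ℕ} {s : Config}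
    (hs : Okay L s) (hr : Repr s σ) (he : e.safe L σ) (ht : 32 ≤ t) (hd : t + e.depth ≤ 64) :
    ∃ s', Runs L ω (e.compile t) s e.time s' ∧ Okay L s' ∧ SameBelow t s s' ∧
      s'.mem t = e.eval σ := by
  have hV := L.hV
  induction e generalizing t s with
  | reg x =>
    have hx := x.cell_lt
    simp only [Exp.depth] at hd
    have o1 := hs.write_low (a := t) (k := 0) (by omega) (by omega)
    have r1 := Runs.const (ω := ω) hs (d := t) (k := 0) (by omega) o1
    have hv : ArithOp.eval .add ((s.write t 0).mem x.cell) ((s.write t 0).mem t) = σ.reg x := by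
      simp [write_mem, ArithOp.eval, show x.cell ≠ t by omega, hr.reg]
    have o2 := o1.write_low (a := t) (k := ArithOp.eval .add ((s.write t 0).mem x.cell)
      ((s.write t 0).mem t)) (by omega) (by rw [hv]; exact (hr.bounded hs).reg x)
    refine ⟨_, r1.seq (Runs.arith o1 o2), o2, ?_, ?_⟩
    · exact (SameBelow.write _ _ le_rfl (by omega)).trans (SameBelow.write _ _ le_rfl (by omega))
    · rw [write_mem, if_pos rfl, hv]; rfl
  | lit k =>
    simp only [Exp.depth] at hd
    have o1 := hs.write_low (a := t) (k := k) (by omega) he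
    refine ⟨_, Runs.const hs he o1, o1, SameBelow.write _ _ le_rfl (by omega), ?_⟩
    rw [write_mem, if_pos rfl]; rfl
  | op o a b iha ihb =>
    simp only [Exp.depth] at hd
    obtain ⟨s1, r1, o1, e1, v1⟩ := iha hs hr he.1 ht (by omega)
    obtain ⟨s2, r2, o2, e2, v2⟩ := ihb (t := t + 1) o1 (e1.repr ht hr) he.2.1 (by omega) (by omega)
    have hv : o.eval (s2.mem t) (s2.mem (t + 1)) = (Exp.op o a b).eval σ := by
      rw [v2, e2.mem t (by omega), v1]; rfl
    have hp : 0 < b.depth := by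
      clear * -
      induction b <;> simp [Exp.depth, *]
    have o3 := o2.write_low (a := t) (k := o.eval (s2.mem t) (s2.mem (t + 1))) (by omega)
      (by rw [hv]; exact Exp.eval_lt (hr.bounded hs) _ he)
    refine ⟨_, (r1.seq (r2.seq (Runs.arith o2 o3))).mono (by simp [Exp.time]; omega), o3, ?_, ?_⟩
    · exact (e1.trans (e2.mono (by omega))).trans (SameBelow.write _ _ le_rfl (by omega))
    · rw [write_mem, if_pos rfl, hv]
  | get A a iha =>
    simp only [Exp.depth] at hd
    obtain ⟨s1, r1, o1, e1, v1⟩ := iha hs hr he.1 ht (by omega)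
    obtain ⟨s2, r2, o2, e2, v2⟩ := addrCode_runs (ω := ω) A o1 (t := t) (by omega)
      (by rw [v1]; exact he.2)
    have hv : s2.mem (s2.mem t) = (Exp.get A a).eval σ := by
      rw [v2, v1, e2.mem _ (Or.inr (A.le_addr _)), e1.mem _ (Or.inr (A.le_addr _)), hr.arr]; rfl
    have o3 := o2.write_low (a := t) (k := s2.mem (s2.mem t)) (by omega) (o2.lt _)
    refine ⟨_, (r1.seq (r2.seq (Runs.load o2 o3))).mono (by simp [Exp.time]), o3, ?_, ?_⟩
    · exact (e1.trans e2).trans (SameBelow.write _ _ le_rfl (by omega))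
    · rw [write_mem, if_pos rfl, hv]

theorem Repr.set {s : Config} {σ : Store} (h : Repr s σ) (x : Reg) (k : ℕ) :
    Repr (s.write x.cell k) (σ.set x k) where
  reg y := by
    rw [write_mem, Store.set_reg]
    simp only [Reg.cell_injective.eq_iff, h.reg]
  arr A a := by
    have h1 := x.cell_lt
    have h2 := A.le_addr a
    rw [write_mem, if_neg (by omega)]; exact h.arr A a
  coins := h.coins
  out := h.out

theorem Repr.put {s : Config} {σ : Store} (h : Repr s σ) (A : Arr) (a k : ℕ) :
    Repr (s.write (A.addr a) k) (σ.put A a k) where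
  reg y := by
    have h1 := y.cell_lt
    have h2 := A.le_addr a
    rw [write_mem, if_neg (by omega)]; exact h.reg y
  arr B b := by
    rw [write_mem, Store.put_arr, h.arr]
    simp only [Arr.addr_inj]
  coins := h.coins
  out := h.out

theorem asgCode_runs {L : Lim} {ω : ℕ → Bool} {σ : Store} (x : Reg) (e : Exp) {s : Config}
    (hs : Okay L s) (hr : Repr s σ) (he : e.safe L σ) (hd : e.depth ≤ 30) :
    ∃ s', Runs L ω (asgCode x e) s (e.time + 2) s' ∧ Okay L s' ∧
      Repr s' (σ.set x (e.eval σ)) := by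
  have hV := L.hV
  obtain ⟨s1, r1, o1, e1, v1⟩ := e.compile_runs (ω := ω) hs hr he le_rfl (by omega)
  have o2 := o1.write_low (a := 33) (k := 0) (by omega) (by omega)
  have r2 := Runs.const (ω := ω) o1 (d := 33) (k := 0) (by omega) o2
  have hv : ArithOp.eval .add ((s1.write 33 0).mem 32) ((s1.write 33 0).mem 33) = e.eval σ := by
    simp [write_mem, ArithOp.eval, v1]
  have o3 := o2.write_low (a := x.cell) (x.cell_lt.trans (by norm_num))
    (k := ArithOp.eval .add ((s1.write 33 0).mem 32) ((s1.write 33 0).mem 33))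
    (by rw [hv]; exact Exp.eval_lt (hr.bounded hs) _ he)
  refine ⟨_, r1.seq (r2.seq (Runs.arith o2 o3)), o3, ?_⟩
  rw [hv]
  exact Repr.set (((e1.trans (SameBelow.write _ _ (by omega) (by omega)))).repr le_rfl hr) x _

/-- A loop whose counter goes down to zero, with an invariant `I` that is indexed by the counter.
The body has to preserve the counter, which is decreased before each pass. -/
theorem loop_runs {L : Lim} {ω : ℕ → Bool} {x : Reg} {P : Program} {N : ℕ}
    {I : ℕ → Store → Prop} {m : ℕ}
    (H : ∀ k < m, ∀ (s : Config) (τ : Store), Okay L s → Repr s (τ.set x k) → I (k + 1) τ →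
      ∃ s' τ', Runs L ω P s N s' ∧ Okay L s' ∧ Repr s' τ' ∧ τ'.reg x = k ∧ I k τ') :
    ∀ k ≤ m, ∀ (s : Config) (τ : Store), Okay L s → Repr s τ → τ.reg x = k → I k τ →
      ∃ s' τ', Runs L ω (.loop x.cell (.seq (.seq (.instr (.const 32 1))
        (.instr (.arith .sub x.cell x.cell 32))) P)) s (k * (N + 3) + 1) s' ∧
        Okay L s' ∧ Repr s' τ' ∧ τ'.reg x = 0 ∧ I 0 τ' := by
  have hV := L.hV
  have hx := x.cell_lt
  intro k
  induction k with
  | zero =>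
    intro _ s τ hs hr h0 hI
    refine ⟨s, τ, ⟨1, _, .loop_done ((hr.reg x).trans h0), ?_, hs.bits_le⟩, hs, hr, h0, hI⟩
    simp [Lim.unit]
  | succ k ih =>
    intro hk s τ hs hr h0 hI
    have o1 := hs.write_low (a := 32) (k := 1) (by omega) (by omega)
    have r1 := Runs.const (ω := ω) hs (d := 32) (k := 1) (by omega) o1
    have hv : ArithOp.eval .sub ((s.write 32 1).mem x.cell) ((s.write 32 1).mem 32) = k := by
      simp [write_mem, ArithOp.eval, show x.cell ≠ 32 by omega, hr.reg, h0]
    have hkV : k < L.V := by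
      have := (hr.bounded hs).reg x
      omega
    have o2 := o1.write_low (a := x.cell)
      (k := ArithOp.eval .sub ((s.write 32 1).mem x.cell) ((s.write 32 1).mem 32))
      (by omega) (by omega)
    have r2 := Runs.arith (ω := ω) o1 o2
    have hr1 : Repr (s.write 32 1) τ :=
      (SameBelow.write s 1 le_rfl (by omega : 32 < 64)).repr le_rfl hr
    have hr2 := hr1.set x k
    rw [← hv] at hr2
    nth_rewrite 2 [hv] at hr2
    obtain ⟨s3, τ3, r3, o3, p3, q3, i3⟩ := H k (by omega) _ τ o2 hr2 hI
    obtain ⟨s4, τ4, ⟨t4, b4, x4, y4, z4⟩, o4, p4, q4, i4⟩ := ih (by omega) s3 τ3 o3 p3 q3 i3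
    obtain ⟨t3, b3, x3, y3, z3⟩ := (r1.seq r2).seq r3
    refine ⟨s4, τ4, ⟨_, _, .loop_step ?_ x3 x4, ?_, max_le z3 z4⟩, o4, p4, q4, i4⟩
    · rw [hr.reg, h0]; omega
    · have h1 : Nat.size (s.mem x.cell) ≤ Nat.size L.V := hs.size_le _
      have h2 : 1 + Nat.size (s.mem x.cell) ≤ L.unit := by unfold Lim.unit; omega
      calc _ ≤ L.unit + (1 + 1 + N) * L.unit + (k * (N + 3) + 1) * L.unit := by omega
        _ = _ := by ring

/-- Soundness of weakest preconditions: the compiled program terminates within the bounds and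
establishes the postcondition. -/
theorem Cmd.compile_runs {L : Lim} {ω : ℕ → Bool} (P : Cmd) {Q : Store → Prop} {s : Config}
    {σ : Store} (hP : P.fits = true) (hs : Okay L s) (hr : Repr s σ) (hw : P.wp ω L Q σ) :
    ∃ s' σ', Runs L ω P.compile s (P.time L.V) s' ∧ Okay L s' ∧ Repr s' σ' ∧ Q σ' := by
  have hV := L.hV
  induction P generalizing Q s σ with
  | asg x e =>
    obtain ⟨s1, r1, o1, p1⟩ := asgCode_runs (ω := ω) x e hs hr hw.1 (by simpa [Cmd.fits] using hP)
    exact ⟨s1, _, r1, o1, p1, hw.2⟩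
  | put A a e =>
    simp only [Cmd.fits, Bool.and_eq_true, decide_eq_true_eq] at hP
    obtain ⟨h1, h2, h3, h4, h5⟩ := hw
    obtain ⟨s1, r1, o1, e1, v1⟩ := a.compile_runs (ω := ω) hs hr h1 le_rfl (by omega)
    obtain ⟨s2, r2, o2, e2, v2⟩ := addrCode_runs (ω := ω) A o1 (t := 32) (by omega)
      (by rw [v1]; exact h3)
    have e12 := e1.trans e2
    obtain ⟨s3, r3, o3, e3, v3⟩ := e.compile_runs (ω := ω) (t := 33) o2 (e12.repr le_rfl hr) h2
      (by omega) (by omega)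
    have hm : s3.mem 32 = A.addr (a.eval σ) := by rw [e3.mem 32 (by omega), v2, v1]
    have o4 := o3.write_high (a := s3.mem 32) (k := s3.mem 33)
      (by rw [hm]; exact A.le_addr _)
      (by rw [hm]; unfold Arr.addr; have : A.idx ≤ 2 := by cases A <;> simp [Arr.idx]
          omega) (by rw [v3]; exact h4)
    refine ⟨_, _, (r1.seq (r2.seq (r3.seq (Runs.store o3 o4)))).mono
      (by simp only [Cmd.time]; omega), o4, ?_, h5⟩
    rw [hm, v3]
    exact Repr.put ((e12.trans (e3.mono (by omega))).repr le_rfl hr) A _ _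
  | flip x =>
    have hb : (ω σ.coins).toNat < L.V := (Bool.toNat_le _).trans_lt (by omega)
    rw [← hr.coins] at hb
    have hx := x.cell_lt
    have o1 := hs.write_low (a := x.cell) (by omega) hb
    have o2 : Okay L { s.write x.cell (ω s.coins).toNat with coins := s.coins + 1 } :=
      ⟨o1.low, o1.high⟩
    refine ⟨_, _, ⟨_, _, .instr _ _, ?_, max_le hs.bits_le o2.bits_le⟩, o2, ?_, hw⟩
    · simp [Instr.cost, Cmd.time, Lim.unit]
    · have := hr.set x (ω s.coins).toNat
      exact ⟨fun y => (this.reg y).trans (by rw [hr.coins]), this.arr,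
        congrArg (· + 1) hr.coins, hr.out⟩
  | emit e =>
    obtain ⟨s1, r1, o1, e1, v1⟩ := e.compile_runs (ω := ω) hs hr hw.1 le_rfl
      (by have := hP; simp [Cmd.fits] at this; omega)
    have o2 : Okay L { s1 with out := s1.out ++ [s1.mem 32] } := ⟨o1.low, o1.high⟩
    have r2 : Runs L ω (.instr (.emit 32)) s1 1 { s1 with out := s1.out ++ [s1.mem 32] } := by
      refine ⟨_, _, .instr _ _, ?_, max_le o1.bits_le o2.bits_le⟩
      have := o1.size_le 32
      simp only [Instr.cost, Lim.unit]; omega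
    have hr1 := e1.repr le_rfl hr
    refine ⟨_, _, r1.seq r2, o2, ?_, hw.2⟩
    exact ⟨hr1.reg, hr1.arr, hr1.coins, by simp [hr1.out, v1]⟩
  | skip =>
    exact ⟨s, σ, ⟨_, _, .skip s, by simp [Cmd.time, Lim.unit], hs.bits_le⟩, hs, hr, hw⟩
  | seq P R ihP ihR =>
    simp only [Cmd.fits, Bool.and_eq_true] at hP
    obtain ⟨s1, σ1, r1, o1, p1, q1⟩ := ihP hP.1 hs hr hw
    obtain ⟨s2, σ2, r2, o2, p2, q2⟩ := ihR hP.2 o1 p1 q1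
    exact ⟨s2, σ2, r1.seq r2, o2, p2, q2⟩
  | ite e P R ihP ihR =>
    simp only [Cmd.fits, Bool.and_eq_true, decide_eq_true_eq] at hP
    obtain ⟨s1, r1, o1, e1, v1⟩ := e.compile_runs (ω := ω) hs hr hw.1 le_rfl (by omega)
    have p1 := e1.repr le_rfl hr
    have h1 : 1 + Nat.size (s1.mem 32) ≤ L.unit := by
      have := o1.size_le 32
      unfold Lim.unit; omega
    by_cases h0 : e.eval σ = 0
    · obtain ⟨s2, σ2, ⟨t2, b2, x2, y2, z2⟩, o2, p2, q2⟩ := ihR hP.2 o1 p1 (hw.2.2 h0)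
      refine ⟨s2, σ2, (r1.seq (N := 1 + R.time L.V)
        ⟨_, _, .ite_false (v1.trans h0) x2, ?_, z2⟩).mono ?_, o2, p2, q2⟩
      · rw [add_mul]; omega
      · simp only [Cmd.time]; omega
    · obtain ⟨s2, σ2, ⟨t2, b2, x2, y2, z2⟩, o2, p2, q2⟩ := ihP hP.1.2 o1 p1 (hw.2.1 h0)
      refine ⟨s2, σ2, (r1.seq (N := 1 + P.time L.V)
        ⟨_, _, .ite_true (by rwa [v1]) x2, ?_, z2⟩).mono ?_, o2, p2, q2⟩
      · rw [add_mul]; omega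
      · simp only [Cmd.time]; omega
  | down x e P ih =>
    simp only [Cmd.fits, Bool.and_eq_true, decide_eq_true_eq] at hP
    obtain ⟨h1, I, h2, h3, h4⟩ := hw
    obtain ⟨s1, r1, o1, p1⟩ := asgCode_runs (ω := ω) x e hs hr h1 hP.1
    obtain ⟨s2, σ2, r2, o2, p2, q2, i2⟩ := loop_runs (L := L) (ω := ω) (x := x)
      (P := P.compile) (N := P.time L.V) (I := I) (m := e.eval σ)
      (fun k hk s τ hs hr hI => by
        obtain ⟨s', τ', a1, a2, a3, a4⟩ := ih hP.2 hs hr (h3 k τ hk hI)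
        exact ⟨s', τ', a1, a2, a3, a4⟩) _ le_rfl s1 _ o1 p1 (by simp) h2
    have := Exp.eval_lt (hr.bounded hs) e h1
    refine ⟨s2, σ2, (r1.seq r2).mono ?_, o2, p2, h4 _ q2 i2⟩
    simp only [Cmd.time]
    have := Nat.mul_le_mul_right (P.time L.V + 3) this.le
    omega

/-- The nesting depth of the loops of a command. -/
def Cmd.nesting : Cmd → ℕ
  | seq P Q => max P.nesting Q.nesting
  | ite _ P Q => max P.nesting Q.nesting
  | .down _ _ P => P.nesting + 1
  | _ => 0

/-- A program with loops nested `m` deep takes time `O(V ^ m)`, with a constant that is its time when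
no loop runs more than once. -/
theorem Cmd.time_le {V : ℕ} (hV : 1 ≤ V) (P : Cmd) {m : ℕ} (hm : P.nesting ≤ m) :
    P.time V ≤ P.time 1 * V ^ m := by
  have h1 : ∀ m, 1 ≤ V ^ m := fun m => Nat.one_le_pow _ _ hV
  induction P generalizing m with
  | asg x e => exact Nat.le_mul_of_pos_right _ (h1 m)
  | put A a e => exact Nat.le_mul_of_pos_right _ (h1 m)
  | flip x => exact Nat.le_mul_of_pos_right _ (h1 m)
  | emit e => exact Nat.le_mul_of_pos_right _ (h1 m)
  | skip => exact Nat.le_mul_of_pos_right _ (h1 m)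
  | seq P Q ihP ihQ =>
    simp only [Cmd.nesting] at hm
    simp only [Cmd.time, add_mul]
    exact add_le_add (ihP (by omega)) (ihQ (by omega))
  | ite e P Q ihP ihQ =>
    simp only [Cmd.nesting] at hm
    have h2 := ihP (m := m) (by omega)
    have h3 := ihQ (m := m) (by omega)
    have h4 := Nat.le_mul_of_pos_right (e.time + 1) (h1 m)
    simp only [Cmd.time, add_mul (e.time + 1)]
    refine add_le_add h4 (max_le (h2.trans ?_) (h3.trans ?_))
    · exact Nat.mul_le_mul_right _ (le_max_left _ _)
    · exact Nat.mul_le_mul_right _ (le_max_right _ _)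
  | down x e P ih =>
    simp only [Cmd.nesting] at hm
    obtain ⟨m, rfl⟩ : ∃ k, m = k + 1 := ⟨m - 1, by omega⟩
    have h2 := ih (m := m) (by omega)
    have h4 := Nat.le_mul_of_pos_right (e.time + 3) (h1 (m + 1))
    simp only [Cmd.time, add_mul (e.time + 3), one_mul]
    refine add_le_add h4 ?_
    calc V * (P.time V + 3) ≤ V * (P.time 1 * V ^ m + 3 * V ^ m) := by
          gcongr; exact Nat.le_mul_of_pos_right _ (h1 m)
      _ = _ := by ring

end Imp

/-! ### The streaming program -/

namespace Imp

section Eval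

variable (L : Lim) (σ : Store)

@[simp] theorem Exp.eval_reg (x : Reg) : (Exp.reg x).eval σ = σ.reg x := rfl
@[simp] theorem Exp.eval_lit (k : ℕ) : (Exp.lit k).eval σ = k := rfl
@[simp] theorem Exp.eval_ofNat (k : ℕ) : (no_index (OfNat.ofNat k) : Exp).eval σ = k := rfl
@[simp] theorem Exp.eval_add (a b : Exp) : (a + b).eval σ = a.eval σ + b.eval σ := rfl
@[simp] theorem Exp.eval_sub (a b : Exp) : (a - b).eval σ = a.eval σ - b.eval σ := rfl
@[simp] theorem Exp.eval_mul (a b : Exp) : (a * b).eval σ = a.eval σ * b.eval σ := rfl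
@[simp] theorem Exp.eval_div (a b : Exp) : (a / b).eval σ = a.eval σ / b.eval σ := rfl
@[simp] theorem Exp.eval_mod (a b : Exp) : (a % b).eval σ = a.eval σ % b.eval σ := rfl
@[simp] theorem Exp.eval_get (A : Arr) (a : Exp) :
    (Exp.get A a).eval σ = σ.arr A (a.eval σ) := rfl

@[simp] theorem Exp.safe_reg (x : Reg) : (Exp.reg x).safe L σ := trivial
@[simp] theorem Exp.safe_lit (k : ℕ) : (Exp.lit k).safe L σ ↔ k < L.V := Iff.rfl
@[simp] theorem Exp.safe_ofNat (k : ℕ) : (no_index (OfNat.ofNat k) : Exp).safe L σ ↔ k < L.V := Iff.rfl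
@[simp] theorem Exp.safe_add (a b : Exp) : (a + b).safe L σ ↔
    a.safe L σ ∧ b.safe L σ ∧ a.eval σ + b.eval σ < L.V := Iff.rfl
@[simp] theorem Exp.safe_mul (a b : Exp) : (a * b).safe L σ ↔
    a.safe L σ ∧ b.safe L σ ∧ a.eval σ * b.eval σ < L.V := Iff.rfl
@[simp] theorem Exp.safe_sub (a b : Exp) : (a - b).safe L σ ↔ a.safe L σ ∧ b.safe L σ := by
  change a.safe L σ ∧ b.safe L σ ∧ True ↔ _; rw [and_true]
@[simp] theorem Exp.safe_div (a b : Exp) : (a / b).safe L σ ↔ a.safe L σ ∧ b.safe L σ := by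
  change a.safe L σ ∧ b.safe L σ ∧ True ↔ _; rw [and_true]
@[simp] theorem Exp.safe_mod (a b : Exp) : (a % b).safe L σ ↔ a.safe L σ ∧ b.safe L σ := by
  change a.safe L σ ∧ b.safe L σ ∧ True ↔ _; rw [and_true]
@[simp] theorem Exp.safe_get (A : Arr) (a : Exp) : (Exp.get A a).safe L σ ↔
    a.safe L σ ∧ a.eval σ < L.A := Iff.rfl

end Eval

/-- Two stores that agree except possibly for the scalars in a given list. -/
structure EqOff (F : List Reg) (σ τ : Store) : Prop where
  reg : ∀ x, x ∉ F → τ.reg x = σ.reg x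
  arr : τ.arr = σ.arr
  coins : τ.coins = σ.coins
  out : τ.out = σ.out

theorem EqOff.refl (F : List Reg) (σ : Store) : EqOff F σ σ := ⟨fun _ _ => rfl, rfl, rfl, rfl⟩

theorem EqOff.set {F : List Reg} {σ τ : Store} (h : EqOff F σ τ) {x : Reg} (hx : x ∈ F) (k : ℕ) :
    EqOff F σ (τ.set x k) :=
  ⟨fun y hy => by
    rw [Store.set_reg, if_neg (by rintro rfl; exact hy hx)]; exact h.reg y hy, h.arr, h.coins, h.out⟩

theorem EqOff.trans {F F' : List Reg} {σ τ ρ : Store} (h : EqOff F σ τ) (h' : EqOff F' τ ρ)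
    (hF : F' ⊆ F) : EqOff F σ ρ :=
  ⟨fun x hx => (h'.reg x fun e => hx (hF e)).trans (h.reg x hx), h'.arr.trans h.arr,
    h'.coins.trans h.coins, h'.out.trans h.out⟩

/-! #### Parameters -/

/-- The binary length of `n`, which is the index of the highest sampling level. -/
abbrev len (n : ℕ) : ℕ := Nat.size n

/-- The expected number of sampled edges that are aimed at for every vertex. -/
def lam (c n : ℕ) : ℕ := min (c * len n * len n) n

theorem exists_prime_ge (n : ℕ) : ∃ p, 2 * (n + 2) * (n + 2) ≤ p ∧ p.Prime :=
  Nat.exists_infinite_primes _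

/-- The field size: the least prime that is at least `2 (n + 2)²`. -/
def prm (n : ℕ) : ℕ := Nat.find (exists_prime_ge n)

theorem prm_prime (n : ℕ) : (prm n).Prime := (Nat.find_spec (exists_prime_ge n)).2

theorem le_prm (n : ℕ) : 2 * (n + 2) * (n + 2) ≤ prm n := (Nat.find_spec (exists_prime_ge n)).1

theorem prm_le (n : ℕ) : prm n ≤ 4 * (n + 2) * (n + 2) := by
  obtain ⟨q, h1, h2, h3⟩ := Nat.exists_prime_lt_and_le_two_mul (2 * (n + 2) * (n + 2))
    (by positivity)
  exact (Nat.find_min' (exists_prime_ge n) ⟨h2.le, h1⟩).trans (h3.trans (le_of_eq (by ring)))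

/-- A common bound for the linear and quadratic quantities that the program handles. -/
def quad (n : ℕ) : ℕ := 8 * ((n + 2) * (n + 2))

theorem lam_le (c n : ℕ) : lam c n ≤ n := min_le_right _ _

theorem len_le (n : ℕ) : len n ≤ n := Nat.size_le.2 Nat.lt_two_pow_self

theorem mul_le_quad {n a b : ℕ} (ha : a ≤ n + 2) (hb : b ≤ n + 2) : 8 * (a * b) ≤ quad n :=
  Nat.mul_le_mul_left _ (Nat.mul_le_mul ha hb)

theorem linear_le_quad (n : ℕ) : 16 * (n + 2) ≤ quad n := by
  unfold quad; nlinarith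

theorem prm_le_quad (n : ℕ) : 2 * prm n ≤ quad n := by
  have := prm_le n
  unfold quad; linarith

theorem linear_le_prm (n : ℕ) : 4 * (n + 2) ≤ prm n := by
  have := le_prm n
  nlinarith

/-- The memory bounds for `n` vertices; `c` is the constant of the program. -/
def lim (c n : ℕ) : Lim where
  V := (c + 1) * (64 * (quad n * quad n))
  A := n * (len n + 1) * (2 * lam c n + 1)
  W := 4 * (n + 2) * (n + 2) + 1
  hV := by
    have := linear_le_quad n
    nlinarith [Nat.zero_le c, Nat.mul_le_mul (by omega : 16 ≤ quad n) (by omega : 16 ≤ quad n)]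
  hA := by
    have h1 := linear_le_quad n
    have h2 := mul_le_quad (n := n) (a := n) (b := len n + 1) (by omega)
      (by have := len_le n; omega)
    have h3 := lam_le c n
    have h4 : n * (len n + 1) * (2 * lam c n + 1) ≤ quad n * quad n :=
      Nat.mul_le_mul (by omega) (by omega)
    have h5 : 16 * 16 ≤ quad n * quad n := Nat.mul_le_mul (by omega) (by omega)
    nlinarith [Nat.zero_le (c * (64 * (quad n * quad n)))]
  hW := by
    have h1 := linear_le_quad n
    have h2 : 16 * quad n ≤ quad n * quad n := Nat.mul_le_mul_right _ (by omega)
    have h3 : 4 * (n + 2) * (n + 2) + 1 ≤ quad n := by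
      unfold quad at *; nlinarith
    nlinarith [Nat.zero_le (c * (64 * (quad n * quad n)))]

theorem mul_add_lt_lim {c n a b : ℕ} (ha : a ≤ quad n) (hb : b ≤ quad n) :
    a * b + 4 * quad n < (lim c n).V := by
  have h1 := linear_le_quad n
  have h2 := Nat.mul_le_mul ha hb
  have h3 : 16 * quad n ≤ quad n * quad n := Nat.mul_le_mul_right _ (by omega)
  have h4 : 0 < quad n * quad n := by nlinarith
  change _ < (c + 1) * (64 * (quad n * quad n))
  nlinarith [Nat.zero_le (c * (64 * (quad n * quad n)))]

theorem quad_lt_lim (c n : ℕ) : 4 * quad n < (lim c n).V := by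
  simpa using mul_add_lt_lim (c := c) (n := n) (a := 0) (b := 0) (by omega) (by omega)

theorem prm_lt_lim (c n : ℕ) : prm n < (lim c n).W := Nat.lt_succ_of_le (prm_le n)

theorem row_lt {n m v l : ℕ} (hv : v < n) (hl : l < m) : v * m + l < n * m := by
  calc v * m + l < v * m + m := by omega
    _ = (v + 1) * m := by ring
    _ ≤ n * m := Nat.mul_le_mul_right _ hv

theorem row_inj {m v l v' l' : ℕ} (hl : l < m) (hl' : l' < m) :
    v * m + l = v' * m + l' ↔ v = v' ∧ l = l' := by
  constructor
  · intro h
    have h1 : (v * m + l) / m = v := by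
      rw [Nat.mul_comm, Nat.mul_add_div (by omega), Nat.div_eq_of_lt hl, add_zero]
    have h2 : (v' * m + l') / m = v' := by
      rw [Nat.mul_comm, Nat.mul_add_div (by omega), Nat.div_eq_of_lt hl', add_zero]
    have h3 : v = v' := by rw [← h1, ← h2, h]
    subst h3
    exact ⟨rfl, by omega⟩
  · rintro ⟨rfl, rfl⟩; rfl

theorem rows_le_quad (n : ℕ) : n * (len n + 1) ≤ quad n := by
  have := mul_le_quad (n := n) (a := n) (b := len n + 1) (by omega)
    (by have := len_le n; omega)
  omega

/-! #### The setup -/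

/-- The binary length of `n`. -/
def lenCmd : Cmd := .block
  [.asg .len 0, .asg .t Reg.n,
   .down .i Reg.n (.ite Reg.t (.seq (.asg .t (Reg.t / 2)) (.asg .len (Reg.len + 1))) .skip)]

/-- The sampling parameter. -/
def lamCmd (c : ℕ) : Cmd :=
  .seq (.asg .lam (Exp.lit c * Reg.len * Reg.len))
    (.ite ((Reg.n : Exp) - Reg.lam) .skip (.asg .lam Reg.n))

/-- The search for a prime by trial division. -/
def primeCmd : Cmd :=
  .seq (.asg .p (2 * (Reg.n + 2) * (Reg.n + 2)))
    (.down .i Reg.p (.block [.asg .f 0,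
      .down .d (Reg.p - 2) (.ite (Reg.p % (Reg.d + 2)) .skip (.asg .f 1)),
      .ite Reg.f (.asg .p (Reg.p + 1)) .skip]))

/-- The random choice of the coefficients of the hash polynomial. -/
def coefCmd : Cmd :=
  .down .i (2 * Reg.n * Reg.lam) (.block [.asg .t 0,
    .down .j (4 * Reg.len + 7) (.seq (.flip .b) (.asg .t (2 * Reg.t + Reg.b))),
    .put .coef Reg.i ((Reg.t : Exp) % Reg.p)])

/-- All sketches are set to the empty product. -/
def onesCmd : Cmd :=
  .down .i (Reg.n * (Reg.len + 1) * (2 * Reg.lam + 1)) (.put .sk Reg.i 1)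

/-- The program that is run before the stream. -/
def setupCmd (c : ℕ) : Cmd := .block [lenCmd, lamCmd c, primeCmd, coefCmd, onesCmd]

/-- The number with the binary digits `ω s, …, ω (s + m - 1)`. -/
def blockVal (ω : ℕ → Bool) (s : ℕ) : ℕ → ℕ
  | 0 => 0
  | m + 1 => 2 * blockVal ω s m + (ω (s + m)).toNat

theorem blockVal_lt (ω : ℕ → Bool) (s m : ℕ) : blockVal ω s m < 2 ^ m := by
  induction m with
  | zero => simp [blockVal]
  | succ m ih =>
    have := Bool.toNat_le (ω (s + m))
    simp only [blockVal, pow_succ]; omega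

/-- The number of coefficients of the hash polynomial. -/
abbrev deg (c n : ℕ) : ℕ := 2 * n * lam c n

/-- The number of coins that are flipped for a coefficient. -/
abbrev width (n : ℕ) : ℕ := 4 * len n + 7

/-- The coefficients of the hash polynomial as a function of the coins. -/
def coefs (ω : ℕ → Bool) (c n i : ℕ) : ℕ :=
  blockVal ω ((deg c n - 1 - i) * width n) (width n) % prm n

theorem two_pow_width_lt (c : ℕ) {n : ℕ} (hn : 1 ≤ n) : 2 ^ width n < (lim c n).V := by
  have h0 : 0 < len n := Nat.size_pos.2 hn
  have h1 : 2 ^ (len n - 1) ≤ n := Nat.lt_size.1 (Nat.sub_lt h0 one_pos)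
  have h2 : 2 ^ len n ≤ 2 * n := by
    obtain ⟨k, hk⟩ : ∃ k, len n = k + 1 := ⟨len n - 1, by omega⟩
    rw [hk] at h1 ⊢
    rw [pow_succ]; simp only [Nat.add_sub_cancel] at h1; omega
  have h3 : 2 ^ width n = (2 ^ len n * 2 ^ len n) * (2 ^ len n * 2 ^ len n) * 128 := by
    unfold width; ring
  have h4 := Nat.mul_le_mul h2 h2
  have h5 := Nat.mul_le_mul h4 h4
  have h6 : 2 * n * (2 * n) * 2 + 1 ≤ quad n := by unfold quad; nlinarith
  have h7 := Nat.mul_le_mul h6 h6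
  rw [h3]
  change _ < (c + 1) * (64 * (quad n * quad n))
  nlinarith [Nat.zero_le (c * (64 * (quad n * quad n)))]

section Setup

variable {ω : ℕ → Bool} {c n : ℕ} {σ : Store} {Q : Store → Prop}

theorem lenCmd_wp (h1 : σ.reg .n = n)
    (hQ : ∀ τ, EqOff [.len, .t, .i] σ τ → τ.reg .len = len n → Q τ) :
    lenCmd.wp ω (lim c n) Q σ := by
  have hq := quad_lt_lim c n
  have hl := linear_le_quad n
  have hn := len_le n
  simp only [lenCmd, Cmd.block, Cmd.wp]
  refine ⟨by simp; omega, by simp, by simp, fun k τ => EqOff [.len, .t, .i] σ τ ∧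
    τ.reg .t ≤ k ∧ Nat.size (τ.reg .t) + τ.reg .len = len n, ?_, ?_, ?_⟩
  · exact ⟨(((EqOff.refl _ σ).set (by simp) _).set (by simp) _).set (by simp) _, by simp, by
      simp [h1]⟩
  · rintro k τ - ⟨h2, h3, h4⟩
    refine ⟨by simp, fun h0 => ?_, fun h0 => ?_⟩
    · have h5 : Nat.size (τ.reg .t) = Nat.size (τ.reg .t / 2) + 1 := by
        have h0 : τ.reg .t ≠ 0 := by simpa using h0
        conv_lhs => rw [← Nat.bit_bodd_div2 (τ.reg .t)]
        rw [Nat.size_bit, Nat.div2_val]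
        rw [Nat.bit_bodd_div2]; exact h0
      refine ⟨by simp; omega, by simp; omega, by simp, ?_, ?_, ?_⟩
      · exact ((h2.set (by simp) _).set (by simp) _).set (by simp) _
      · simp; omega
      · simp; omega
    · have h0 : τ.reg .t = 0 := by simpa using h0
      refine ⟨by simp, h2.set (by simp) _, by simp [h0], by simpa using h4⟩
  · rintro τ - ⟨h2, h3, h4⟩
    refine hQ τ h2 ?_
    have h3 : τ.reg .t = 0 := by omega
    simpa [h3] using h4

theorem lamCmd_wp (hc : 1 ≤ n) (h1 : σ.reg .n = n) (h2 : σ.reg .len = len n)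
    (hQ : ∀ τ, EqOff [.lam] σ τ → τ.reg .lam = lam c n → Q τ) :
    (lamCmd c).wp ω (lim c n) Q σ := by
  have hn := len_le n
  have hV : (c + 1) * (len n * len n) < (lim c n).V := by
    have h3 := mul_le_quad (n := n) (a := len n) (b := len n) (by omega) (by omega)
    have h4 := linear_le_quad n
    have h5 : 16 * quad n ≤ quad n * quad n := Nat.mul_le_mul_right _ (by omega)
    change _ < (c + 1) * (64 * (quad n * quad n))
    exact Nat.mul_lt_mul_of_pos_left (by omega) (by omega)
  have hp : 0 < len n := Nat.size_pos.2 hc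
  have hle : 1 * 1 ≤ len n * len n := Nat.mul_le_mul hp hp
  simp only [lamCmd, Cmd.wp, Exp.safe_mul, Exp.safe_lit, Exp.eval_mul, Exp.eval_lit, Exp.eval_reg,
    Exp.safe_reg, Exp.safe_sub, Exp.eval_sub, Store.set_reg, h1, h2]
  refine ⟨⟨⟨by nlinarith, trivial, by nlinarith⟩, trivial, by nlinarith⟩, ⟨trivial, trivial⟩, ?_, ?_⟩
  · intro h0
    refine hQ _ ((EqOff.refl _ σ).set (by simp) _) ?_
    have h0 : n - c * len n * len n ≠ 0 := by simpa using h0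
    simp [lam]; omega
  · intro h0
    refine ⟨trivial, hQ _ (((EqOff.refl _ σ).set (by simp) _).set (by simp) _) ?_⟩
    have h0 : n - c * len n * len n = 0 := by simpa using h0
    simp [lam]; omega

theorem trial_division {p : ℕ} (hp : 2 ≤ p) :
    (∃ d < p - 2, p % (d + 2) = 0) ↔ ¬ p.Prime := by
  constructor
  · rintro ⟨d, hd, h0⟩ h
    rcases (Nat.dvd_prime h).1 (Nat.dvd_of_mod_eq_zero h0) with h1 | h1 <;> omega
  · intro h
    have h1 := (Nat.not_prime_iff_minFac_lt hp).1 h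
    have h2 := (Nat.minFac_prime (n := p) (by omega)).two_le
    exact ⟨p.minFac - 2, by omega, by
      rw [Nat.sub_add_cancel h2]; exact Nat.mod_eq_zero_of_dvd (Nat.minFac_dvd p)⟩

/-- The search stops before `4 (n + 2)²` by Bertrand's postulate, so that it needs no unbounded loop. -/
theorem primeCmd_wp (h1 : σ.reg .n = n)
    (hQ : ∀ τ, EqOff [.p, .i, .f, .d] σ τ → τ.reg .p = prm n → Q τ) :
    primeCmd.wp ω (lim c n) Q σ := by
  have hq := quad_lt_lim c n
  have hl := linear_le_quad n
  have hq2 := prm_le_quad n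
  have hpl := prm_le n
  have hlp := le_prm n
  have hn4 := linear_le_prm n
  have hm := mul_add_lt_lim (c := c) (n := n) (a := 2 * (n + 2)) (b := n + 2) (by omega) (by omega)
  simp only [primeCmd, Cmd.wp, Cmd.block]
  refine ⟨by simp [h1]; omega, by simp, fun k τ => EqOff [.p, .i, .f, .d] σ τ ∧
    2 * (n + 2) * (n + 2) ≤ τ.reg .p ∧ τ.reg .p ≤ prm n ∧ prm n ≤ τ.reg .p + k, ?_, ?_, ?_⟩
  · refine ⟨((EqOff.refl _ σ).set (by simp) _).set (by simp) _, by simp [h1], by simp [h1, hlp], ?_⟩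
    simp [h1]; nlinarith
  · rintro k τ - ⟨h2, h3, h4, h5⟩
    have h35 : 2 ≤ τ.reg .p := by nlinarith
    refine ⟨by simp; omega, by simp; omega, fun m τ' => EqOff [.f, .d] (τ.set .i k) τ' ∧
      (τ'.reg .f = 0 ↔ ∀ d < τ.reg .p - 2, m ≤ d → τ.reg .p % (d + 2) ≠ 0), ?_, ?_, ?_⟩
    · refine ⟨((EqOff.refl _ _).set (by simp) _).set (by simp) _, by simp; omega⟩
    · rintro m τ' hm' ⟨h6, h7⟩
      have hp' : τ'.reg .p = τ.reg .p := by simpa using h6.reg .p (by simp)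
      simp only [Exp.eval_reg, Exp.eval_sub, Exp.eval_ofNat, Store.set_reg] at hm'
      refine ⟨by simp; simp at hm'; omega, fun h0 => ?_, fun h0 => ⟨by simp; omega, by simp, ?_, ?_⟩⟩
      · have h0 : τ.reg .p % (m + 2) ≠ 0 := by simpa [hp'] using h0
        refine ⟨by simp, h6.set (by simp) _, ?_⟩
        simp only [Store.set_reg, reduceCtorEq, if_false, h7]
        refine ⟨fun H d hd hmd => ?_, fun H d hd hmd => H d hd (by omega)⟩
        rcases eq_or_lt_of_le hmd with rfl | h8
        exacts [h0, H d hd h8]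
      · exact (h6.set (by simp) _).set (by simp) _
      · have h0 : τ.reg .p % (m + 2) = 0 := by simpa [hp'] using h0
        simp only [Store.set_reg, if_true, Exp.eval_ofNat, one_ne_zero, false_iff, not_forall]
        exact ⟨m, by simpa using hm', le_rfl, by simp [h0]⟩
    · rintro τ' - ⟨h6, h7⟩
      have hp' : τ'.reg .p = τ.reg .p := by simpa using h6.reg .p (by simp)
      have hi' : τ'.reg .i = k := by simpa using h6.reg .i (by simp)
      have h8 : τ'.reg .f = 0 ↔ (τ.reg .p).Prime := by
        rw [h7, ← not_iff_not, ← trial_division h35]; push Not; simp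
      have h9 : EqOff [.p, .i, .f, .d] σ τ' :=
        (h2.set (by simp) k).trans h6 (by simp)
      refine ⟨by simp, fun h0 => ?_, fun h0 => ?_⟩
      · have h0 : ¬ (τ.reg .p).Prime := by rw [← h8]; simpa using h0
        have h10 : τ.reg .p ≠ prm n := fun e => h0 (e ▸ prm_prime n)
        refine ⟨by simp; omega, by simpa using hi', h9.set (by simp) _, ?_, ?_, ?_⟩
        all_goals simp; omega
      · have h0 : (τ.reg .p).Prime := by rw [← h8]; simpa using h0
        have h10 : prm n ≤ τ.reg .p := Nat.find_min' (exists_prime_ge n) ⟨h3, h0⟩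
        exact ⟨hi', h9, by omega, by omega, by omega⟩
  · rintro τ - ⟨h2, h3, h4, h5⟩
    exact hQ τ h2 (by omega)

/-- The coefficients are filled in from the last to the first, because loop counters go down. -/
theorem coefCmd_wp (hn : 1 ≤ n) (h1 : σ.reg .n = n) (h2 : σ.reg .len = len n)
    (h3 : σ.reg .lam = lam c n) (h4 : σ.reg .p = prm n) (h5 : σ.coins = 0)
    (hQ : ∀ τ, (∀ x, x ∉ [Reg.i, .j, .t, .b] → τ.reg x = σ.reg x) → τ.out = σ.out →
      (∀ i < deg c n, τ.arr .coef i = coefs ω c n i) →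
      (∀ A, A ≠ Arr.coef → τ.arr A = σ.arr A) → Q τ) :
    coefCmd.wp ω (lim c n) Q σ := by
  have hq := quad_lt_lim c n
  have hl := linear_le_quad n
  have hq2 := prm_le_quad n
  have hlam := lam_le c n
  have hlen := len_le n
  have hw := two_pow_width_lt c hn
  have hm := mul_add_lt_lim (c := c) (n := n) (a := 2 * n) (b := lam c n) (by omega) (by omega)
  have hA : deg c n ≤ (lim c n).A := by
    change 2 * n * lam c n ≤ n * (len n + 1) * (2 * lam c n + 1)
    have h6 : 1 ≤ len n := Nat.size_pos.2 hn
    have h7 := Nat.mul_le_mul (Nat.mul_le_mul_left n (by omega : 2 ≤ len n + 1))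
      (by omega : lam c n ≤ 2 * lam c n + 1)
    calc _ = n * 2 * lam c n := by ring
      _ ≤ _ := h7
  have hW := prm_lt_lim c n
  have hdeg : deg c n = 2 * n * lam c n := rfl
  have hp0 := (prm_prime n).pos
  simp only [coefCmd, Cmd.wp, Cmd.block]
  refine ⟨by simp [h1, h3]; omega, fun k τ =>
    (∀ x, x ∉ [Reg.i, .j, .t, .b] → τ.reg x = σ.reg x) ∧ τ.out = σ.out ∧
    τ.coins = (deg c n - k) * width n ∧
    (∀ i < deg c n, k ≤ i → τ.arr .coef i = coefs ω c n i) ∧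
    (∀ A, A ≠ Arr.coef → τ.arr A = σ.arr A), ?_, ?_, ?_⟩
  · refine ⟨fun x hx => ?_, rfl, ?_, ?_, fun _ _ => rfl⟩
    · simp at hx; simp [hx]
    · simp [h1, h3, h5]
    · simp [h1, h3]; omega
  · rintro k τ hk ⟨a1, a2, a3, a4, a5⟩
    have hk : k < deg c n := by simpa [h1, h3] using hk
    have e1 : τ.reg .len = len n := (a1 _ (by simp)).trans h2
    have e2 : τ.reg .p = prm n := (a1 _ (by simp)).trans h4
    refine ⟨by simp; omega, by simp [e1]; omega, fun m ρ =>
      (∀ x, x ∉ [Reg.i, .j, .t, .b] → ρ.reg x = σ.reg x) ∧ ρ.reg .i = k ∧ ρ.out = τ.out ∧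
      ρ.arr = τ.arr ∧ m ≤ width n ∧
      ρ.coins = (deg c n - 1 - k) * width n + (width n - m) ∧
      ρ.reg .t = blockVal ω ((deg c n - 1 - k) * width n) (width n - m), ?_, ?_, ?_⟩
    · refine ⟨fun x hx => ?_, by simp, rfl, rfl, by simp [e1], ?_, by simp [e1, blockVal]⟩
      · have := a1 x hx
        simp at hx; simp [hx, this]
      · simp [a3, e1, show deg c n - (k + 1) = deg c n - 1 - k by omega]
    · rintro m ρ - ⟨b1, b2, b3, b4, b5, b6, b7⟩
      obtain ⟨r, hr⟩ : ∃ r, width n = m + 1 + r := ⟨width n - (m + 1), by omega⟩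
      have hr1 : width n - (m + 1) = r := by omega
      have hr2 : width n - m = r + 1 := by omega
      rw [hr1] at b6 b7
      have hlt := blockVal_lt ω ((deg c n - 1 - k) * width n) (r + 1)
      have hle : 2 ^ (r + 1) ≤ 2 ^ width n := Nat.pow_le_pow_right (by omega) (by omega)
      simp only [blockVal] at hlt
      have hb0 := Bool.toNat_le (ω ρ.coins)
      have hlt2 := blockVal_lt ω ((deg c n - 1 - k) * width n) r
      rw [← b6] at hlt
      refine ⟨⟨⟨by simp; omega, by simp, ?_⟩, by simp, ?_⟩, by simp, ?_, ?_, ?_, ?_, ?_, ?_, ?_⟩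
      · change 2 * ρ.reg .t < _
        rw [b7]; omega
      · change 2 * ρ.reg .t + (ω ρ.coins).toNat < _
        rw [b7]; omega
      · intro x hx
        have := b1 x hx
        simp at hx; simp [hx, this]
      · simp [b2]
      · exact b3
      · exact b4
      · omega
      · simp [b6, hr2]; ring
      · simp [b7, hr2, blockVal, b6]
    · rintro ρ - ⟨b1, b2, b3, b4, b5, b6, b7⟩
      have e4 : ρ.reg .p = prm n := (b1 _ (by simp)).trans h4
      have hmod := Nat.mod_lt (ρ.reg .t) hp0
      refine ⟨by simp, by simp, by simp [b2]; omega, by simp [e4]; omega, by simp [b2], b1,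
        b3.trans a2, ?_, ?_, ?_⟩
      · simp only [Store.put_coins, b6]
        rw [show deg c n - k = deg c n - 1 - k + 1 by omega, add_mul, one_mul, Nat.sub_zero]
      · intro i hi hki
        simp only [Store.put_arr, Exp.eval_reg, Exp.eval_mod, b2, true_and, b4, b7, e4]
        split_ifs with h0
        · subst h0; rfl
        · exact a4 i hi (by omega)
      · intro A hA'
        funext a
        simp [hA', b4, a5 A hA']
  · rintro τ - ⟨a1, a2, a3, a4, a5⟩
    exact hQ τ a1 a2 (fun i hi => a4 i hi (Nat.zero_le _)) a5

theorem onesCmd_wp (h1 : σ.reg .n = n) (h2 : σ.reg .len = len n) (h3 : σ.reg .lam = lam c n)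
    (hQ : ∀ τ, (∀ x, x ≠ Reg.i → τ.reg x = σ.reg x) → τ.out = σ.out →
      (∀ i < n * (len n + 1) * (2 * lam c n + 1), τ.arr .sk i = 1) →
      (∀ A, A ≠ Arr.sk → τ.arr A = σ.arr A) → Q τ) :
    onesCmd.wp ω (lim c n) Q σ := by
  have hq := quad_lt_lim c n
  have hl := linear_le_quad n
  have hlam := lam_le c n
  have hlen := len_le n
  have hrow := rows_le_quad n
  have hm := mul_add_lt_lim (c := c) (n := n) (a := n * (len n + 1)) (b := 2 * lam c n + 1)
    (by omega) (by omega)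
  have hA : (lim c n).A = n * (len n + 1) * (2 * lam c n + 1) := rfl
  have hW : 1 < (lim c n).W := by
    exact Nat.succ_lt_succ (by positivity)
  simp only [onesCmd, Cmd.wp]
  refine ⟨by simp [h1, h2, h3]; omega, fun k τ =>
    (∀ x, x ≠ Reg.i → τ.reg x = σ.reg x) ∧ τ.out = σ.out ∧
    (∀ i < n * (len n + 1) * (2 * lam c n + 1), k ≤ i → τ.arr .sk i = 1) ∧
    (∀ A, A ≠ Arr.sk → τ.arr A = σ.arr A), ?_, ?_, ?_⟩
  · refine ⟨fun x hx => by simp [hx], rfl, ?_, fun _ _ => rfl⟩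
    simp [h1, h2, h3]; omega
  · rintro k τ hk ⟨a1, a2, a3, a4⟩
    have hk : k < n * (len n + 1) * (2 * lam c n + 1) := by simpa [h1, h2, h3] using hk
    refine ⟨by simp, by simp; omega, by simpa [hA] using hk, by simpa using hW, by simp, ?_, a2, ?_, ?_⟩
    · intro x hx; simp [hx, a1 x hx]
    · intro i hi hki
      simp only [Store.put_arr, Exp.eval_reg, Store.set_reg, if_true, true_and, Exp.eval_ofNat,
        Store.set_arr]
      split_ifs with h0
      · rfl
      · exact a3 i hi (by omega)
    · intro A hA; funext a; simp [hA, a4 A hA]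
  · rintro τ - ⟨a1, a2, a3, a4⟩
    exact hQ τ a1 a2 (fun i hi => a3 i hi (Nat.zero_le _)) a4

theorem setupCmd_wp (hn : 1 ≤ n) (h1 : σ.reg .n = n) (h2 : σ.coins = 0)
    (h3 : ∀ A a, σ.arr A a = 0)
    (hQ : ∀ τ, τ.reg .n = n → τ.reg .len = len n → τ.reg .lam = lam c n → τ.reg .p = prm n →
      (∀ i < deg c n, τ.arr .coef i = coefs ω c n i) → (∀ i, τ.arr .cnt i = 0) →
      (∀ i < n * (len n + 1) * (2 * lam c n + 1), τ.arr .sk i = 1) → Q τ) :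
    (setupCmd c).wp ω (lim c n) Q σ := by
  simp only [setupCmd, Cmd.block]
  refine lenCmd_wp h1 fun τ₁ e₁ l₁ => ?_
  have n₁ := (e₁.reg .n (by simp)).trans h1
  refine lamCmd_wp hn n₁ l₁ fun τ₂ e₂ l₂ => ?_
  have n₂ := (e₂.reg .n (by simp)).trans n₁
  refine primeCmd_wp n₂ fun τ₃ e₃ l₃ => ?_
  have n₃ := (e₃.reg .n (by simp)).trans n₂
  have m₃ := (e₃.reg .len (by simp)).trans ((e₂.reg .len (by simp)).trans l₁)
  have k₃ := (e₃.reg .lam (by simp)).trans l₂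
  refine coefCmd_wp hn n₃ m₃ k₃ l₃ (by rw [e₃.coins, e₂.coins, e₁.coins, h2])
    fun τ₄ e₄ _ c₄ a₄ => ?_
  have n₄ := (e₄ .n (by simp)).trans n₃
  have m₄ := (e₄ .len (by simp)).trans m₃
  have k₄ := (e₄ .lam (by simp)).trans k₃
  have p₄ := (e₄ .p (by simp)).trans l₃
  refine onesCmd_wp n₄ m₄ k₄ fun τ₅ e₅ _ s₅ a₅ => ?_
  refine hQ τ₅ ((e₅ _ (by simp)).trans n₄) ((e₅ _ (by simp)).trans m₄)
    ((e₅ _ (by simp)).trans k₄) ((e₅ _ (by simp)).trans p₄) (fun i hi => ?_) (fun i => ?_) s₅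
  · rw [a₅ _ (by simp), c₄ i hi]
  · rw [a₅ _ (by simp), a₄ _ (by simp), e₃.arr, e₂.arr, e₁.arr, h3]

end Setup

end Imp

/-! ### Processing an update -/

namespace Imp

/-- Evaluate the hash polynomial at the number of the ordered pair `(u, v)` by Horner's rule. -/
def hashCmd : Cmd := .block [.asg .x (Reg.u * Reg.n + Reg.v), .asg .h 0,
  .down .j (2 * Reg.n * Reg.lam) (.asg .h ((Reg.h * Reg.x + .get .coef Reg.j) % Reg.p))]

/-- Multiply the `j`-th entry of the sketch in row `r` by `(n + j - v) ^ e` for all `j`. -/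
def rowCmd : Cmd := .down .j (2 * Reg.lam + 1) (.seq (.asg .a (Reg.r * (2 * Reg.lam + 1) + Reg.j))
  (.down .s Reg.e (.put .sk Reg.a ((.get .sk Reg.a * (Reg.n + Reg.j - Reg.v)) % Reg.p))))

/-- Update the counter and the sketch of the vertex `u` at level `l` if the pair is sampled there,
and halve the threshold. -/
def levelCmd : Cmd := .seq
  (.ite ((Reg.t : Exp) - Reg.h) (.block [.asg .r (Reg.u * (Reg.len + 1) + Reg.l),
    .ite Reg.kind (.put .cnt Reg.r (.get .cnt Reg.r + 1)) (.put .cnt Reg.r (.get .cnt Reg.r - 1)),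
    rowCmd]) .skip)
  (.asg .t (Reg.t / 2))

/-- Update the memory of the vertex `u` for the edge from `u` to `v`. -/
def halfCmd : Cmd := .seq hashCmd (.seq (.asg .t Reg.p) (.down .l (Reg.len + 1) levelCmd))

/-- The program that is run for every update: division by a sketch factor is multiplication by its
power with exponent `p - 2`. -/
def updateCmd : Cmd := .seq (.ite Reg.kind (.asg .e 1) (.asg .e (Reg.p - 2)))
  (.down .i 2 (.block [halfCmd, .asg .s Reg.u, .asg .u Reg.v, .asg .v Reg.s]))

/-- The value of the hash polynomial with coefficients `a` at the point `x`. -/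
def hashVal (c n : ℕ) (a : ℕ → ℕ) (x : ℕ) : ℕ :=
  (∑ i ∈ Finset.range (deg c n), a i * x ^ i) % prm n

/-- The threshold for the hash values that are sampled at level `l`. -/
def thr (n l : ℕ) : ℕ := prm n / 2 ^ (len n - l)

open scoped Classical in
/-- The sampled neighbours of `v` at level `l` for the directed graph `D`. -/
noncomputable def nbrs (c : ℕ) {n : ℕ} (a : ℕ → ℕ) (D : Fin n → Fin n → Prop) (v : Fin n) (l : ℕ) :
    Finset (Fin n) :=
  {w | D v w ∧ hashVal c n a (v * n + w) < thr n l}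

/-- The memory represents the directed graph `D`. The `j`-th entry of the sketch of `v` at level
`l` is the value at `n + j` of the monic polynomial whose roots are the sampled neighbours. -/
structure Holds (c : ℕ) {n : ℕ} (a : ℕ → ℕ) (D : Fin n → Fin n → Prop) (τ : Store) : Prop where
  reg_n : τ.reg .n = n
  reg_len : τ.reg .len = len n
  reg_lam : τ.reg .lam = lam c n
  reg_p : τ.reg .p = prm n
  coef : ∀ i < deg c n, τ.arr .coef i = a i
  cnt : ∀ (v : Fin n), ∀ l < len n + 1, τ.arr .cnt (v * (len n + 1) + l) = (nbrs c a D v l).card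
  sk_lt : ∀ (v : Fin n), ∀ l < len n + 1, ∀ j < 2 * lam c n + 1,
    τ.arr .sk ((v * (len n + 1) + l) * (2 * lam c n + 1) + j) < prm n
  sk : ∀ (v : Fin n), ∀ l < len n + 1, ∀ j < 2 * lam c n + 1,
    (τ.arr .sk ((v * (len n + 1) + l) * (2 * lam c n + 1) + j) : ZMod (prm n)) =
      ∏ w ∈ nbrs c a D v l, ((n + j - w : ℕ) : ZMod (prm n))

section Half

variable {ω : ℕ → Bool} {c n : ℕ} {σ : Store} {Q : Store → Prop} {a : ℕ → ℕ}

theorem hashCmd_wp (h1 : σ.reg .n = n) (h3 : σ.reg .lam = lam c n)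
    (h4 : σ.reg .p = prm n) (hu : σ.reg .u < n) (hv : σ.reg .v < n)
    (hc : ∀ i < deg c n, σ.arr .coef i = a i) (ha : ∀ i, a i < prm n)
    (hQ : ∀ τ, EqOff [.x, .h, .j] σ τ → τ.reg .h = hashVal c n a (σ.reg .u * n + σ.reg .v) → Q τ) :
    hashCmd.wp ω (lim c n) Q σ := by
  have hq := quad_lt_lim c n
  have hl := linear_le_quad n
  have hq2 := prm_le_quad n
  have hlam := lam_le c n
  have hdeg : deg c n = 2 * n * lam c n := rfl
  have hm := mul_add_lt_lim (c := c) (n := n) (a := 2 * n) (b := lam c n) (by omega) (by omega)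
  have hA : deg c n ≤ (lim c n).A := by
    change 2 * n * lam c n ≤ n * (len n + 1) * (2 * lam c n + 1)
    have h6 : 1 ≤ len n := Nat.size_pos.2 (by omega)
    calc 2 * n * lam c n = n * 2 * lam c n := by ring
      _ ≤ _ := Nat.mul_le_mul (Nat.mul_le_mul_left n (by omega)) (by omega)
  have hx := row_lt hu hv
  have hx2 := mul_le_quad (n := n) (a := n) (b := n) (by omega) (by omega)
  have hp0 := (prm_prime n).pos
  set x := σ.reg .u * n + σ.reg .v with hxdef
  simp only [hashCmd, Cmd.block, Cmd.wp]
  refine ⟨by simp [h1]; omega, by simp; omega, by simp [h1, h3]; omega, fun k τ =>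
    EqOff [.x, .h, .j] σ τ ∧ τ.reg .x = x ∧ τ.reg .h =
      (∑ i ∈ Finset.range (deg c n - k), a (k + i) * x ^ i) % prm n, ?_, ?_, ?_⟩
  · refine ⟨(((EqOff.refl _ σ).set (by simp) _).set (by simp) _).set (by simp) _, ?_, ?_⟩
    · simp [h1, hxdef]
    · simp [h1, h3]
  · rintro k τ hk ⟨b1, b2, b3⟩
    have hk : k < deg c n := by simpa [h1, h3] using hk
    have e1 : τ.reg .p = prm n := (b1.reg _ (by simp)).trans h4
    have e2 : τ.arr .coef k = a k := by rw [b1.arr, hc k hk]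
    have e3 : τ.reg .h < prm n := b3 ▸ Nat.mod_lt _ hp0
    have e4 := ha k
    have hm2 := mul_add_lt_lim (c := c) (n := n) (a := τ.reg .h) (b := x) (by omega) (by omega)
    refine ⟨by simp [b2, e2]; omega, by simp, (b1.set (by simp) _).set (by simp) _,
      by simp [b2], ?_⟩
    simp only [Store.set_reg, if_true, Exp.eval_mod, Exp.eval_add, Exp.eval_mul, Exp.eval_reg,
      Exp.eval_get, reduceCtorEq, if_false, e1, b2, b3, Store.set_arr, e2]
    rw [show deg c n - k = deg c n - (k + 1) + 1 by omega, Finset.sum_range_succ',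
      Finset.sum_congr rfl fun i _ => show a (k + (i + 1)) * x ^ (i + 1) =
        a (k + 1 + i) * x ^ i * x by rw [pow_succ, mul_assoc, add_right_comm, add_assoc],
      ← Finset.sum_mul, pow_zero, mul_one, add_zero]
    simp [Nat.add_mod, Nat.mul_mod]
  · rintro τ - ⟨b1, b2, b3⟩
    exact hQ τ b1 (by rw [b3]; simp [hashVal])

/-- All entries of one row are multiplied by their factors, and nothing else in the arrays changes. -/
theorem rowCmd_wp {r v : ℕ} (h1 : σ.reg .n = n) (h3 : σ.reg .lam = lam c n)
    (h4 : σ.reg .p = prm n) (hr : σ.reg .r = r) (hr' : r < n * (len n + 1)) (hv : σ.reg .v = v)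
    (hv' : v < n) (hlt : ∀ j < 2 * lam c n + 1, σ.arr .sk (r * (2 * lam c n + 1) + j) < prm n)
    (hQ : ∀ τ, (∀ x, x ∉ [Reg.j, .a, .s] → τ.reg x = σ.reg x) →
      (∀ A, A ≠ Arr.sk → τ.arr A = σ.arr A) →
      (∀ b, (∀ j < 2 * lam c n + 1, b ≠ r * (2 * lam c n + 1) + j) →
        τ.arr .sk b = σ.arr .sk b) →
      (∀ j < 2 * lam c n + 1, τ.arr .sk (r * (2 * lam c n + 1) + j) < prm n ∧
        (τ.arr .sk (r * (2 * lam c n + 1) + j) : ZMod (prm n)) =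
          σ.arr .sk (r * (2 * lam c n + 1) + j) * ((n + j - v : ℕ) : ZMod (prm n)) ^ σ.reg .e) →
      Q τ) :
    rowCmd.wp ω (lim c n) Q σ := by
  have hq := quad_lt_lim c n
  have hl := linear_le_quad n
  have hq2 := prm_le_quad n
  have hlam := lam_le c n
  have hrow := rows_le_quad n
  have hW := prm_lt_lim c n
  have hp0 := (prm_prime n).pos
  simp only [rowCmd, Cmd.wp]
  set K := 2 * lam c n + 1 with hK
  have hA : (lim c n).A = n * (len n + 1) * K := rfl
  have hm := mul_add_lt_lim (c := c) (n := n) (a := r) (b := K) (by omega) (by omega)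
  refine ⟨by simp [h3]; omega, fun k τ =>
    (∀ x, x ∉ [Reg.j, .a, .s] → τ.reg x = σ.reg x) ∧
    (∀ A, A ≠ Arr.sk → τ.arr A = σ.arr A) ∧
    (∀ b, (∀ j < K, k ≤ j → b ≠ r * K + j) → τ.arr .sk b = σ.arr .sk b) ∧
    (∀ j < K, k ≤ j → τ.arr .sk (r * K + j) < prm n ∧
      (τ.arr .sk (r * K + j) : ZMod (prm n)) =
        σ.arr .sk (r * K + j) * ((n + j - v : ℕ) : ZMod (prm n)) ^ σ.reg .e), ?_, ?_, ?_⟩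
  · refine ⟨fun x hx => ?_, fun _ _ => rfl, fun _ _ => rfl, ?_⟩
    · simp at hx; simp [hx]
    · simp [h3]; omega
  · rintro k τ hk ⟨b1, b2, b3, b4⟩
    have hk : k < K := by simpa [h3, hK] using hk
    have hidx := row_lt hr' hk
    rw [← hA] at hidx
    have e1 : τ.reg .lam = lam c n := (b1 _ (by simp)).trans h3
    have e2 : τ.reg .r = r := (b1 _ (by simp)).trans hr
    have e3 : τ.reg .n = n := (b1 _ (by simp)).trans h1
    have e4 : τ.reg .v = v := (b1 _ (by simp)).trans hv
    have e5 : τ.reg .p = prm n := (b1 _ (by simp)).trans h4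
    have e6 : τ.reg .e = σ.reg .e := b1 _ (by simp)
    have e7 : τ.arr .sk (r * K + k) = σ.arr .sk (r * K + k) :=
      b3 _ fun j _ hj => by omega
    refine ⟨by simp [e1, e2, ← hK]; omega, by simp, fun m ρ =>
      (∀ x, x ∉ [Reg.j, .a, .s] → ρ.reg x = σ.reg x) ∧ ρ.reg .j = k ∧ ρ.reg .a = r * K + k ∧
      m ≤ σ.reg .e ∧
      (∀ A, A ≠ Arr.sk → ρ.arr A = σ.arr A) ∧
      (∀ b, b ≠ r * K + k → ρ.arr .sk b = τ.arr .sk b) ∧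
      ρ.arr .sk (r * K + k) < prm n ∧ (ρ.arr .sk (r * K + k) : ZMod (prm n)) =
        σ.arr .sk (r * K + k) * ((n + k - v : ℕ) : ZMod (prm n)) ^ (σ.reg .e - m), ?_, ?_, ?_⟩
    · refine ⟨fun x hx => ?_, by simp, by simp [e1, e2, ← hK], by simp [e6], b2, fun _ _ => rfl,
        ?_, ?_⟩
      · have := b1 x hx
        simp at hx; simp [hx, this]
      · simpa [e7] using hlt k hk
      · simp [e7, e6]
    · rintro m ρ - ⟨c1, c2, c3, c4, c5, c6, c7, c8⟩
      have f3 : ρ.reg .n = n := (c1 _ (by simp)).trans h1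
      have f4 : ρ.reg .v = v := (c1 _ (by simp)).trans hv
      have f5 : ρ.reg .p = prm n := (c1 _ (by simp)).trans h4
      have hmod := Nat.mod_lt (ρ.arr .sk (r * K + k) * (n + k - v)) hp0
      have hm2 := mul_add_lt_lim (c := c) (n := n) (a := ρ.arr .sk (r * K + k)) (b := n + k - v)
        (by omega) (by omega)
      refine ⟨by simp, by simp [c2, c3, f3, f4]; omega, by simpa [c3] using hidx,
        by simp [c2, c3, f3, f4, f5]; omega, by simp, ?_, by simp [c2], by simp [c3], by omega,
        ?_, ?_, ?_, ?_⟩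
      · intro x hx
        have := c1 x hx
        simp at hx; simp [hx, this]
      · intro A hA'; funext b; simp [hA', c5 A hA']
      · intro b hb; simp [c3, hb, c6 b hb]
      · simp [c2, c3, f3, f4, f5]; exact hmod
      · simp only [Store.put_arr, Exp.eval_reg, Store.set_reg, c3, reduceCtorEq, if_false,
          and_self, if_true, Exp.eval_mod, Exp.eval_mul, Exp.eval_get, Exp.eval_sub, Exp.eval_add,
          Store.set_arr, c2, f3, f4, f5]
        rw [ZMod.natCast_mod, Nat.cast_mul, c8, mul_assoc, ← pow_succ]
        congr 2; omega
    · rintro ρ - ⟨c1, c2, c3, c4, c5, c6, c7, c8⟩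
      refine ⟨c2, c1, c5, fun b hb => ?_, fun j hj hkj => ?_⟩
      · rw [c6 b (hb k hk le_rfl), b3 b fun j hj hkj => hb j hj (by omega)]
      · rcases eq_or_lt_of_le hkj with rfl | h0
        · exact ⟨c7, c8⟩
        · rw [c6 _ (by omega)]; exact b4 j hj h0
  · rintro τ - ⟨b1, b2, b3, b4⟩
    exact hQ τ b1 b2 (fun b hb => b3 b fun j hj _ => hb j hj) fun j hj => b4 j hj (Nat.zero_le _)

theorem thr_succ {k : ℕ} (hk : k < len n + 1) :
    prm n / 2 ^ (len n + 1 - (k + 1)) = thr n k ∧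
      thr n k / 2 = prm n / 2 ^ (len n + 1 - k) := by
  refine ⟨by rw [thr, Nat.add_sub_add_right], ?_⟩
  rw [thr, Nat.div_div_eq_div_mul, ← pow_succ]
  congr 2; omega

/-- The effect of a half update. -/
structure HalfStep (c : ℕ) {n : ℕ} (a : ℕ → ℕ) (u v : Fin n) (k : ℕ) (σ τ : Store) : Prop where
  reg : ∀ x, x ∉ [Reg.j, .a, .s, .x, .h, .t, .l, .r] → τ.reg x = σ.reg x
  coef : τ.arr .coef = σ.arr .coef
  cnt : ∀ (v' : Fin n), ∀ l < len n + 1, τ.arr .cnt (v' * (len n + 1) + l) =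
    if v' = u ∧ k ≤ l ∧ hashVal c n a (u * n + v) < thr n l then
      if σ.reg .kind = 0 then σ.arr .cnt (v' * (len n + 1) + l) - 1
      else σ.arr .cnt (v' * (len n + 1) + l) + 1
    else σ.arr .cnt (v' * (len n + 1) + l)
  sk_lt : ∀ (v' : Fin n), ∀ l < len n + 1, ∀ j < 2 * lam c n + 1,
    τ.arr .sk ((v' * (len n + 1) + l) * (2 * lam c n + 1) + j) < prm n
  sk : ∀ (v' : Fin n), ∀ l < len n + 1, ∀ j < 2 * lam c n + 1,
    (τ.arr .sk ((v' * (len n + 1) + l) * (2 * lam c n + 1) + j) : ZMod (prm n)) =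
      σ.arr .sk ((v' * (len n + 1) + l) * (2 * lam c n + 1) + j) *
      if v' = u ∧ k ≤ l ∧ hashVal c n a (u * n + v) < thr n l then
        ((n + j - v : ℕ) : ZMod (prm n)) ^ σ.reg .e else 1

/-- One pass of the loop over the levels extends the part of the sketch that is up to date from the
levels above `k` to the level `k`. -/
theorem levelCmd_wp {u v : Fin n} {τ : Store} {k : ℕ} (h1 : σ.reg .n = n)
    (h2 : σ.reg .len = len n) (h3 : σ.reg .lam = lam c n) (h4 : σ.reg .p = prm n)
    (hu : σ.reg .u = u) (hv : σ.reg .v = v)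
    (hcnt : ∀ (v' : Fin n), ∀ l < len n + 1, σ.arr .cnt (v' * (len n + 1) + l) ≤ n)
    (hk : k < len n + 1) (hτ : HalfStep c a u v (k + 1) σ τ)
    (hh : τ.reg .h = hashVal c n a (u * n + v))
    (ht : τ.reg .t = prm n / 2 ^ (len n + 1 - (k + 1)))
    (hQ : ∀ ρ, HalfStep c a u v k σ ρ → ρ.reg .l = k → ρ.reg .h = hashVal c n a (u * n + v) →
      ρ.reg .t = prm n / 2 ^ (len n + 1 - k) → Q ρ) :
    levelCmd.wp ω (lim c n) Q (τ.set .l k) := by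
  have hq := quad_lt_lim c n
  have hl := linear_le_quad n
  have hlam := lam_le c n
  have hlen := len_le n
  have hrow := rows_le_quad n
  have hW : 4 * (n + 2) < (lim c n).W := by
    refine (linear_le_prm n).trans_lt (prm_lt_lim c n)
  have hA : (lim c n).A = n * (len n + 1) * (2 * lam c n + 1) := rfl
  have hidx := row_lt u.2 hk
  have hA' : n * (len n + 1) ≤ (lim c n).A := hA ▸ Nat.le_mul_of_pos_right _ (by omega)
  have hm := mul_add_lt_lim (c := c) (n := n) (a := (u : ℕ)) (b := len n + 1) (by omega) (by omega)
  rw [(thr_succ hk).1] at ht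
  simp only [levelCmd, Cmd.block, Cmd.wp]
  refine ⟨by simp, fun h0 => ?_, fun h0 => ?_⟩
  · have h0 : hashVal c n a (u * n + v) < thr n k := by
      have h0 : thr n k - hashVal c n a (u * n + v) ≠ 0 := by simpa [hh, ht] using h0
      omega
    have e1 := (hτ.reg .n (by simp)).trans h1
    have e2 := (hτ.reg .len (by simp)).trans h2
    have e3 := (hτ.reg .lam (by simp)).trans h3
    have e4 := (hτ.reg .p (by simp)).trans h4
    have e5 := (hτ.reg .u (by simp)).trans hu
    have e6 := (hτ.reg .v (by simp)).trans hv
    have e7 := hτ.reg .kind (by simp)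
    have e8 := hτ.reg .e (by simp)
    have hold : τ.arr .cnt (u * (len n + 1) + k) = σ.arr .cnt (u * (len n + 1) + k) := by
      rw [hτ.cnt u k hk, if_neg (by omega)]
    have hcn := hcnt u k hk
    -- the rest of the level, for either value of the counter
    have key : ∀ z : ℕ,
        z = (if σ.reg .kind = 0 then σ.arr .cnt (u * (len n + 1) + k) - 1
          else σ.arr .cnt (u * (len n + 1) + k) + 1) →
        rowCmd.wp ω (lim c n) (fun σ => Exp.safe (lim c n) σ (Reg.t / 2) ∧
          Q (σ.set Reg.t (Exp.eval σ (Reg.t / 2))))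
          (((τ.set .l k).set .r (u * (len n + 1) + k)).put .cnt (u * (len n + 1) + k) z) := by
      intro z hz
      refine rowCmd_wp (r := u * (len n + 1) + k) (v := v) (by simpa using e1) (by simpa using e3)
        (by simpa using e4) (by simp) hidx (by simpa using e6) v.2 (fun j hj => ?_)
        fun ρ r1 r2 r3 r4 => ⟨by simp; omega, hQ _ ⟨?_, ?_, ?_, ?_, ?_⟩ ?_ ?_ ?_⟩
      · simpa using hτ.sk_lt u k hk j hj
      · intro x hx
        have := hτ.reg x hx
        have r1x := r1 x (by simp at hx ⊢; tauto)
        simp at hx; simp [hx, this, r1x]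
      · have := r2 .coef (by simp)
        funext i
        simp [this, hτ.coef]
      · intro v' l hl'
        have := r2 .cnt (by simp)
        simp only [Store.set_arr, this, Store.put_arr, true_and, row_inj hl' hk, Fin.val_inj]
        by_cases hvl : v' = u ∧ l = k
        · obtain ⟨rfl, rfl⟩ := hvl
          simp [hz, h0]
        · rw [if_neg hvl, hτ.cnt v' l hl']
          refine if_congr ?_ rfl rfl
          constructor
          · exact fun ⟨g1, g2, g3⟩ => ⟨g1, by omega, g3⟩
          · refine fun ⟨g1, g2, g3⟩ => ⟨g1, ?_, g3⟩
            have : l ≠ k := fun e => hvl ⟨g1, e⟩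
            omega
      · intro v' l hl' j hj
        simp only [Store.set_arr]
        by_cases hvl : v' = u ∧ l = k
        · obtain ⟨rfl, rfl⟩ := hvl
          exact (r4 j hj).1
        · rw [r3 _ fun j' hj' e => hvl ?_]
          · simpa using hτ.sk_lt v' l hl' j hj
          · have e := ((row_inj hj hj').1 e).1
            rw [row_inj hl' hk, Fin.val_inj] at e; exact e
      · intro v' l hl' j hj
        simp only [Store.set_arr]
        by_cases hvl : v' = u ∧ l = k
        · obtain ⟨rfl, rfl⟩ := hvl
          rw [(r4 j hj).2]
          have := hτ.sk v' l hl' j hj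
          rw [if_neg (by omega), mul_one] at this
          simp [this, h0, e8]
        · rw [r3 _ fun j' hj' e => hvl ?_]
          · have := hτ.sk v' l hl' j hj
            simp only [Store.put_arr, reduceCtorEq, false_and, if_false, Store.set_arr, this]
            congr 1
            refine if_congr ?_ rfl rfl
            constructor
            · exact fun ⟨g1, g2, g3⟩ => ⟨g1, by omega, g3⟩
            · refine fun ⟨g1, g2, g3⟩ => ⟨g1, ?_, g3⟩
              have : l ≠ k := fun e => hvl ⟨g1, e⟩
              omega
          · have e := ((row_inj hj hj').1 e).1
            rw [row_inj hl' hk, Fin.val_inj] at e; exact e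
      · have := r1 .l (by simp)
        simpa using this
      · have := r1 .h (by simp)
        simpa [hh] using this
      · have := r1 .t (by simp)
        simp only [Store.put_reg, Store.set_reg, reduceCtorEq, if_false] at this
        simp [this, ht, (thr_succ hk).2]
    refine ⟨by simp [e5, e2]; omega, by simp, fun hk0 => ?_, fun hk0 => ?_⟩
    · have hk0 : σ.reg .kind ≠ 0 := by simpa [e7] using hk0
      refine ⟨by simp, by simp [e5, e2, hold]; omega, by simp [e5, e2]; omega,
        by simp [e5, e2, hold]; omega, ?_⟩
      have := key _ rfl
      rw [if_neg hk0] at this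
      simpa [e5, e2, hold] using this
    · have hk0 : σ.reg .kind = 0 := by simpa [e7] using hk0
      refine ⟨by simp, by simp [e5, e2]; omega, by simp [e5, e2]; omega,
        by simp [e5, e2, hold]; omega, ?_⟩
      have := key _ rfl
      rw [if_pos hk0] at this
      simpa [e5, e2, hold] using this
  · have h0 : ¬ hashVal c n a (u * n + v) < thr n k := by
      have h0 : thr n k - hashVal c n a (u * n + v) = 0 := by simpa [hh, ht] using h0
      omega
    have hiff : ∀ (v' : Fin n) l, (v' = u ∧ k + 1 ≤ l ∧ hashVal c n a (u * n + v) < thr n l) ↔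
        (v' = u ∧ k ≤ l ∧ hashVal c n a (u * n + v) < thr n l) := by
      intro v' l
      constructor
      · exact fun ⟨g1, g2, g3⟩ => ⟨g1, by omega, g3⟩
      · refine fun ⟨g1, g2, g3⟩ => ⟨g1, ?_, g3⟩
        have : l ≠ k := by rintro rfl; exact h0 g3
        omega
    refine ⟨by simp; omega, hQ _ ⟨?_, ?_, ?_, ?_, ?_⟩ (by simp) (by simp [hh]) ?_⟩
    · intro x hx
      have := hτ.reg x hx
      simp at hx; simp [hx, this]
    · exact hτ.coef
    · intro v' l hl'
      simp only [Store.set_arr, hτ.cnt v' l hl', hiff]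
    · exact hτ.sk_lt
    · intro v' l hl' j hj
      simp only [Store.set_arr, hτ.sk v' l hl' j hj, hiff]
    · simp [ht, (thr_succ hk).2]

theorem halfCmd_wp {u v : Fin n} (h1 : σ.reg .n = n)
    (h2 : σ.reg .len = len n) (h3 : σ.reg .lam = lam c n) (h4 : σ.reg .p = prm n)
    (hu : σ.reg .u = u) (hv : σ.reg .v = v)
    (hc : ∀ i < deg c n, σ.arr .coef i = a i) (ha : ∀ i, a i < prm n)
    (hcnt : ∀ (v' : Fin n), ∀ l < len n + 1, σ.arr .cnt (v' * (len n + 1) + l) ≤ n)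
    (hsk : ∀ (v' : Fin n), ∀ l < len n + 1, ∀ j < 2 * lam c n + 1,
      σ.arr .sk ((v' * (len n + 1) + l) * (2 * lam c n + 1) + j) < prm n)
    (hQ : ∀ ρ, HalfStep c a u v 0 σ ρ → Q ρ) :
    halfCmd.wp ω (lim c n) Q σ := by
  have hq := quad_lt_lim c n
  have hl := linear_le_quad n
  have hlen := len_le n
  simp only [halfCmd, Cmd.wp]
  refine hashCmd_wp h1 h3 h4 (hu ▸ u.2) (hv ▸ v.2) hc ha fun τ e hh => ?_
  rw [hu, hv] at hh
  have e2 : τ.reg .len = len n := (e.reg _ (by simp)).trans h2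
  have e4 : τ.reg .p = prm n := (e.reg _ (by simp)).trans h4
  refine ⟨by simp, by simp [e2]; omega, fun k ρ => HalfStep c a u v k σ ρ ∧
    ρ.reg .h = hashVal c n a (u * n + v) ∧ ρ.reg .t = prm n / 2 ^ (len n + 1 - k), ?_, ?_, ?_⟩
  · refine ⟨⟨?_, ?_, ?_, ?_, ?_⟩, by simp [hh], by simp [e2, e4]⟩
    · intro x hx
      have := e.reg x (by simp at hx ⊢; tauto)
      simp at hx; simp [hx, this]
    · simp [e.arr]
    · intro v' l hl'
      rw [if_neg (by simp [e2]; omega)]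
      simp [e.arr]
    · intro v' l hl' j hj
      simpa [e.arr] using hsk v' l hl' j hj
    · intro v' l hl' j hj
      rw [if_neg (by simp [e2]; omega)]
      simp [e.arr]
  · rintro k ρ hk ⟨b1, b2, b3⟩
    have hk : k < len n + 1 := by simpa [e2] using hk
    exact levelCmd_wp h1 h2 h3 h4 hu hv hcnt hk b1 b2 b3 fun ρ' c1 c2 c3 c4 => ⟨c2, c1, c3, c4⟩
  · rintro ρ - ⟨b1, b2, b3⟩
    exact hQ ρ b1

end Half

end Imp

namespace Imp

variable {ω : ℕ → Bool} {c n : ℕ} {σ : Store} {Q : Store → Prop} {a : ℕ → ℕ}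

/-- The directed graph after an insertion or a deletion of the edge from `u` to `v`. -/
def toggle {n : ℕ} (ins : Bool) (D : Fin n → Fin n → Prop) (u v : Fin n) : Fin n → Fin n → Prop :=
  fun x y => if x = u ∧ y = v then ins = true else D x y

theorem mem_nbrs {D : Fin n → Fin n → Prop} {v w : Fin n} {l : ℕ} :
    w ∈ nbrs c a D v l ↔ D v w ∧ hashVal c n a (v * n + w) < thr n l := by
  simp [nbrs]

theorem nbrs_toggle_of_not (ins : Bool) {D : Fin n → Fin n → Prop} {u v v' : Fin n} {l : ℕ}
    (h : ¬ (v' = u ∧ hashVal c n a (u * n + v) < thr n l)) :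
    nbrs c a (toggle ins D u v) v' l = nbrs c a D v' l := by
  ext w
  simp only [mem_nbrs, toggle]
  split_ifs with h0
  · obtain ⟨rfl, rfl⟩ := h0
    have : ¬ hashVal c n a (v' * n + w) < thr n l := fun e => h ⟨rfl, e⟩
    simp [this]
  · rfl

theorem nbrs_toggle_insert {D : Fin n → Fin n → Prop} {u v : Fin n} {l : ℕ}
    (h : hashVal c n a (u * n + v) < thr n l) (hD : ¬ D u v) :
    v ∉ nbrs c a D u l ∧ nbrs c a (toggle true D u v) u l = insert v (nbrs c a D u l) := by
  refine ⟨by simp [mem_nbrs, hD], ?_⟩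
  ext w
  simp only [mem_nbrs, toggle, Finset.mem_insert]
  by_cases h0 : w = v
  · subst h0; simp [h]
  · simp [h0]

theorem nbrs_toggle_erase {D : Fin n → Fin n → Prop} {u v : Fin n} {l : ℕ}
    (h : hashVal c n a (u * n + v) < thr n l) (hD : D u v) :
    v ∉ nbrs c a (toggle false D u v) u l ∧
      nbrs c a D u l = insert v (nbrs c a (toggle false D u v) u l) := by
  refine ⟨by simp [mem_nbrs, toggle], ?_⟩
  ext w
  simp only [mem_nbrs, toggle, Finset.mem_insert]
  by_cases h0 : w = v
  · subst h0; simp [h, hD]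
  · simp [h0]

/-- The sketch is taken at points `n + j`, which are distinct from all vertices modulo `prm n`, so
that every factor of it can be divided out again. -/
theorem factor_ne_zero {v j : ℕ} (hv : v < n) (hj : j < 2 * lam c n + 1) :
    ((n + j - v : ℕ) : ZMod (prm n)) ≠ 0 := by
  have h1 := linear_le_prm n
  have h2 := lam_le c n
  rw [Ne, ZMod.natCast_eq_zero_iff]
  exact fun h => by have := Nat.le_of_dvd (by omega) h; omega

theorem mul_pow_inv {p : ℕ} (hp : p.Prime) {y : ZMod p} (hy : y ≠ 0) : y * y ^ (p - 2) = 1 := by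
  have := Fact.mk hp
  rw [← pow_succ', show p - 2 + 1 = p - 1 by have := hp.two_le; omega]
  exact ZMod.pow_card_sub_one_eq_one hy

/-- A half update changes the represented graph in one ordered pair. -/
theorem HalfStep.holds {D : Fin n → Fin n → Prop} {u v : Fin n} {ins : Bool} {τ : Store}
    (h : HalfStep c a u v 0 σ τ) (hσ : Holds c a D σ) (hk : σ.reg .kind = ins.toNat)
    (he : σ.reg .e = if ins then 1 else prm n - 2) (hD : D u v ↔ ins = false) :
    Holds c a (toggle ins D u v) τ where
  reg_n := (h.reg _ (by simp)).trans hσ.reg_n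
  reg_len := (h.reg _ (by simp)).trans hσ.reg_len
  reg_lam := (h.reg _ (by simp)).trans hσ.reg_lam
  reg_p := (h.reg _ (by simp)).trans hσ.reg_p
  coef i hi := by rw [h.coef, hσ.coef i hi]
  sk_lt := h.sk_lt
  cnt v' l hl := by
    rw [h.cnt v' l hl, hσ.cnt v' l hl]
    by_cases h0 : v' = u ∧ hashVal c n a (u * n + v) < thr n l
    · obtain ⟨rfl, h0⟩ := h0
      rw [if_pos ⟨rfl, Nat.zero_le _, h0⟩]
      cases ins with
      | true =>
        obtain ⟨h1, h2⟩ := nbrs_toggle_insert h0 (by simpa using hD)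
        rw [if_neg (by simp [hk]), h2, Finset.card_insert_of_notMem h1]
      | false =>
        obtain ⟨h1, h2⟩ := nbrs_toggle_erase h0 (by simpa using hD)
        rw [if_pos (by simp [hk]), h2, Finset.card_insert_of_notMem h1, Nat.add_sub_cancel]
    · rw [if_neg (fun e => h0 ⟨e.1, e.2.2⟩), nbrs_toggle_of_not ins h0]
  sk v' l hl j hj := by
    rw [h.sk v' l hl j hj, hσ.sk v' l hl j hj]
    by_cases h0 : v' = u ∧ hashVal c n a (u * n + v) < thr n l
    · obtain ⟨rfl, h0⟩ := h0
      rw [if_pos ⟨rfl, Nat.zero_le _, h0⟩, he]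
      cases ins with
      | true =>
        obtain ⟨h1, h2⟩ := nbrs_toggle_insert h0 (by simpa using hD)
        rw [h2, Finset.prod_insert h1]
        simp [mul_comm]
      | false =>
        obtain ⟨h1, h2⟩ := nbrs_toggle_erase h0 (by simpa using hD)
        rw [h2, Finset.prod_insert h1, mul_right_comm]
        simp [mul_pow_inv (prm_prime n) (factor_ne_zero v.2 hj)]
    · rw [if_neg (fun e => h0 ⟨e.1, e.2.2⟩), nbrs_toggle_of_not ins h0, mul_one]

theorem Holds.congr_reg {D : Fin n → Fin n → Prop} {τ : Store} (h : Holds c a D σ)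
    (hr : ∀ x, x ∉ [Reg.kind, .u, .v, .s, .i, .e] → τ.reg x = σ.reg x) (ha : τ.arr = σ.arr) :
    Holds c a D τ where
  reg_n := (hr _ (by simp)).trans h.reg_n
  reg_len := (hr _ (by simp)).trans h.reg_len
  reg_lam := (hr _ (by simp)).trans h.reg_lam
  reg_p := (hr _ (by simp)).trans h.reg_p
  coef i hi := by rw [ha, h.coef i hi]
  cnt v l hl := by rw [ha, h.cnt v l hl]
  sk_lt v l hl j hj := by rw [ha]; exact h.sk_lt v l hl j hj
  sk v l hl j hj := by rw [ha, h.sk v l hl j hj]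

theorem nbrs_card_le (D : Fin n → Fin n → Prop) (v : Fin n) (l : ℕ) :
    (nbrs c a D v l).card ≤ n := by
  simpa using Finset.card_le_univ (nbrs c a D v l)

theorem halfCmd_holds {D : Fin n → Fin n → Prop} {u v : Fin n} {ins : Bool}
    (hσ : Holds c a D σ) (hk : σ.reg .kind = ins.toNat)
    (he : σ.reg .e = if ins then 1 else prm n - 2) (hD : D u v ↔ ins = false)
    (hu : σ.reg .u = u) (hv : σ.reg .v = v) (ha : ∀ i, a i < prm n)
    (hQ : ∀ τ, Holds c a (toggle ins D u v) τ →
      (∀ x, x ∉ [Reg.j, .a, .s, .x, .h, .t, .l, .r] → τ.reg x = σ.reg x) → Q τ) :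
    halfCmd.wp ω (lim c n) Q σ := by
  refine halfCmd_wp hσ.reg_n hσ.reg_len hσ.reg_lam hσ.reg_p hu hv hσ.coef ha (fun v' l hl => ?_)
    hσ.sk_lt fun τ hτ => hQ τ (hτ.holds hσ hk he hD) hτ.reg
  rw [hσ.cnt v' l hl]; exact nbrs_card_le _ _ _

/-- Processing an update changes the represented graph in both ordered pairs. -/
theorem updateCmd_wp {D : Fin n → Fin n → Prop} {u v : Fin n} {ins : Bool}
    (hσ : Holds c a D σ) (hk : σ.reg .kind = ins.toNat) (huv : u ≠ v)
    (hD : D u v ↔ ins = false) (hD' : D v u ↔ ins = false)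
    (hu : σ.reg .u = u) (hv : σ.reg .v = v) (ha : ∀ i, a i < prm n)
    (hQ : ∀ τ, Holds c a (toggle ins (toggle ins D u v) v u) τ → Q τ) :
    updateCmd.wp ω (lim c n) Q σ := by
  have hq := quad_lt_lim c n
  have hl := linear_le_quad n
  simp only [updateCmd, Cmd.block, Cmd.wp]
  -- the stores before the first, before the second and after the second round
  let I : ℕ → Store → Prop := fun k τ => τ.reg .kind = ins.toNat ∧
    (τ.reg .e = if ins then 1 else prm n - 2) ∧
    (if k = 2 then Holds c a D τ ∧ τ.reg .u = u ∧ τ.reg .v = v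
      else if k = 1 then Holds c a (toggle ins D u v) τ ∧ τ.reg .u = v ∧ τ.reg .v = u
      else Holds c a (toggle ins (toggle ins D u v) v u) τ)
  have start : ∀ z, z = (if ins then 1 else prm n - 2) →
      Exp.safe (lim c n) (σ.set .e z) 2 ∧ ∃ I : ℕ → Store → Prop,
      I (Exp.eval (σ.set .e z) 2) ((σ.set .e z).set .i (Exp.eval (σ.set .e z) 2)) ∧
      (∀ k τ, k < Exp.eval (σ.set .e z) 2 → I (k + 1) τ →
        halfCmd.wp ω (lim c n) (fun σ => Exp.safe (lim c n) σ (Exp.reg .u) ∧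
          Exp.safe (lim c n) (σ.set .s (Exp.eval σ (Exp.reg .u))) (Exp.reg .v) ∧
          Exp.safe (lim c n) ((σ.set .s (Exp.eval σ (Exp.reg .u))).set .u
            (Exp.eval (σ.set .s (Exp.eval σ (Exp.reg .u))) (Exp.reg .v))) (Exp.reg .s) ∧
          (fun τ' => τ'.reg .i = k ∧ I k τ') (((σ.set .s (Exp.eval σ (Exp.reg .u))).set .u
            (Exp.eval (σ.set .s (Exp.eval σ (Exp.reg .u))) (Exp.reg .v))).set .v
            (Exp.eval ((σ.set .s (Exp.eval σ (Exp.reg .u))).set .u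
            (Exp.eval (σ.set .s (Exp.eval σ (Exp.reg .u))) (Exp.reg .v))) (Exp.reg .s))))
          (τ.set .i k)) ∧
      ∀ τ, τ.reg .i = 0 → I 0 τ → Q τ := by
    intro z hz
    refine ⟨by simp; omega, I, ?_, ?_, ?_⟩
    · refine ⟨by simp [hk], by simp [hz], ?_⟩
      simp only [Exp.eval_ofNat, if_true]
      refine ⟨hσ.congr_reg (fun x hx => ?_) rfl, by simp [hu], by simp [hv]⟩
      simp at hx; simp [hx]
    · rintro k τ hk2 ⟨b1, b2, b3⟩
      have hk2 : k < 2 := by simpa using hk2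
      have hcong : ∀ {D' : Fin n → Fin n → Prop}, Holds c a D' τ →
          Holds c a D' (τ.set .i k) := fun h => h.congr_reg
        (fun x hx => by simp at hx; simp [hx]) rfl
      interval_cases k
      · simp only [zero_add, OfNat.one_ne_ofNat, if_false, if_true] at b3
        obtain ⟨b3, b4, b5⟩ := b3
        refine halfCmd_holds (hcong b3) (by simpa using b1) (by simpa using b2) (u := v) (v := u) ?_
          (by simpa using b4) (by simpa using b5) ha fun ρ c1 c2 => ?_
        · simp [toggle, huv, huv.symm, hD']
        · refine ⟨trivial, trivial, trivial, ?_, ?_, ?_, ?_⟩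
          · have := c2 .i (by simp); simpa using this
          · have := c2 .kind (by simp); simpa [b1] using this
          · have := c2 .e (by simp); simpa [b2] using this
          · simp only [OfNat.zero_ne_ofNat, zero_ne_one, if_false]
            exact c1.congr_reg (fun x hx => by simp at hx; simp [hx]) rfl
      · simp only [Nat.reduceAdd, if_true] at b3
        obtain ⟨b3, b4, b5⟩ := b3
        refine halfCmd_holds (hcong b3) (by simpa using b1) (by simpa using b2) (u := u) (v := v) hD
          (by simpa using b4) (by simpa using b5) ha fun ρ c1 c2 => ?_
        have d1 := c2 .u (by simp)
        have d2 := c2 .v (by simp)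
        refine ⟨trivial, trivial, trivial, ?_, ?_, ?_, ?_⟩
        · have := c2 .i (by simp); simpa using this
        · have := c2 .kind (by simp); simpa [b1] using this
        · have := c2 .e (by simp); simpa [b2] using this
        · simp only [OfNat.one_ne_ofNat, if_false, if_true]
          refine ⟨c1.congr_reg (fun x hx => by simp at hx; simp [hx]) rfl, ?_, ?_⟩
          · simpa [b5] using d2
          · simpa [b4] using d1
    · rintro τ - ⟨-, -, b3⟩
      simp only [OfNat.zero_ne_ofNat, zero_ne_one, if_false] at b3
      exact hQ τ b3
  refine ⟨by simp, fun h0 => ⟨by simp; omega, start 1 ?_⟩, fun h0 => ⟨by simp; omega, ?_⟩⟩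
  · cases ins
    · simp [hk] at h0
    · rfl
  · have := start (prm n - 2) (by
      cases ins
      · rfl
      · simp [hk] at h0)
    simpa [hσ.reg_p] using this

end Imp

/-! ### Computing the output -/

namespace Imp

/-- The `j`-th summand of Lagrange interpolation at the point `u`. -/
def termCmd : Cmd := .seq (.asg .q (.get .sk (Reg.r * (2 * Reg.lam + 1) + Reg.j)))
  (.down .i (2 * Reg.lam + 1) (.ite (((Reg.i : Exp) - Reg.j) + ((Reg.j : Exp) - Reg.i))
    (.seq (.asg .q ((Reg.q * (Reg.p + Reg.u - (Reg.n + Reg.i))) % Reg.p))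
      (.down .s (Reg.p - 2) (.asg .q ((Reg.q * (Reg.p + Reg.j - Reg.i)) % Reg.p)))) .skip))

/-- The value of the sketched polynomial at `u`, by Lagrange interpolation. -/
def evalCmd : Cmd := .seq (.asg .a 0) (.down .j (2 * Reg.lam + 1)
  (.seq termCmd (.asg .a (((Reg.a : Exp) + Reg.q) % Reg.p))))

/-- Write the edge from `v` to `u` if it is in the sketch and `v` is its endpoint of lower degree;
ties are broken by the numbers of the vertices. -/
def edgeCmd : Cmd := .seq evalCmd (.ite Reg.a .skip
  (.ite (.get .cnt (Reg.u * (Reg.len + 1) + Reg.len) * Reg.n + Reg.u - (Reg.d * Reg.n + Reg.v))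
    (.block [.emit Reg.v, .emit Reg.u, .emit Reg.p, .emit Reg.t]) .skip))

/-- Find the sampling level for the degree `d`. -/
def dropCmd : Cmd := .block [.asg .t Reg.p, .asg .l Reg.len,
  .down .i Reg.len (.ite ((Reg.d : Exp) * Reg.t - Reg.lam * Reg.p)
    (.seq (.asg .t (Reg.t / 2)) (.asg .l (Reg.l - 1))) .skip)]

/-- Write the edges that are sampled at `v`, unless there are too many of them. -/
def vertexCmd : Cmd := .seq (.asg .d (.get .cnt (Reg.v * (Reg.len + 1) + Reg.len)))
  (.seq dropCmd (.seq (.asg .r (Reg.v * (Reg.len + 1) + Reg.l))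
    (.ite (.get .cnt Reg.r - 2 * Reg.lam) .skip (.down .u Reg.n edgeCmd))))

/-- The program that is run after the stream. -/
def finishCmd : Cmd := .down .v Reg.n vertexCmd

theorem exists_drop (c n d : ℕ) : ∃ k, d * (prm n / 2 ^ k) ≤ lam c n * prm n :=
  ⟨prm n, by rw [Nat.div_eq_of_lt Nat.lt_two_pow_self]; simp⟩

/-- How often the threshold is halved for a vertex of degree `d`. -/
def drop (c n d : ℕ) : ℕ := Nat.find (exists_drop c n d)

theorem lam_pos {c n : ℕ} (hc : 1 ≤ c) (hn : 1 ≤ n) : 1 ≤ lam c n := by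
  have h1 : 1 ≤ len n := Nat.size_pos.2 hn
  exact le_min (Nat.mul_le_mul (Nat.mul_le_mul hc h1) h1) hn

/-- The `len n + 1` levels of the sketch suffice for all degrees. -/
theorem drop_le_len {c n d : ℕ} (hc : 1 ≤ c) (hn : 1 ≤ n) (hd : d ≤ n) : drop c n d ≤ len n := by
  refine Nat.find_min' _ ?_
  have h1 : d ≤ 2 ^ len n := hd.trans (Nat.lt_size_self n).le
  calc d * (prm n / 2 ^ len n) ≤ 2 ^ len n * (prm n / 2 ^ len n) := Nat.mul_le_mul_right _ h1
    _ ≤ prm n := Nat.mul_div_le _ _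
    _ ≤ lam c n * prm n := Nat.le_mul_of_pos_left _ (lam_pos hc hn)

theorem drop_spec (c n d : ℕ) : d * (prm n / 2 ^ drop c n d) ≤ lam c n * prm n :=
  Nat.find_spec (exists_drop c n d)

theorem lt_of_lt_drop {c n d k : ℕ} (hk : k < drop c n d) :
    lam c n * prm n < d * (prm n / 2 ^ k) :=
  not_le.1 (Nat.find_min (exists_drop c n d) hk)

/-- Lagrange interpolation of a polynomial that is given by its roots, with inverses computed by
Fermat's little theorem. -/
theorem lagrange_eval {c n : ℕ} (S : Finset (Fin n)) (hS : S.card ≤ 2 * lam c n) (u : ℕ) :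
    ∑ j ∈ Finset.range (2 * lam c n + 1), (∏ w ∈ S, ((n + j - w : ℕ) : ZMod (prm n))) *
      (∏ i ∈ Finset.range (2 * lam c n + 1), if i = j then 1 else
        ((u : ZMod (prm n)) - (n + i)) * ((j : ZMod (prm n)) - i) ^ (prm n - 2)) =
      ∏ w ∈ S, ((u : ZMod (prm n)) - (w : ℕ)) := by
  classical
  have := Fact.mk (prm_prime n)
  have h1 := linear_le_prm n
  have h2 := lam_le c n
  set K := 2 * lam c n + 1
  let x : ℕ → ZMod (prm n) := fun i => (n : ZMod (prm n)) + i
  have hinj0 : ∀ i < K, ∀ j < K, (i : ZMod (prm n)) = j → i = j := fun i hi j hj h => by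
    rw [ZMod.natCast_eq_natCast_iff] at h
    exact Nat.ModEq.eq_of_lt_of_lt h (by omega) (by omega)
  have hinj : Set.InjOn x (Finset.range K) := fun i hi j hj h => by
    refine hinj0 i (by simpa using hi) j (by simpa using hj) (add_left_cancel h)
  let f : Polynomial (ZMod (prm n)) := ∏ w ∈ S, (Polynomial.X - Polynomial.C ((w : ℕ) : ZMod (prm n)))
  have hdeg : f.degree < (Finset.range K).card := by
    rw [Polynomial.degree_prod]
    simp only [Polynomial.degree_X_sub_C, Finset.sum_const, Finset.card_range, nsmul_eq_mul,
      mul_one]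
    exact_mod_cast Nat.lt_succ_of_le hS
  have hf := congrArg (Polynomial.eval (u : ZMod (prm n))) (Lagrange.eq_interpolate hinj hdeg)
  have hev : ∀ y, f.eval y = ∏ w ∈ S, (y - ((w : ℕ) : ZMod (prm n))) := fun y => by
    simp [f, Polynomial.eval_prod]
  rw [hev, Lagrange.interpolate_apply, Polynomial.eval_finsetSum] at hf
  rw [hf]
  refine Finset.sum_congr rfl fun j hj => ?_
  rw [Polynomial.eval_mul, Polynomial.eval_C, hev]
  congr 1
  · refine Finset.prod_congr rfl fun w _ => ?_
    rw [Nat.cast_sub (by omega)]; push_cast; rfl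
  · rw [Lagrange.basis, Polynomial.eval_prod, ← Finset.mul_prod_erase _ _ hj, if_pos rfl, one_mul]
    refine Finset.prod_congr rfl fun i hi => ?_
    have hij := Finset.ne_of_mem_erase hi
    have hiK := Finset.mem_of_mem_erase hi
    rw [if_neg hij, Lagrange.basisDivisor, Polynomial.eval_mul, Polynomial.eval_C,
      Polynomial.eval_sub, Polynomial.eval_X, Polynomial.eval_C, mul_comm]
    congr 1
    have hne : (j : ZMod (prm n)) - i ≠ 0 := fun h => hij
      (hinj0 j (by simpa using hj) i (by simpa using hiK) (sub_eq_zero.1 h)).symm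
    have h3 : x j - x i = (j : ZMod (prm n)) - i := by simp only [x]; ring
    rw [h3]
    exact eq_inv_of_mul_eq_one_right (mul_pow_inv (prm_prime n) hne)

/-- The out-degree of a directed graph. -/
noncomputable def outDeg {n : ℕ} (D : Fin n → Fin n → Prop) (v : Fin n) : ℕ := by
  classical exact (Finset.univ.filter (D v)).card

open scoped Classical in
/-- The output for the ordered pair `(v, u)`. -/
noncomputable def edgeOut (c : ℕ) {n : ℕ} (a : ℕ → ℕ) (D : Fin n → Fin n → Prop) (v u : Fin n) :
    List ℕ :=
  if u ∈ nbrs c a D v (len n - drop c n (outDeg D v)) ∧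
      outDeg D v * n + v < outDeg D u * n + u
  then [(v : ℕ), u, prm n, prm n / 2 ^ drop c n (outDeg D v)] else []

open scoped Classical in
/-- The output for the vertex `v`. -/
noncomputable def vertexOut (c : ℕ) {n : ℕ} (a : ℕ → ℕ) (D : Fin n → Fin n → Prop) (v : Fin n) :
    List ℕ :=
  if (nbrs c a D v (len n - drop c n (outDeg D v))).card ≤ 2 * lam c n then
    (List.finRange n).reverse.flatMap (edgeOut c a D v) else []

/-- The output for the whole graph. -/
noncomputable def graphOut (c : ℕ) {n : ℕ} (a : ℕ → ℕ) (D : Fin n → Fin n → Prop) : List ℕ :=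
  (List.finRange n).reverse.flatMap (vertexOut c a D)

/-- The concatenation of the lists `f (k - 1), …, f 0`. -/
def below {n : ℕ} (f : Fin n → List ℕ) : ℕ → List ℕ
  | 0 => []
  | k + 1 => (if h : k < n then f ⟨k, h⟩ else []) ++ below f k

theorem below_eq {n : ℕ} (f : Fin n → List ℕ) :
    below f n = (List.finRange n).reverse.flatMap f := by
  have h : ∀ k (hk : k ≤ n), below f k =
      (List.finRange k).reverse.flatMap fun i => f (Fin.castLE hk i) := by
    intro k
    induction k with
    | zero => intro _; simp [below]
    | succ k ih =>
      intro hk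
      rw [below, dif_pos (Nat.lt_of_succ_le hk), ih (by omega), List.finRange_succ_last]
      simp [List.flatMap_map, ← List.map_reverse]
      rfl
  simpa using h n le_rfl

section Finish

variable {ω : ℕ → Bool} {c n : ℕ} {σ : Store} {Q : Store → Prop} {a : ℕ → ℕ}
  {D : Fin n → Fin n → Prop}

/-- At the highest level everything is sampled, so that its counters are the degrees. -/
theorem nbrs_len (v : Fin n) : (nbrs c a D v (len n)).card = outDeg D v := by
  classical
  unfold outDeg nbrs
  congr 1
  ext w
  simp [thr, hashVal, Nat.mod_lt _ (prm_prime n).pos]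

theorem termCmd_wp {r j u : ℕ} (h1 : σ.reg .n = n) (h3 : σ.reg .lam = lam c n)
    (h4 : σ.reg .p = prm n) (hr : σ.reg .r = r) (hr' : r < n * (len n + 1)) (hu : σ.reg .u = u)
    (hu' : u < n) (hj : σ.reg .j = j) (hj' : j < 2 * lam c n + 1)
    (hlt : σ.arr .sk (r * (2 * lam c n + 1) + j) < prm n)
    (hQ : ∀ τ, EqOff [.q, .i, .s] σ τ → τ.reg .q < prm n → (τ.reg .q : ZMod (prm n)) =
      σ.arr .sk (r * (2 * lam c n + 1) + j) *
      ∏ i ∈ Finset.range (2 * lam c n + 1), (if i = j then 1 else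
        ((u : ZMod (prm n)) - (n + i)) * ((j : ZMod (prm n)) - i) ^ (prm n - 2)) → Q τ) :
    termCmd.wp ω (lim c n) Q σ := by
  have hq := quad_lt_lim c n
  have hl := linear_le_quad n
  have hq2 := prm_le_quad n
  have hlam := lam_le c n
  have hrow := rows_le_quad n
  have hp4 := linear_le_prm n
  have hp0 := (prm_prime n).pos
  simp only [termCmd, Cmd.wp]
  set K := 2 * lam c n + 1 with hK
  have hA : (lim c n).A = n * (len n + 1) * K := rfl
  have hidx := row_lt hr' hj'
  rw [← hA] at hidx
  have hm := mul_add_lt_lim (c := c) (n := n) (a := r) (b := K) (by omega) (by omega)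
  let g : ℕ → ZMod (prm n) := fun i => if i = j then 1 else
        ((u : ZMod (prm n)) - (n + i)) * ((j : ZMod (prm n)) - i) ^ (prm n - 2)
  refine ⟨by simp [h3, hr, hj, ← hK]; omega, by simp [h3]; omega, fun k τ =>
    EqOff [.q, .i, .s] σ τ ∧ τ.reg .q < prm n ∧
    (τ.reg .q : ZMod (prm n)) = σ.arr .sk (r * K + j) * ∏ i ∈ Finset.Ico k K, g i, ?_, ?_, ?_⟩
  · refine ⟨((EqOff.refl _ σ).set (by simp) _).set (by simp) _, ?_, ?_⟩
    · simpa [hr, h3, hj] using hlt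
    · simp [hr, h3, hj, ← hK]
  · rintro k τ hk ⟨b1, b2, b3⟩
    have hk : k < K := by simpa [h3, hK] using hk
    have e1 : τ.reg .p = prm n := (b1.reg _ (by simp)).trans h4
    have e2 : τ.reg .j = j := (b1.reg _ (by simp)).trans hj
    have e3 : τ.reg .u = u := (b1.reg _ (by simp)).trans hu
    have e4 : τ.reg .n = n := (b1.reg _ (by simp)).trans h1
    have hprod := Finset.prod_eq_prod_Ico_succ_bot hk g
    refine ⟨by simp [e2]; omega, fun h0 => ?_, fun h0 => ?_⟩
    · have h0 : k ≠ j := by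
        rintro rfl
        simp [e2] at h0
      have hgk : g k = ((u : ZMod (prm n)) - (n + k)) * ((j : ZMod (prm n)) - k) ^ (prm n - 2) :=
        if_neg h0
      have hm2 := mul_add_lt_lim (c := c) (n := n) (a := τ.reg .q) (b := prm n + u - (n + k))
        (by omega) (by omega)
      have hc1 : ((prm n + u - (n + k) : ℕ) : ZMod (prm n)) = (u : ZMod (prm n)) - (n + k) := by
        rw [Nat.cast_sub (by omega)]; simp
      have hc2 : ((prm n + j - k : ℕ) : ZMod (prm n)) = (j : ZMod (prm n)) - k := by
        rw [Nat.cast_sub (by omega)]; simp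
      refine ⟨by simp [e1, e3, e4]; omega, by simp; omega, fun m ρ =>
        EqOff [.q, .i, .s] σ ρ ∧ ρ.reg .i = k ∧ ρ.reg .q < prm n ∧ m ≤ prm n - 2 ∧
        (ρ.reg .q : ZMod (prm n)) = τ.reg .q * ((u : ZMod (prm n)) - (n + k)) *
          ((j : ZMod (prm n)) - k) ^ (prm n - 2 - m), ?_, ?_, ?_⟩
      · refine ⟨((b1.set (by simp) _).set (by simp) _).set (by simp) _, by simp, ?_, by simp [e1],
          ?_⟩
        · simp [e1, Nat.mod_lt _ hp0]
        · simp [e1, e3, e4, ← hc1]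
      · rintro m ρ - ⟨c1, c2, c3, c4, c5⟩
        have f1 : ρ.reg .p = prm n := (c1.reg _ (by simp)).trans h4
        have f2 : ρ.reg .j = j := (c1.reg _ (by simp)).trans hj
        have hm3 := mul_add_lt_lim (c := c) (n := n) (a := ρ.reg .q) (b := prm n + j - k)
          (by omega) (by omega)
        refine ⟨by simp [f1, f2, c2]; omega, by simp, (c1.set (by simp) _).set (by simp) _,
          by simp [c2], by simp [f1, Nat.mod_lt _ hp0], by omega, ?_⟩
        simp only [Store.set_reg, if_true, Exp.eval_mod, Exp.eval_mul, Exp.eval_reg, Exp.eval_sub,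
          Exp.eval_add, reduceCtorEq, if_false, f1, f2, c2]
        rw [ZMod.natCast_mod, Nat.cast_mul, c5, hc2, mul_assoc, ← pow_succ]
        congr 2; omega
      · rintro ρ - ⟨c1, c2, c3, c4, c5⟩
        refine ⟨c2, c1, c3, ?_⟩
        rw [c5, b3, hprod, hgk, Nat.sub_zero]; ring
    · have h0 : k = j := by
        simp [e2] at h0; omega
      have hgk : g k = 1 := if_pos h0
      exact ⟨by simp, b1.set (by simp) _, by simpa using b2, by simp [b3, hprod, hgk]⟩
  · rintro τ - ⟨b1, b2, b3⟩
    exact hQ τ b1 b2 (by rw [b3, Finset.range_eq_Ico])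

/-- The sketched polynomial vanishes at `u` if and only if `u` is one of its roots. -/
theorem evalCmd_wp {r u : ℕ} (h1 : σ.reg .n = n) (h3 : σ.reg .lam = lam c n)
    (h4 : σ.reg .p = prm n) (hr : σ.reg .r = r) (hr' : r < n * (len n + 1)) (hu : σ.reg .u = u)
    (hu' : u < n) (hlt : ∀ j < 2 * lam c n + 1, σ.arr .sk (r * (2 * lam c n + 1) + j) < prm n)
    (S : Finset (Fin n)) (hS : S.card ≤ 2 * lam c n)
    (hsk : ∀ j < 2 * lam c n + 1, (σ.arr .sk (r * (2 * lam c n + 1) + j) : ZMod (prm n)) =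
      ∏ w ∈ S, ((n + j - w : ℕ) : ZMod (prm n)))
    (hQ : ∀ τ, EqOff [.q, .i, .s, .j, .a] σ τ → (τ.reg .a = 0 ↔ (⟨u, hu'⟩ : Fin n) ∈ S) → Q τ) :
    evalCmd.wp ω (lim c n) Q σ := by
  have hq := quad_lt_lim c n
  have hl := linear_le_quad n
  have hq2 := prm_le_quad n
  have hlam := lam_le c n
  have hp4 := linear_le_prm n
  have hp0 := (prm_prime n).pos
  have := Fact.mk (prm_prime n)
  let g : ℕ → ZMod (prm n) := fun j => (∏ w ∈ S, ((n + j - w : ℕ) : ZMod (prm n))) *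
      (∏ i ∈ Finset.range (2 * lam c n + 1), if i = j then 1 else
        ((u : ZMod (prm n)) - (n + i)) * ((j : ZMod (prm n)) - i) ^ (prm n - 2))
  simp only [evalCmd, Cmd.wp]
  refine ⟨by simp; omega, by simp [h3]; omega, fun k τ => EqOff [.q, .i, .s, .j, .a] σ τ ∧
    τ.reg .a < prm n ∧ (τ.reg .a : ZMod (prm n)) =
      ∑ j ∈ Finset.Ico k (2 * lam c n + 1), g j, ?_, ?_, ?_⟩
  · refine ⟨((EqOff.refl _ σ).set (by simp) _).set (by simp) _, by simp [hp0], by simp [h3]⟩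
  · rintro k τ hk ⟨b1, b2, b3⟩
    have hk : k < 2 * lam c n + 1 := by simpa [h3] using hk
    have e1 : τ.reg .p = prm n := (b1.reg _ (by simp)).trans h4
    have e2 : τ.reg .lam = lam c n := (b1.reg _ (by simp)).trans h3
    have e3 : τ.reg .u = u := (b1.reg _ (by simp)).trans hu
    have e4 : τ.reg .n = n := (b1.reg _ (by simp)).trans h1
    have e5 : τ.reg .r = r := (b1.reg _ (by simp)).trans hr
    refine termCmd_wp (r := r) (j := k) (u := u) (by simpa using e4) (by simpa using e2)
      (by simpa using e1) (by simpa using e5) hr' (by simpa using e3) hu' (by simp) hk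
      (by simpa [b1.arr] using hlt k hk) fun ρ c1 c2 c3 => ?_
    have f1 : ρ.reg .p = prm n := (c1.reg _ (by simp)).trans (by simpa using e1)
    have f2 : ρ.reg .a = τ.reg .a := (c1.reg _ (by simp)).trans (by simp)
    have f3 : ρ.reg .j = k := (c1.reg _ (by simp)).trans (by simp)
    refine ⟨by simp [f2]; omega, by simp [f3],
      ((b1.set (by simp) _).trans c1 (by simp)).set (by simp) _, by simp [f1, Nat.mod_lt _ hp0], ?_⟩
    rw [Finset.sum_eq_sum_Ico_succ_bot hk]
    simp only [Store.set_reg, if_true, Exp.eval_mod, Exp.eval_add, Exp.eval_reg, f1, f2]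
    rw [ZMod.natCast_mod, Nat.cast_add, b3, c3, add_comm, Store.set_arr, b1.arr, hsk k hk]
  · rintro τ - ⟨b1, b2, b3⟩
    refine hQ τ b1 ?_
    rw [← Finset.range_eq_Ico, lagrange_eval S hS u] at b3
    have h0 : τ.reg .a = 0 ↔ (τ.reg .a : ZMod (prm n)) = 0 := by
      rw [ZMod.natCast_eq_zero_iff]
      exact ⟨fun h => h ▸ dvd_zero _, fun h => Nat.eq_zero_of_dvd_of_lt h b2⟩
    rw [h0, b3, Finset.prod_eq_zero_iff]
    constructor
    · rintro ⟨w, hw, hw0⟩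
      have h6 := sub_eq_zero.1 hw0
      rw [ZMod.natCast_eq_natCast_iff] at h6
      have h7 := Nat.ModEq.eq_of_lt_of_lt h6 (by omega) (by omega)
      rwa [show (⟨u, hu'⟩ : Fin n) = w from Fin.ext h7]
    · exact fun h => ⟨_, h, sub_self _⟩

theorem outDeg_le (v : Fin n) : outDeg D v ≤ n := by
  rw [← nbrs_len (c := 0) (a := fun _ => 0)]; exact nbrs_card_le _ _ _

theorem dropCmd_wp {d : ℕ} (hc : 1 ≤ c) (hn : 1 ≤ n) (h2 : σ.reg .len = len n)
    (h3 : σ.reg .lam = lam c n) (h4 : σ.reg .p = prm n) (hd : σ.reg .d = d) (hd' : d ≤ n)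
    (hQ : ∀ τ, EqOff [.t, .l, .i] σ τ → τ.reg .t = prm n / 2 ^ drop c n d →
      τ.reg .l = len n - drop c n d → Q τ) :
    dropCmd.wp ω (lim c n) Q σ := by
  have hq := quad_lt_lim c n
  have hl := linear_le_quad n
  have hq2 := prm_le_quad n
  have hlam := lam_le c n
  have hlen := len_le n
  have hdl := drop_le_len hc hn hd'
  have hm2 := mul_add_lt_lim (c := c) (n := n) (a := lam c n) (b := prm n) (by omega) (by omega)
  simp only [dropCmd, Cmd.wp, Cmd.block]
  refine ⟨by simp, by simp, by simp, fun k τ => EqOff [.t, .l, .i] σ τ ∧ ∃ m ≤ drop c n d,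
    (m = drop c n d ∨ m + k = len n) ∧ τ.reg .t = prm n / 2 ^ m ∧ τ.reg .l = len n - m,
    ?_, ?_, ?_⟩
  · refine ⟨(((EqOff.refl _ σ).set (by simp) _).set (by simp) _).set (by simp) _, 0, Nat.zero_le _,
      Or.inr (by simp [h2]), by simp [h4], by simp [h2]⟩
  · rintro k τ - ⟨b1, m, b2, b3, b4, b5⟩
    have e1 : τ.reg .p = prm n := (b1.reg _ (by simp)).trans h4
    have e2 : τ.reg .lam = lam c n := (b1.reg _ (by simp)).trans h3
    have e3 : τ.reg .d = d := (b1.reg _ (by simp)).trans hd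
    have ht : prm n / 2 ^ m ≤ prm n := Nat.div_le_self _ _
    have hm1 := mul_add_lt_lim (c := c) (n := n) (a := d) (b := prm n / 2 ^ m) (by omega)
      (by omega)
    refine ⟨by simp [e1, e2, e3, b4]; omega, fun h0 => ?_, fun h0 => ?_⟩
    · have h0 : d * (prm n / 2 ^ m) - lam c n * prm n ≠ 0 := by simpa [e1, e2, e3, b4] using h0
      have hne : m ≠ drop c n d := by
        rintro rfl
        have := drop_spec c n d
        omega
      refine ⟨by simp; omega, by simp; omega, by simp,
        ((b1.set (by simp) _).set (by simp) _).set (by simp) _, m + 1, by omega,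
        Or.inr (by omega), ?_, ?_⟩
      · simp [b4, Nat.div_div_eq_div_mul, pow_succ]
      · simp [b5]; omega
    · have h0 : d * (prm n / 2 ^ m) - lam c n * prm n = 0 := by simpa [e1, e2, e3, b4] using h0
      have hne : m = drop c n d := by
        by_contra hne
        have := lt_of_lt_drop (c := c) (n := n) (d := d) (k := m) (by omega)
        omega
      exact ⟨by simp, b1.set (by simp) _, m, b2, Or.inl hne, by simpa using b4, by simpa using b5⟩
  · rintro τ - ⟨b1, m, b2, b3, b4, b5⟩
    have hm : m = drop c n d := by omega
    exact hQ τ b1 (hm ▸ b4) (hm ▸ b5)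

theorem edgeCmd_wp {v u : Fin n} (hσ : Holds c a D σ)
    (hd : σ.reg .d = outDeg D v) (hv : σ.reg .v = v) (hu : σ.reg .u = u)
    (ht : σ.reg .t = prm n / 2 ^ drop c n (outDeg D v))
    (hr : σ.reg .r = v * (len n + 1) + (len n - drop c n (outDeg D v)))
    (hcard : (nbrs c a D v (len n - drop c n (outDeg D v))).card ≤ 2 * lam c n)
    (hQ : ∀ τ, (∀ x, x ∉ [Reg.q, .i, .s, .j, .a] → τ.reg x = σ.reg x) → τ.arr = σ.arr →
      τ.out = σ.out ++ edgeOut c a D v u → Q τ) :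
    edgeCmd.wp ω (lim c n) Q σ := by
  have hq := quad_lt_lim c n
  have hl := linear_le_quad n
  have hlen := len_le n
  have hrow := rows_le_quad n
  have hln : len n - drop c n (outDeg D v) < len n + 1 := by omega
  have hr' := row_lt v.2 hln
  have hlu := row_lt u.2 (Nat.lt_add_one (len n))
  have hA : (lim c n).A = n * (len n + 1) * (2 * lam c n + 1) := rfl
  have hA' : n * (len n + 1) ≤ (lim c n).A := hA ▸ Nat.le_mul_of_pos_right _ (by omega)
  simp only [edgeCmd, Cmd.wp, Cmd.block]
  refine evalCmd_wp (u := u) hσ.reg_n hσ.reg_lam hσ.reg_p hr hr' hu u.2 (hσ.sk_lt v _ hln)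
    (nbrs c a D v (len n - drop c n (outDeg D v))) hcard (hσ.sk v _ hln) fun τ e he => ?_
  have e1 : τ.reg .n = n := (e.reg _ (by simp)).trans hσ.reg_n
  have e2 : τ.reg .len = len n := (e.reg _ (by simp)).trans hσ.reg_len
  have e3 : τ.reg .v = v := (e.reg _ (by simp)).trans hv
  have e4 : τ.reg .u = u := (e.reg _ (by simp)).trans hu
  have e5 : τ.reg .d = outDeg D v := (e.reg _ (by simp)).trans hd
  have e6 : τ.arr .cnt (u * (len n + 1) + len n) = outDeg D u := by
    rw [e.arr, hσ.cnt u _ (Nat.lt_succ_self _), nbrs_len]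
  have e7 : τ.reg .p = prm n := (e.reg _ (by simp)).trans hσ.reg_p
  have e8 := (e.reg .t (by simp)).trans ht
  have hdu := outDeg_le (D := D) u
  have hdv := outDeg_le (D := D) v
  have m1 := mul_add_lt_lim (c := c) (n := n) (a := (u : ℕ)) (b := len n + 1) (by omega) (by omega)
  have m2 := mul_add_lt_lim (c := c) (n := n) (a := outDeg D u) (b := n) (by omega) (by omega)
  have m3 := mul_add_lt_lim (c := c) (n := n) (a := outDeg D v) (b := n) (by omega) (by omega)
  refine ⟨by simp, fun h0 => ?_, fun h0 => ?_⟩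
  · have h0 : τ.reg .a ≠ 0 := by simpa using h0
    refine hQ τ e.reg e.arr ?_
    rw [edgeOut, if_neg (fun h => h0 (he.2 h.1)), List.append_nil, e.out]
  · have h0 : τ.reg .a = 0 := by simpa using h0
    refine ⟨by simp [e1, e2, e3, e4, e5, e6]; omega, fun h5 => ?_, fun h5 => ?_⟩
    · have h5 : outDeg D u * n + u - (outDeg D v * n + v) ≠ 0 := by
        simpa [e1, e2, e3, e4, e5, e6] using h5
      refine ⟨by simp, by simp, by simp, by simp, hQ _ e.reg e.arr ?_⟩
      rw [edgeOut, if_pos ⟨he.1 h0, by omega⟩]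
      simp [e.out, e3, e4, e7, e8]
    · have h5 : outDeg D u * n + u - (outDeg D v * n + v) = 0 := by
        simpa [e1, e2, e3, e4, e5, e6] using h5
      refine hQ τ e.reg e.arr ?_
      rw [edgeOut, if_neg (fun h => by omega), List.append_nil, e.out]

theorem Holds.congr {τ : Store} (h : Holds c a D σ)
    (hr : ∀ x ∈ [Reg.n, .len, .lam, .p], τ.reg x = σ.reg x) (ha : τ.arr = σ.arr) :
    Holds c a D τ where
  reg_n := (hr _ (by simp)).trans h.reg_n
  reg_len := (hr _ (by simp)).trans h.reg_len
  reg_lam := (hr _ (by simp)).trans h.reg_lam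
  reg_p := (hr _ (by simp)).trans h.reg_p
  coef i hi := by rw [ha, h.coef i hi]
  cnt v l hl := by rw [ha, h.cnt v l hl]
  sk_lt v l hl j hj := by rw [ha]; exact h.sk_lt v l hl j hj
  sk v l hl j hj := by rw [ha, h.sk v l hl j hj]

theorem vertexCmd_wp {v : Fin n} (hc : 1 ≤ c) (hσ : Holds c a D σ) (hv : σ.reg .v = v)
    (hQ : ∀ τ, Holds c a D τ → τ.reg .v = v → τ.out = σ.out ++ vertexOut c a D v → Q τ) :
    vertexCmd.wp ω (lim c n) Q σ := by
  have hq := quad_lt_lim c n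
  have hl := linear_le_quad n
  have hlen := len_le n
  have hlam := lam_le c n
  have hrow := rows_le_quad n
  have hn : 1 ≤ n := by have := v.2; omega
  have hA : (lim c n).A = n * (len n + 1) * (2 * lam c n + 1) := rfl
  have hA' : n * (len n + 1) ≤ (lim c n).A := hA ▸ Nat.le_mul_of_pos_right _ (by omega)
  have hlv := row_lt v.2 (Nat.lt_add_one (len n))
  have m1 := mul_add_lt_lim (c := c) (n := n) (a := (v : ℕ)) (b := len n + 1) (by omega) (by omega)
  have hcnt : σ.arr .cnt (v * (len n + 1) + len n) = outDeg D v := by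
    rw [hσ.cnt v _ (Nat.lt_succ_self _), nbrs_len]
  simp only [vertexCmd, Cmd.wp]
  refine ⟨by simp [hv, hσ.reg_len]; omega, ?_⟩
  refine dropCmd_wp (d := outDeg D v) hc hn (by simp [hσ.reg_len]) (by simp [hσ.reg_lam])
    (by simp [hσ.reg_p]) (by simp [hv, hσ.reg_len, hcnt]) (outDeg_le v) fun τ e ht htl => ?_
  have e1 : τ.reg .v = v := (e.reg _ (by simp)).trans (by simpa using hv)
  have e2 : τ.reg .len = len n := (e.reg _ (by simp)).trans (by simp [hσ.reg_len])
  have e3 : τ.reg .d = outDeg D v := (e.reg _ (by simp)).trans (by simp [hv, hσ.reg_len, hcnt])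
  have hτ : Holds c a D τ := hσ.congr (fun x hx => by
    rw [e.reg x (by simp at hx ⊢; rcases hx with rfl | rfl | rfl | rfl <;> simp)]
    simp at hx; rcases hx with rfl | rfl | rfl | rfl <;> simp) (by simp [e.arr])
  have hout : τ.out = σ.out := e.out
  set ℓ := len n - drop c n (outDeg D v) with hℓ
  have hln : ℓ < len n + 1 := by omega
  have hr' := row_lt v.2 hln
  have e4 : τ.arr .cnt (v * (len n + 1) + ℓ) = (nbrs c a D v ℓ).card := hτ.cnt v _ hln
  refine ⟨by simp [e1, e2, htl]; omega, by simp [e1, e2, htl, hτ.reg_lam]; omega,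
    fun h0 => ?_, fun h0 => ?_⟩
  · have h0 : (nbrs c a D v ℓ).card - 2 * lam c n ≠ 0 := by
      simpa [e1, e2, htl, hτ.reg_lam, e4] using h0
    refine hQ _ (hτ.congr (fun x hx => ?_) rfl) (by simp [e1]) ?_
    · simp at hx; rcases hx with rfl | rfl | rfl | rfl <;> simp
    · have h1 : ¬ (nbrs c a D v ℓ).card ≤ 2 * lam c n := by omega
      rw [vertexOut, if_neg h1]; simp [hout]
  · have h0 : (nbrs c a D v ℓ).card - 2 * lam c n = 0 := by
      simpa [e1, e2, htl, hτ.reg_lam, e4] using h0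
    have h1 : (nbrs c a D v ℓ).card ≤ 2 * lam c n := by omega
    refine ⟨by simp, fun k ρ => Holds c a D ρ ∧ ρ.reg .v = v ∧ ρ.reg .d = outDeg D v ∧
      ρ.reg .t = prm n / 2 ^ drop c n (outDeg D v) ∧ ρ.reg .r = v * (len n + 1) + ℓ ∧
      ρ.out ++ below (edgeOut c a D v) k = σ.out ++ below (edgeOut c a D v) n, ?_, ?_, ?_⟩
    · refine ⟨hτ.congr (fun x hx => ?_) rfl, by simp [e1], by simp [e3], by simp [ht],
        by simp [e1, e2, htl], by simp [hout, hτ.reg_n]⟩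
      simp at hx; rcases hx with rfl | rfl | rfl | rfl <;> simp
    · rintro k ρ hk ⟨b1, b2, b3, b4, b5, b6⟩
      have hk : k < n := by simpa [hτ.reg_n] using hk
      have b1' : Holds c a D (ρ.set .u k) := b1.congr (fun x hx => by
        simp at hx; rcases hx with rfl | rfl | rfl | rfl <;> simp) rfl
      refine edgeCmd_wp (v := v) (u := ⟨k, hk⟩) b1' (by simpa using b3) (by simpa using b2)
        (by simp) (by simpa using b4) (by simpa using b5) h1 fun ρ' c1 c2 c3 => ?_
      refine ⟨(c1 _ (by simp)).trans (by simp), b1'.congr (fun x hx => c1 x ?_) c2,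
        (c1 _ (by simp)).trans (by simpa using b2), (c1 _ (by simp)).trans (by simpa using b3),
        (c1 _ (by simp)).trans (by simpa using b4), (c1 _ (by simp)).trans (by simpa using b5), ?_⟩
      · simp at hx; rcases hx with rfl | rfl | rfl | rfl <;> simp
      · rw [← b6, c3, below, dif_pos hk, Store.set_out, List.append_assoc]
    · rintro ρ - ⟨b1, b2, b3, b4, b5, b6⟩
      refine hQ ρ b1 b2 ?_
      rw [vertexOut, if_pos h1, ← below_eq, ← b6, below, List.append_nil]

theorem finishCmd_wp (hc : 1 ≤ c) (hσ : Holds c a D σ) (ho : σ.out = [])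
    (hQ : ∀ τ, τ.out = graphOut c a D → Q τ) : finishCmd.wp ω (lim c n) Q σ := by
  simp only [finishCmd, Cmd.wp]
  refine ⟨by simp, fun k ρ => Holds c a D ρ ∧
    ρ.out ++ below (vertexOut c a D) k = below (vertexOut c a D) n, ?_, ?_, ?_⟩
  · refine ⟨hσ.congr (fun x hx => ?_) rfl, by simp [ho, hσ.reg_n]⟩
    simp at hx; rcases hx with rfl | rfl | rfl | rfl <;> simp
  · rintro k ρ hk ⟨b1, b2⟩
    have hk : k < n := by simpa [hσ.reg_n] using hk
    have b1' : Holds c a D (ρ.set .v k) := b1.congr (fun x hx => by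
      simp at hx; rcases hx with rfl | rfl | rfl | rfl <;> simp) rfl
    refine vertexCmd_wp (v := ⟨k, hk⟩) hc b1' (by simp) fun τ c1 c2 c3 => ⟨c2, c1, ?_⟩
    rw [← b2, c3, below, dif_pos hk, Store.set_out, List.append_assoc]
  · rintro ρ - ⟨b1, b2⟩
    refine hQ ρ ?_
    rw [graphOut, ← below_eq, ← b2, below, List.append_nil]

end Finish

end Imp

/-! ### The streaming algorithm -/

namespace Imp

/-- The streaming algorithm; the parameters enter through the constant `c` only. -/
def alg (c : ℕ) : StreamAlg := ⟨(setupCmd c).compile, updateCmd.compile, finishCmd.compile⟩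

/-- A bound on the lengths of the three programs. -/
def progTime : ℕ := (setupCmd 0).time 1 + updateCmd.time 1 + finishCmd.time 1

/-- A bound on the running time of the three programs. -/
def timeBound (c n : ℕ) : ℕ := progTime * (lim c n).V ^ 8 * (lim c n).unit

theorem Runs.exec {c n : ℕ} {ω : ℕ → Bool} {P : Cmd} {s s' : Config}
    (h : Runs (lim c n) ω P.compile s (P.time (lim c n).V) s') (h1 : P.time 1 ≤ progTime)
    (h2 : P.nesting ≤ 8) :
    ∃ t b, Exec ω P.compile s t b s' ∧ t ≤ timeBound c n ∧ b ≤ (lim c n).bits := by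
  obtain ⟨t, b, a1, a2, a3⟩ := h
  refine ⟨t, b, a1, a2.trans (Nat.mul_le_mul_right _ ?_), a3⟩
  exact (P.time_le (by have := (lim c n).hV; omega) h2).trans (Nat.mul_le_mul_right _ h1)

theorem setupCmd_time (c : ℕ) : (setupCmd c).time 1 ≤ progTime := by
  have : (setupCmd c).time 1 = (setupCmd 0).time 1 := rfl
  unfold progTime; omega

theorem setupCmd_fits (c : ℕ) : (setupCmd c).fits = true := rfl

theorem setupCmd_nesting (c : ℕ) : (setupCmd c).nesting ≤ 8 := Nat.le_of_ble_eq_true rfl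

theorem coefs_lt (ω : ℕ → Bool) (c n i : ℕ) : coefs ω c n i < prm n :=
  Nat.mod_lt _ (prm_prime n).pos

theorem toggle_insert {n : ℕ} {G : SimpleGraph (Fin n)} {u v : Fin n} (h : u ≠ v) :
    toggle true (toggle true G.Adj u v) v u =
      (G ⊔ SimpleGraph.fromEdgeSet {s(u, v)}).Adj := by
  funext x y
  simp only [toggle, SimpleGraph.sup_adj, SimpleGraph.fromEdgeSet_adj, Set.mem_singleton_iff,
    Sym2.eq_iff]
  by_cases h1 : x = v ∧ y = u
  · obtain ⟨rfl, rfl⟩ := h1; simp [h.symm]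
  · by_cases h2 : x = u ∧ y = v
    · obtain ⟨rfl, rfl⟩ := h2; simp [h]
    · simp [h1, h2]

theorem toggle_delete {n : ℕ} {G : SimpleGraph (Fin n)} {u v : Fin n} :
    toggle false (toggle false G.Adj u v) v u = (G.deleteEdges {s(u, v)}).Adj := by
  funext x y
  simp only [toggle, SimpleGraph.deleteEdges_adj, Set.mem_singleton_iff, Sym2.eq_iff]
  by_cases h1 : x = v ∧ y = u
  · obtain ⟨rfl, rfl⟩ := h1; simp
  · by_cases h2 : x = u ∧ y = v
    · obtain ⟨rfl, rfl⟩ := h2; simp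
    · simp [h1, h2]

/-- After every update the memory represents the current graph. -/
theorem alg_reads {c n : ℕ} (hn : 1 ≤ n) {S T : ℝ} (hT : (timeBound c n : ℝ) ≤ T)
    (hS : ((lim c n).bits : ℝ) ≤ S) (ω : ℕ → Bool) {l : List (Update n)}
    {G : SimpleGraph (Fin n)} (hl : IsDynamicStream l G) :
    ∃ s τ, (alg c).Reads ω T S l s ∧ Okay (lim c n) s ∧ Repr s τ ∧
      Holds c (coefs ω c n) G.Adj τ := by
  have hq := quad_lt_lim c n
  have hql := linear_le_quad n
  have hcast : ∀ {t b : ℕ}, t ≤ timeBound c n → b ≤ (lim c n).bits → (t : ℝ) ≤ T ∧ (b : ℝ) ≤ S :=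
    fun h1 h2 => ⟨le_trans (Nat.cast_le.2 h1) hT, le_trans (Nat.cast_le.2 h2) hS⟩
  -- one update
  have step : ∀ {l : List (Update n)} {G : SimpleGraph (Fin n)} {s : Config} {τ : Store}
      {u v : Fin n} (ins : Bool) (e : Update n), (alg c).Reads ω T S l s → Okay (lim c n) s →
      Repr s τ → Holds c (coefs ω c n) G.Adj τ → u ≠ v → (G.Adj u v ↔ ins = false) →
      StreamAlg.feed s e = ((s.write 1 ins.toNat).write 2 u).write 3 v →
      ∃ s' τ', (alg c).Reads ω T S (l ++ [e]) s' ∧ Okay (lim c n) s' ∧ Repr s' τ' ∧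
        Holds c (coefs ω c n) (toggle ins (toggle ins G.Adj u v) v u) τ' := by
    intro l G s τ u v ins e h1 h2 h3 h4 huv hadj hfeed
    have hins := Bool.toNat_le ins
    have o1 : Okay (lim c n) (StreamAlg.feed s e) := by
      rw [hfeed]
      exact ((h2.write_low (by omega) (by omega)).write_low (by omega) (by omega)).write_low
        (by omega) (by omega)
    have r1 : Repr (StreamAlg.feed s e) (((τ.set .kind ins.toNat).set .u u).set .v v) := by
      rw [hfeed]
      exact ((h3.set .kind _).set .u _).set .v _
    have hH : Holds c (coefs ω c n) G.Adj (((τ.set .kind ins.toNat).set .u u).set .v v) :=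
      h4.congr_reg (fun x hx => by simp at hx; simp [hx]) rfl
    obtain ⟨s', τ', a1, a2, a3, a4⟩ := updateCmd.compile_runs (L := lim c n) (ω := ω) rfl o1 r1
      (updateCmd_wp (ω := ω) (u := u) (v := v) (ins := ins) hH (by simp) huv hadj
        (by rw [G.adj_comm]; exact hadj) (by simp) (by simp) (coefs_lt ω c n) fun τ h => h)
    obtain ⟨t, b, b1, b2, b3⟩ := a1.exec (by unfold progTime; omega) (Nat.le_of_ble_eq_true rfl)
    exact ⟨s', τ', .snoc h1 b1 (hcast b2 b3).1 (hcast b2 b3).2, a2, a3, a4⟩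
  induction hl with
  | nil =>
    have o1 : Okay (lim c n) (StreamAlg.start n) := by
      refine ⟨fun a _ => ?_, fun a ha h0 => absurd ?_ h0⟩
      · classical
        simp only [StreamAlg.start, Finsupp.single_apply]
        split_ifs <;> omega
      · classical
        simp only [StreamAlg.start, Finsupp.single_apply]
        rw [if_neg (by omega)]
    have r1 : Repr (StreamAlg.start n) ⟨fun x => if x = .n then n else 0, fun _ _ => 0, 0, []⟩ := by
      refine ⟨fun x => ?_, fun A k => ?_, rfl, rfl⟩
      · classical
        simp only [StreamAlg.start, Finsupp.single_apply]
        cases x <;> simp [Reg.cell]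
      · classical
        simp only [StreamAlg.start, Finsupp.single_apply]
        have := A.le_addr k
        rw [if_neg (by omega)]
    have hw : (setupCmd c).wp ω (lim c n) (Holds c (coefs ω c n) (⊥ : SimpleGraph (Fin n)).Adj)
        ⟨fun x => if x = .n then n else 0, fun _ _ => 0, 0, []⟩ := by
      refine setupCmd_wp hn (by simp) rfl (fun _ _ => rfl)
        fun τ h1 h2 h3 h4 h5 h6 h7 => ⟨h1, h2, h3, h4, h5, fun v l hl => ?_, fun v l hl j hj => ?_,
          fun v l hl j hj => ?_⟩
      · rw [h6, eq_comm, Finset.card_eq_zero]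
        ext w; simp [mem_nbrs]
      · rw [h7 _ (row_lt (row_lt v.2 hl) hj)]
        exact (prm_prime n).one_lt
      · rw [h7 _ (row_lt (row_lt v.2 hl) hj), Finset.prod_eq_one fun w hw => ?_, Nat.cast_one]
        simp [mem_nbrs] at hw
    obtain ⟨s', τ', a1, a2, a3, a4⟩ :=
      (setupCmd c).compile_runs (L := lim c n) (ω := ω) (setupCmd_fits c) o1 r1 hw
    obtain ⟨t, b, b1, b2, b3⟩ := a1.exec (setupCmd_time c) (setupCmd_nesting c)
    exact ⟨s', τ', .nil b1 (hcast b2 b3).1 (hcast b2 b3).2, a2, a3, a4⟩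
  | insert h huv hadj ih =>
    obtain ⟨s, τ, h1, h2, h3, h4⟩ := ih
    rw [← toggle_insert huv]
    exact step true _ h1 h2 h3 h4 huv (by simpa using hadj) rfl
  | delete h hadj ih =>
    obtain ⟨s, τ, h1, h2, h3, h4⟩ := ih
    rw [← toggle_delete]
    exact step false _ h1 h2 h3 h4 hadj.ne (by simpa using hadj) rfl

theorem alg_outputs {c n : ℕ} (hc : 1 ≤ c) (hn : 1 ≤ n) {S T : ℝ}
    (hT : (timeBound c n : ℝ) ≤ T) (hS : ((lim c n).bits : ℝ) ≤ S) (ω : ℕ → Bool)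
    {l : List (Update n)} {G : SimpleGraph (Fin n)} (hl : IsDynamicStream l G) :
    (alg c).Outputs ω T S l (graphOut c (coefs ω c n) G.Adj) := by
  obtain ⟨s, τ, h1, h2, h3, h4⟩ := alg_reads hn hT hS ω hl
  have o1 : Okay (lim c n) { s with out := [] } := ⟨h2.low, h2.high⟩
  have r1 : Repr { s with out := [] } { τ with out := [] } := ⟨h3.reg, h3.arr, h3.coins, rfl⟩
  obtain ⟨s', τ', a1, a2, a3, a4⟩ := finishCmd.compile_runs (L := lim c n) (ω := ω) rfl o1 r1
    (finishCmd_wp (ω := ω) hc (h4.congr (fun _ _ => rfl) rfl) rfl fun τ h => h)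
  obtain ⟨t, b, b1, b2, b3⟩ := a1.exec (by unfold progTime; omega) (Nat.le_of_ble_eq_true rfl)
  exact ⟨s, s', t, b, h1, b1, le_trans (Nat.cast_le.2 b2) hT, le_trans (Nat.cast_le.2 b3) hS,
    a3.out.trans a4⟩

end Imp

/-! ### Concentration for random polynomials over a finite field -/

namespace PolyHash

/-- The value at `x` of the polynomial with the coefficients `c`. -/
def ev {p k : ℕ} (c : Fin k → ZMod p) (x : ZMod p) : ZMod p := ∑ i, c i * x ^ (i : ℕ)

section Moments

variable {p : ℕ} [Fact p.Prime] {ι : Type*} [DecidableEq ι]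

/-- The average of a function on the field. -/
noncomputable def avg (g : ZMod p → ℝ) : ℝ := (∑ y, g y) / p

theorem card_pos' : (0 : ℝ) < p := Nat.cast_pos.2 (Fact.out : p.Prime).pos

theorem sum_eq_avg (g : ZMod p → ℝ) : ∑ y, g y = p * avg g := by
  rw [avg, mul_div_cancel₀ _ (card_pos' (p := p)).ne']

theorem sum_prod_eq [Fintype ι] (T : Finset ι) (g : ι → ZMod p → ℝ) :
    ∑ f : ι → ZMod p, ∏ e ∈ T, g e (f e) = (p : ℝ) ^ Fintype.card ι * ∏ e ∈ T, avg (g e) := by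
  have h1 : ∀ f : ι → ZMod p, ∏ e ∈ T, g e (f e) = ∏ e, if e ∈ T then g e (f e) else 1 :=
    fun f => by rw [Finset.prod_ite_mem, Finset.univ_inter]
  have h2 := Finset.prod_univ_sum (R := ℝ) (fun _ : ι => (Finset.univ : Finset (ZMod p)))
    (fun e y => if e ∈ T then g e y else 1)
  rw [Fintype.piFinset_univ] at h2
  rw [Finset.sum_congr rfl fun f _ => h1 f, ← h2]
  have h3 : ∀ e, (∑ y, if e ∈ T then g e y else 1) = (p : ℝ) * if e ∈ T then avg (g e) else 1 := by
    intro e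
    split_ifs
    · exact sum_eq_avg _
    · simp [ZMod.card]
  rw [Finset.prod_congr rfl fun e _ => h3 e, Finset.prod_mul_distrib, Finset.prod_ite_mem,
    Finset.univ_inter, Finset.prod_const, Finset.card_univ]

/-- The values of a random polynomial at as many points as it has coefficients determine it. -/
theorem ev_bijective {k : ℕ} {x : Fin k → ZMod p} (hx : Function.Injective x) :
    Function.Bijective fun (c : Fin k → ZMod p) (i : Fin k) => ev c (x i) := by
  have h1 : (fun (c : Fin k → ZMod p) (i : Fin k) => ev c (x i)) =
      (Matrix.vandermonde x).mulVec := by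
    funext c i
    simp [ev, Matrix.mulVec, dotProduct, Matrix.vandermonde_apply, mul_comm]
  rw [h1]
  refine (Finite.injective_iff_bijective).1 (Matrix.mulVec_injective_of_isUnit ?_)
  rw [Matrix.isUnit_iff_isUnit_det]
  exact (Matrix.det_vandermonde_ne_zero_iff.2 hx).isUnit

/-- The values of a random polynomial at no more points than it has coefficients are independent
and uniform. -/
theorem sum_ev_eq {k : ℕ} (hk : k ≤ p) {enc : ι → ZMod p} (henc : Function.Injective enc)
    (T : Finset ι) (hT : T.card ≤ k) (g : ι → ZMod p → ℝ) :
    ∑ c : Fin k → ZMod p, ∏ e ∈ T, g e (ev c (enc e)) = (p : ℝ) ^ k * ∏ e ∈ T, avg (g e) := by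
  classical
  obtain ⟨U, hU, hUc⟩ := Finset.exists_superset_card_eq (s := T.image enc) (n := k)
    (by rwa [Finset.card_image_of_injective _ henc]) (by rwa [ZMod.card])
  let φ := U.equivFinOfCardEq hUc
  let x : Fin k → ZMod p := fun i => (φ.symm i : ZMod p)
  have hx : Function.Injective x := fun i j h => φ.symm.injective (Subtype.ext h)
  -- the index of the interpolation point that belongs to an element of `T`
  have hmem : ∀ e ∈ T, enc e ∈ U := fun e he => hU (Finset.mem_image_of_mem _ he)
  let idx : T → Fin k := fun e => φ ⟨enc e, hmem e e.2⟩
  have hidx : Function.Injective idx := fun e e' h => by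
    have := congrArg Subtype.val (φ.injective h)
    exact Subtype.ext (henc this)
  have hxi : ∀ e : T, x (idx e) = enc e := fun e => by simp [x, idx]
  have h1 : ∀ (f : ι → ℝ), ∏ e ∈ T, f e = ∏ e : T, f e := fun f =>
    (Finset.prod_coe_sort T f).symm
  let G : Fin k → ZMod p → ℝ := fun i y =>
    ∏ e : T, if idx e = i then g e y else 1
  have hG : ∀ e : T, G (idx e) = g e := by
    intro e
    funext y
    rw [show G (idx e) y = ∏ e' : T, if idx e' = idx e then g e' y else 1 from rfl]
    simp only [hidx.eq_iff, Finset.prod_ite_eq', Finset.mem_univ, if_true]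
  have h2 : ∀ c : Fin k → ZMod p, ∏ e ∈ T, g e (ev c (enc e)) =
      ∏ i ∈ Finset.univ.image idx, G i (ev c (x i)) := by
    intro c
    rw [h1 fun e => g e (ev c (enc e)), Finset.prod_image fun a _ b _ h => hidx h]
    exact Finset.prod_congr rfl fun e _ => by rw [hG, hxi]
  rw [Finset.sum_congr rfl fun c _ => h2 c,
    (ev_bijective hx).sum_comp fun f => ∏ i ∈ Finset.univ.image idx, G i (f i),
    sum_prod_eq, Fintype.card_fin, h1 fun e => avg (g e), Finset.prod_image fun a _ b _ h => hidx h]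
  simp only [hG]

/-- A moment of low order of a sum over the values of a random polynomial is the same as for
independent uniform values. -/
theorem moment_eq [Fintype ι] {k r : ℕ} (hk : k ≤ p) {enc : ι → ZMod p} (henc : Function.Injective enc)
    (hr : r ≤ k) (D : Finset ι) (Y : ι → ZMod p → ℝ) :
    (∑ c : Fin k → ZMod p, (∑ e ∈ D, Y e (ev c (enc e))) ^ r) * (p : ℝ) ^ Fintype.card ι =
      (p : ℝ) ^ k * ∑ f : ι → ZMod p, (∑ e ∈ D, Y e (f e)) ^ r := by
  simp only [Finset.sum_pow']
  rw [Finset.sum_comm, Finset.sum_comm (s := (Finset.univ : Finset (ι → ZMod p))),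
    Finset.sum_mul, Finset.mul_sum]
  refine Finset.sum_congr rfl fun a _ => ?_
  have h1 : ∀ v : ι → ZMod p, ∏ i : Fin r, Y (a i) (v (a i)) =
      ∏ e ∈ Finset.univ.image a, Y e (v e) ^ (Finset.univ.filter fun i => a i = e).card :=
    fun v => Finset.prod_comp (fun e => Y e (v e)) a
  have h2 : (Finset.univ.image a).card ≤ k :=
    Finset.card_image_le.trans (by simpa using hr)
  rw [Finset.sum_congr rfl fun c _ => h1 fun e => ev c (enc e), Finset.sum_congr rfl fun f _ => h1 f,
    sum_ev_eq hk henc _ h2 fun e y => Y e y ^ (Finset.univ.filter fun i => a i = e).card,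
    sum_prod_eq _ fun e y => Y e y ^ (Finset.univ.filter fun i => a i = e).card]
  ring

/-- The exponential moment of a centred bounded variable, from `exp x ≤ 1 + x + x²` for `|x| ≤ 1`. -/
theorem avg_exp_le {Y : ZMod p → ℝ} {θ M v : ℝ} (hθ : 0 ≤ θ) (hM : θ * M ≤ 1)
    (hY0 : avg Y = 0) (hY : ∀ y, |Y y| ≤ M) (hv : avg (fun y => Y y ^ 2) ≤ v) {s : ℝ}
    (hs : |s| = θ) : avg (fun y => Real.exp (s * Y y)) ≤ Real.exp (θ ^ 2 * v) := by
  have hp := card_pos' (p := p)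
  have h1 : ∀ y, Real.exp (s * Y y) ≤ 1 + s * Y y + θ ^ 2 * Y y ^ 2 := by
    intro y
    have h2 : |s * Y y| ≤ 1 := by
      rw [abs_mul, hs]; exact (mul_le_mul_of_nonneg_left (hY y) hθ).trans hM
    have h3 := (abs_le.1 (Real.abs_exp_sub_one_sub_id_le h2)).2
    have h4 : (s * Y y) ^ 2 = θ ^ 2 * Y y ^ 2 := by rw [mul_pow, ← sq_abs s, hs]
    linarith
  have h2 : avg (fun y => Real.exp (s * Y y)) ≤ 1 + θ ^ 2 * avg (fun y => Y y ^ 2) := by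
    unfold avg at *
    rw [div_le_iff₀ hp]
    have h5 : ∑ y, Y y = 0 := by
      rcases div_eq_zero_iff.1 hY0 with h | h
      exacts [h, absurd h hp.ne']
    calc _ ≤ ∑ y, (1 + s * Y y + θ ^ 2 * Y y ^ 2) := Finset.sum_le_sum fun y _ => h1 y
      _ = p + s * ∑ y, Y y + θ ^ 2 * ∑ y, Y y ^ 2 := by
        rw [Finset.sum_add_distrib, Finset.sum_add_distrib, ← Finset.mul_sum, ← Finset.mul_sum]
        simp [ZMod.card]
      _ = _ := by rw [h5]; field_simp; ring
  calc _ ≤ 1 + θ ^ 2 * v := h2.trans (by gcongr)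
    _ ≤ _ := by rw [add_comm]; exact Real.add_one_le_exp _

/-- A moment bound for sums of independent centred bounded variables, by way of the exponential
moment. -/
theorem moment_le [Fintype ι] {D : Finset ι} {Y : ι → ZMod p → ℝ} {θ M : ℝ} {v : ι → ℝ} (hθ : 0 ≤ θ)
    (hM : θ * M ≤ 1) (hY0 : ∀ e ∈ D, avg (Y e) = 0) (hY : ∀ e ∈ D, ∀ y, |Y e y| ≤ M)
    (hv : ∀ e ∈ D, avg (fun y => Y e y ^ 2) ≤ v e) (m : ℕ) :
    θ ^ (2 * m) * ∑ f : ι → ZMod p, (∑ e ∈ D, Y e (f e)) ^ (2 * m) ≤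
      (2 * m).factorial * ((p : ℝ) ^ Fintype.card ι * (2 * Real.exp (θ ^ 2 * ∑ e ∈ D, v e))) := by
  have hexp : ∀ s : ℝ, |s| = θ → ∑ f : ι → ZMod p, Real.exp (s * ∑ e ∈ D, Y e (f e)) ≤
      (p : ℝ) ^ Fintype.card ι * Real.exp (θ ^ 2 * ∑ e ∈ D, v e) := by
    intro s hs
    have h1 : ∀ f : ι → ZMod p, Real.exp (s * ∑ e ∈ D, Y e (f e)) =
        ∏ e ∈ D, Real.exp (s * Y e (f e)) := fun f => by rw [Finset.mul_sum, Real.exp_sum]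
    rw [Finset.sum_congr rfl fun f _ => h1 f, sum_prod_eq D fun e y => Real.exp (s * Y e y),
      Finset.mul_sum, Real.exp_sum]
    refine mul_le_mul_of_nonneg_left (Finset.prod_le_prod (fun e _ => ?_) fun e he =>
      avg_exp_le hθ hM (hY0 e he) (hY e he) (hv e he) hs) (by positivity)
    unfold avg; positivity
  have h2 : ∀ z : ℝ, θ ^ (2 * m) * z ^ (2 * m) ≤
      (2 * m).factorial * (Real.exp (θ * z) + Real.exp (-θ * z)) := by
    intro z
    have h3 := Real.pow_div_factorial_le_exp |θ * z| (abs_nonneg _) (2 * m)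
    rw [div_le_iff₀ (by positivity), Even.pow_abs (by simp), mul_pow] at h3
    refine h3.trans ?_
    rw [mul_comm]
    refine mul_le_mul_of_nonneg_left ?_ (by positivity)
    rcases abs_cases (θ * z) with h | h
    · rw [h.1]; linarith [Real.exp_pos (-θ * z)]
    · rw [h.1, ← neg_mul]; linarith [Real.exp_pos (θ * z)]
  rw [Finset.mul_sum]
  refine (Finset.sum_le_sum fun f _ => h2 _).trans ?_
  rw [← Finset.mul_sum, Finset.sum_add_distrib]
  refine mul_le_mul_of_nonneg_left ?_ (by positivity)
  have h3 := hexp θ (abs_of_nonneg hθ)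
  have h4 := hexp (-θ) (by rw [abs_neg, abs_of_nonneg hθ])
  linarith

/-- Concentration: the tail bound for sums of independent variables holds for the values of a
random polynomial with at least `2 m` coefficients, as it follows from the moment of order
`2 m`. -/
theorem card_tail_le [Fintype ι] {k m : ℕ} (hk : k ≤ p) {enc : ι → ZMod p} (henc : Function.Injective enc)
    (hm : 1 ≤ m) (hmk : 2 * m ≤ k) {D : Finset ι} {Y : ι → ZMod p → ℝ} {t M : ℝ} {v : ι → ℝ}
    (hM0 : 0 < M) (hY0 : ∀ e ∈ D, avg (Y e) = 0) (hY : ∀ e ∈ D, ∀ y, |Y e y| ≤ M)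
    (hv : ∀ e ∈ D, avg (fun y => Y e y ^ 2) ≤ v e)
    (ht : 16 * m * M ≤ t) (ht2 : 256 * m * ∑ e ∈ D, v e ≤ t ^ 2) :
    ((Finset.univ.filter fun c : Fin k → ZMod p =>
      t ≤ |∑ e ∈ D, Y e (ev c (enc e))|).card : ℝ) ≤ (1 / 8) ^ m * (p : ℝ) ^ k := by
  have hp := card_pos' (p := p)
  have hm0 : (1 : ℝ) ≤ m := by exact_mod_cast hm
  have ht0 : 0 < t := lt_of_lt_of_le (by positivity) ht
  set θ : ℝ := 16 * m / t with hθ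
  have hθ0 : 0 < θ := by positivity
  have hθt : θ * t = 8 * (2 * m : ℕ) := by rw [hθ]; push_cast; field_simp; norm_num
  have hθM : θ * M ≤ 1 := by
    rw [hθ, div_mul_eq_mul_div, div_le_one ht0]; exact ht
  have hθV : θ ^ 2 * ∑ e ∈ D, v e ≤ m := by
    rw [hθ, div_pow, div_mul_eq_mul_div, div_le_iff₀ (by positivity)]
    nlinarith
  have h1 := moment_le (ι := ι) hθ0.le hθM hY0 hY hv m
  have h2 := moment_eq hk henc hmk D Y
  set Z : (Fin k → ZMod p) → ℝ := fun c => ∑ e ∈ D, Y e (ev c (enc e)) with hZ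
  set B := Finset.univ.filter fun c => t ≤ |Z c| with hB
  have h3 : (B.card : ℝ) * t ^ (2 * m) ≤ ∑ c, Z c ^ (2 * m) := by
    calc (B.card : ℝ) * t ^ (2 * m) = ∑ c ∈ B, t ^ (2 * m) := by simp
      _ ≤ ∑ c ∈ B, Z c ^ (2 * m) := by
        refine Finset.sum_le_sum fun c hc => ?_
        rw [← Even.pow_abs (n := 2 * m) (by simp) (Z c)]
        exact pow_le_pow_left₀ ht0.le (Finset.mem_filter.1 hc).2 _
      _ ≤ _ := Finset.sum_le_univ_sum_of_nonneg fun c => Even.pow_nonneg (by simp) _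
  have hpι : (0 : ℝ) < (p : ℝ) ^ Fintype.card ι := by positivity
  have h4 : θ ^ (2 * m) * ∑ c, Z c ^ (2 * m) ≤
      (2 * m).factorial * ((p : ℝ) ^ k * (2 * Real.exp m)) := by
    have h5 : θ ^ (2 * m) * (∑ c, Z c ^ (2 * m)) * (p : ℝ) ^ Fintype.card ι ≤
        (2 * m).factorial * ((p : ℝ) ^ k * (2 * Real.exp m)) * (p : ℝ) ^ Fintype.card ι := by
      calc _ = (p : ℝ) ^ k * (θ ^ (2 * m) *
            ∑ f : ι → ZMod p, (∑ e ∈ D, Y e (f e)) ^ (2 * m)) := by rw [mul_assoc, h2]; ring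
        _ ≤ (p : ℝ) ^ k * ((2 * m).factorial *
            ((p : ℝ) ^ Fintype.card ι * (2 * Real.exp m))) := by
          refine mul_le_mul_of_nonneg_left (h1.trans ?_) (by positivity)
          gcongr
        _ = _ := by ring
    exact le_of_mul_le_mul_right h5 hpι
  have h6 : ((2 * m).factorial : ℝ) ≤ ((2 * m : ℕ) : ℝ) ^ (2 * m) := by
    exact_mod_cast Nat.factorial_le_pow (2 * m)
  have h7 : Real.exp m ≤ 3 ^ m := by
    rw [← mul_one (m : ℝ), Real.exp_nat_mul]
    exact pow_le_pow_left₀ (Real.exp_pos _).le (by linarith [Real.exp_one_lt_d9]) _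
  have hpos : (0 : ℝ) < ((2 * m : ℕ) : ℝ) ^ (2 * m) := by positivity
  have h8 : (B.card : ℝ) * 8 ^ (2 * m) ≤ (p : ℝ) ^ k * (2 * 3 ^ m) := by
    refine le_of_mul_le_mul_right ?_ hpos
    calc (B.card : ℝ) * 8 ^ (2 * m) * ((2 * m : ℕ) : ℝ) ^ (2 * m)
        = θ ^ (2 * m) * (B.card * t ^ (2 * m)) := by
          rw [mul_assoc, ← mul_pow, ← hθt, mul_pow]; ring
      _ ≤ θ ^ (2 * m) * ∑ c, Z c ^ (2 * m) := mul_le_mul_of_nonneg_left h3 (by positivity)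
      _ ≤ ((2 * m : ℕ) : ℝ) ^ (2 * m) * ((p : ℝ) ^ k * (2 * 3 ^ m)) := by
          refine h4.trans ?_
          gcongr
      _ = _ := by ring
  have h9 : (2 : ℝ) * 3 ^ m ≤ 8 ^ m := by
    obtain ⟨r, rfl⟩ : ∃ r, m = r + 1 := ⟨m - 1, by omega⟩
    have : (3 : ℝ) ^ r ≤ 8 ^ r := by gcongr; norm_num
    rw [pow_succ, pow_succ]
    nlinarith [show (0 : ℝ) < 8 ^ r by positivity]
  have h10 : (B.card : ℝ) * 8 ^ m ≤ (p : ℝ) ^ k := by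
    refine le_of_mul_le_mul_right ?_ (show (0 : ℝ) < 8 ^ m by positivity)
    calc (B.card : ℝ) * 8 ^ m * 8 ^ m = B.card * 8 ^ (2 * m) := by rw [two_mul, pow_add]; ring
      _ ≤ _ := h8.trans (mul_le_mul_of_nonneg_left h9 (by positivity))
  rw [one_div, inv_pow, ← div_eq_inv_mul, le_div_iff₀ (by positivity)]
  exact h10

end Moments

end PolyHash

/-! ### Sampling the edges of a graph -/

namespace Sparsify

open Imp PolyHash

instance (n : ℕ) : Fact (prm n).Prime := ⟨prm_prime n⟩

section Sampling

variable {c n : ℕ} (G : SimpleGraph (Fin n))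

/-- The number of hash values for which an edge that belongs to `v` is sampled. -/
noncomputable def cutoff (c : ℕ) (v : Fin n) : ℕ := prm n / 2 ^ drop c n (outDeg G.Adj v)

/-- The edge from `v` to `u` belongs to its endpoint `v` of lower degree; ties are broken by the
numbers of the vertices. -/
def Owns (v u : Fin n) : Prop :=
  G.Adj v u ∧ outDeg G.Adj v * n + v < outDeg G.Adj u * n + u

/-- The point at which the hash polynomial is evaluated for an ordered pair. -/
def enc (e : Fin n × Fin n) : ZMod (prm n) := ((e.1 * n + e.2 : ℕ) : ZMod (prm n))

/-- The deviation of the sampled weight of an edge from its expectation one, as a function of the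
hash value. -/
noncomputable def dev (c : ℕ) (e : Fin n × Fin n) (y : ZMod (prm n)) : ℝ :=
  (prm n : ℝ) / cutoff G c e.1 *
    ((if y.val < cutoff G c e.1 then 1 else 0) - (cutoff G c e.1 : ℝ) / prm n)

theorem enc_injective : Function.Injective (enc (n := n)) := by
  rintro ⟨v, u⟩ ⟨v', u'⟩ h
  simp only [enc] at h
  rw [ZMod.natCast_eq_natCast_iff] at h
  have h1 := le_prm n
  have h2 := row_lt v.2 u.2
  have h3 := row_lt v'.2 u'.2
  have h4 := Nat.ModEq.eq_of_lt_of_lt h (by nlinarith) (by nlinarith)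
  rw [row_inj u.2 u'.2] at h4
  exact Prod.ext (Fin.ext h4.1) (Fin.ext h4.2)

theorem cutoff_le (v : Fin n) : cutoff G c v ≤ prm n := Nat.div_le_self _ _

theorem mul_cutoff_le (v : Fin n) : outDeg G.Adj v * cutoff G c v ≤ lam c n * prm n :=
  drop_spec _ _ _

theorem cutoff_eq {v : Fin n} (h : outDeg G.Adj v ≤ lam c n) : cutoff G c v = prm n := by
  have : drop c n (outDeg G.Adj v) = 0 := by
    rw [drop, Nat.find_eq_zero, pow_zero, Nat.div_one]
    exact Nat.mul_le_mul_right _ h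
  rw [cutoff, this, pow_zero, Nat.div_one]

/-- If not everything is sampled, then at least a third of the `lam c n` neighbours that are aimed at
are expected: the threshold before the last halving was too large, and halving a number of at least
three with rounding down loses at most a factor of three. -/
theorem prm_mul_lam_le {v : Fin n} (hc : 1 ≤ c) (h : lam c n < outDeg G.Adj v) :
    lam c n * prm n ≤ 3 * outDeg G.Adj v * cutoff G c v ∧ 1 ≤ cutoff G c v := by
  have hn : 1 ≤ n := by have := v.2; omega
  have h0 : drop c n (outDeg G.Adj v) ≠ 0 := by
    intro h0
    have h1 := drop_spec c n (outDeg G.Adj v)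
    rw [h0, pow_zero, Nat.div_one] at h1
    exact absurd (le_of_mul_le_mul_right h1 (prm_prime n).pos) (not_le.2 h)
  obtain ⟨r, hr⟩ := Nat.exists_eq_succ_of_ne_zero h0
  have h1 := lt_of_lt_drop (c := c) (n := n) (d := outDeg G.Adj v) (k := r) (by omega)
  have h2 : cutoff G c v = prm n / 2 ^ r / 2 := by
    rw [cutoff, hr, Nat.div_div_eq_div_mul, pow_succ]
  set t := prm n / 2 ^ r with ht
  have h3 := linear_le_prm n
  have h4 := outDeg_le (D := G.Adj) v
  have h5 := lam_pos hc hn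
  have h6 : 2 < t := by
    by_contra h6
    have h7 : outDeg G.Adj v * t ≤ n * 2 := Nat.mul_le_mul h4 (by omega)
    have h8 : 1 * prm n ≤ lam c n * prm n := Nat.mul_le_mul_right _ h5
    omega
  have h7 : t ≤ 3 * cutoff G c v := by omega
  refine ⟨?_, by omega⟩
  have h8 := Nat.mul_le_mul_left (outDeg G.Adj v) h7
  calc _ ≤ outDeg G.Adj v * (3 * cutoff G c v) := by omega
    _ = _ := by ring

theorem cutoff_pos (hc : 1 ≤ c) (v : Fin n) : 0 < cutoff G c v := by
  by_cases h : outDeg G.Adj v ≤ lam c n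
  · rw [cutoff_eq G h]; exact (prm_prime n).pos
  · exact (prm_mul_lam_le G hc (not_le.1 h)).2

theorem avg_lt {t : ℕ} (ht : t ≤ prm n) :
    avg (fun y : ZMod (prm n) => if y.val < t then (1 : ℝ) else 0) = t / prm n := by
  classical
  have h1 : (Finset.univ.filter fun y : ZMod (prm n) => y.val < t).card = t := by
    rw [← Finset.card_range t]
    refine Finset.card_bij (fun y _ => y.val) (fun y hy => ?_) (fun y _ y' _ h =>
      ZMod.val_injective _ h) (fun k hk => ?_)
    · simpa using hy
    · have hk : k < t := by simpa using hk
      have : ((k : ZMod (prm n))).val = k := ZMod.val_cast_of_lt (by omega)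
      exact ⟨k, by simpa [this] using hk, this⟩
  unfold avg
  rw [Finset.sum_boole, h1]

theorem avg_dev (e : Fin n × Fin n) : avg (dev G c e) = 0 := by
  have hp := card_pos' (p := prm n)
  have hs := sum_eq_avg (p := prm n) (fun y => if y.val < cutoff G c e.1 then (1 : ℝ) else 0)
  rw [avg_lt (cutoff_le G e.1)] at hs
  unfold avg dev
  rw [← Finset.mul_sum, Finset.sum_sub_distrib, hs]
  simp [ZMod.card]

theorem dev_eq_zero {e : Fin n × Fin n} (h : cutoff G c e.1 = prm n) (y : ZMod (prm n)) :
    dev G c e y = 0 := by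
  have hp := card_pos' (p := prm n)
  have hy := ZMod.val_lt y
  rw [dev, h, if_pos hy, div_self hp.ne', sub_self, mul_zero]

theorem abs_dev_le {e : Fin n × Fin n} {M : ℝ} (hM : 0 ≤ M)
    (h : cutoff G c e.1 = prm n ∨ (prm n : ℝ) / cutoff G c e.1 ≤ M) (y : ZMod (prm n)) :
    |dev G c e y| ≤ M := by
  have hp := card_pos' (p := prm n)
  rcases h with h | h
  · rw [dev_eq_zero G h, abs_zero]; exact hM
  · have h1 : (0 : ℝ) ≤ (prm n : ℝ) / cutoff G c e.1 := by positivity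
    have h2 : (cutoff G c e.1 : ℝ) / prm n ≤ 1 := by
      rw [div_le_one hp]; exact_mod_cast cutoff_le G e.1
    have h3 : (0 : ℝ) ≤ (cutoff G c e.1 : ℝ) / prm n := by positivity
    rw [dev, abs_mul, abs_of_nonneg h1]
    refine le_trans (mul_le_of_le_one_right h1 ?_) h
    rw [abs_le]; split_ifs <;> constructor <;> linarith

/-- The variance of the weight of an edge is at most its maximal weight. -/
theorem avg_dev_sq_le (hc : 1 ≤ c) {e : Fin n × Fin n} {M : ℝ} (hM : 0 ≤ M)
    (h : cutoff G c e.1 = prm n ∨ (prm n : ℝ) / cutoff G c e.1 ≤ M) :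
    avg (fun y => dev G c e y ^ 2) ≤ M := by
  have hp := card_pos' (p := prm n)
  rcases h with h | h
  · simpa [dev_eq_zero G h, avg] using hM
  · refine le_trans ?_ h
    have ht : (0 : ℝ) < cutoff G c e.1 := by exact_mod_cast cutoff_pos G hc e.1
    have hs := sum_eq_avg (p := prm n) (fun y => if y.val < cutoff G c e.1 then (1 : ℝ) else 0)
    rw [avg_lt (cutoff_le G e.1)] at hs
    have h1 : ∀ y : ZMod (prm n), dev G c e y ^ 2 = ((prm n : ℝ) / cutoff G c e.1) ^ 2 *
        ((1 - 2 * ((cutoff G c e.1 : ℝ) / prm n)) * (if y.val < cutoff G c e.1 then (1 : ℝ) else 0) +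
          ((cutoff G c e.1 : ℝ) / prm n) ^ 2) := by
      intro y
      unfold dev; split_ifs <;> ring
    unfold avg
    rw [Finset.sum_congr rfl fun y _ => h1 y, ← Finset.mul_sum, Finset.sum_add_distrib,
      ← Finset.mul_sum, hs, Finset.sum_const, Finset.card_univ, ZMod.card, nsmul_eq_mul,
      div_le_iff₀ hp]
    have h2 : ((prm n : ℝ) / cutoff G c e.1) ^ 2 *
        ((1 - 2 * ((cutoff G c e.1 : ℝ) / prm n)) * (prm n * ((cutoff G c e.1 : ℝ) / prm n)) +
          prm n * ((cutoff G c e.1 : ℝ) / prm n) ^ 2) =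
        (prm n : ℝ) / cutoff G c e.1 * prm n - prm n := by
      field_simp; ring
    rw [h2]; linarith

/-- The number of coefficients is at most the size of the field. -/
theorem deg_le_prm (c n : ℕ) : Imp.deg c n ≤ prm n := by
  have h1 := le_prm n
  have h2 := lam_le c n
  have h3 : 2 * n * lam c n ≤ 2 * n * n := Nat.mul_le_mul_left _ h2
  nlinarith

/-- Concentration of the sampled weight of a set of edges. -/
theorem card_dev_le (hc : 1 ≤ c) {m : ℕ} (hm : 1 ≤ m) (hmk : 2 * m ≤ Imp.deg c n)
    {D : Finset (Fin n × Fin n)} {t M : ℝ} (hM : 0 < M)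
    (hD : ∀ e ∈ D, cutoff G c e.1 = prm n ∨ (prm n : ℝ) / cutoff G c e.1 ≤ M)
    (ht : 16 * m * M ≤ t) (ht2 : 256 * m * (M * D.card) ≤ t ^ 2) :
    ((Finset.univ.filter fun a : Fin (Imp.deg c n) → ZMod (prm n) =>
      t ≤ |∑ e ∈ D, dev G c e (ev a (enc e))|).card : ℝ) ≤
        (1 / 8) ^ m * (prm n : ℝ) ^ Imp.deg c n := by
  refine card_tail_le (v := fun _ => M) (deg_le_prm c n) enc_injective hm hmk hM
    (fun e _ => avg_dev G e) (fun e he => abs_dev_le G hM.le (hD e he))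
    (fun e he => avg_dev_sq_le G hc hM.le (hD e he)) ht ?_
  rw [Finset.sum_const, nsmul_eq_mul, mul_comm (D.card : ℝ)]
  exact ht2

/-- A vertex of degree at most `d` gives weights `O(d / lam c n)` to its edges, unless it gives the
exact weight one. -/
theorem prm_div_cutoff_le (hc : 1 ≤ c) {v : Fin n} {d : ℝ} (hd : (outDeg G.Adj v : ℝ) ≤ d) :
    cutoff G c v = prm n ∨ (prm n : ℝ) / cutoff G c v ≤ 3 * d / lam c n := by
  by_cases h : outDeg G.Adj v ≤ lam c n
  · exact Or.inl (cutoff_eq G h)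
  · right
    have hn : 1 ≤ n := by have := v.2; omega
    have h1 : (0 : ℝ) < lam c n := by exact_mod_cast lam_pos hc hn
    have h2 : (0 : ℝ) < cutoff G c v := by exact_mod_cast cutoff_pos G hc v
    rw [div_le_div_iff₀ h2 h1]
    have h3 : (lam c n * prm n : ℝ) ≤ 3 * outDeg G.Adj v * cutoff G c v := by
      exact_mod_cast (prm_mul_lam_le G hc (not_le.1 h)).1
    have h4 : 3 * (outDeg G.Adj v : ℝ) * cutoff G c v ≤ 3 * d * cutoff G c v := by gcongr
    linarith

end Sampling

end Sparsify

/-! ### The sampled graph -/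

namespace Sparsify

open Imp PolyHash

section Decode

theorem blocks_append {l : List ℕ} (h : 4 ∣ l.length) (l' : List ℕ) :
    StreamAlg.blocks (l ++ l') = StreamAlg.blocks l ++ StreamAlg.blocks l' := by
  obtain ⟨k, hk⟩ := h
  induction k generalizing l with
  | zero => rw [List.length_eq_zero_iff.1 hk]; rfl
  | succ k ih =>
    match l, hk with
    | u :: v :: a :: b :: l, hk =>
      have : l.length = 4 * k := by simp only [List.length_cons] at hk; omega
      simp only [List.cons_append, StreamAlg.blocks, ih this]

theorem blocks_flatMap {ι : Type*} (f : ι → List ℕ) (hf : ∀ i, 4 ∣ (f i).length) (l : List ι) :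
    StreamAlg.blocks (l.flatMap f) = l.flatMap fun i => StreamAlg.blocks (f i) := by
  induction l with
  | nil => rfl
  | cons i l ih => rw [List.flatMap_cons, blocks_append (hf i), ih, List.flatMap_cons]

theorem sum_flatMap {ι κ : Type*} (f : ι → List κ) (g : κ → ℝ) (l : List ι) :
    ((l.flatMap f).map g).sum = (l.map fun i => ((f i).map g).sum).sum := by
  induction l with
  | nil => rfl
  | cons i l ih => simp [ih]

theorem length_flatMap_dvd {ι : Type*} (f : ι → List ℕ) (hf : ∀ i, 4 ∣ (f i).length)
    (l : List ι) : 4 ∣ (l.flatMap f).length := by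
  induction l with
  | nil => simp
  | cons i l ih => rw [List.flatMap_cons, List.length_append]; exact dvd_add (hf i) ih

theorem sum_reverse_finRange {n : ℕ} (f : Fin n → ℝ) :
    ((List.finRange n).reverse.map f).sum = ∑ i, f i := by
  rw [List.map_reverse, List.sum_reverse, Fin.sum_univ_def]

theorem sum_blocks_flatMap {n : ℕ} (f : Fin n → List ℕ) (hf : ∀ i, 4 ∣ (f i).length)
    (g : ℕ × ℕ × ℕ × ℕ → ℝ) :
    ((StreamAlg.blocks ((List.finRange n).reverse.flatMap f)).map g).sum =
      ∑ i, ((StreamAlg.blocks (f i)).map g).sum := by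
  rw [blocks_flatMap f hf, sum_flatMap, sum_reverse_finRange]

theorem edgeOut_length (c : ℕ) {n : ℕ} (a : ℕ → ℕ) (D : Fin n → Fin n → Prop) (v u : Fin n) :
    4 ∣ (edgeOut c a D v u).length := by
  rw [edgeOut]; split_ifs <;> simp

theorem vertexOut_length (c : ℕ) {n : ℕ} (a : ℕ → ℕ) (D : Fin n → Fin n → Prop) (v : Fin n) :
    4 ∣ (vertexOut c a D v).length := by
  rw [vertexOut]; split_ifs
  · exact length_flatMap_dvd _ (edgeOut_length c a D v) _
  · simp

end Decode

section Graph

variable {c n : ℕ} (G : SimpleGraph (Fin n)) (α : Fin (Imp.deg c n) → ZMod (prm n))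

/-- The edge from `v` to `u` is sampled at `v`. -/
def Sampled (v u : Fin n) : Prop := (ev α (enc (v, u))).val < cutoff G c v

open scoped Classical in
/-- The sampled neighbours of `v`. -/
noncomputable def sampledNbrs (v : Fin n) : Finset (Fin n) := {w | G.Adj v w ∧ Sampled G α v w}

open scoped Classical in
/-- The weight that the owner `v` of the edge to `u` gives to it. -/
noncomputable def edgeWt (v u : Fin n) : ℝ :=
  if (sampledNbrs G α v).card ≤ 2 * lam c n ∧ Owns G v u ∧ Sampled G α v u then
    (prm n : ℝ) / cutoff G c v else 0

/-- The sampled graph for the hash polynomial with the coefficients `α`. -/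
noncomputable def sparsifier : WGraph (Fin n) where
  wt x y := edgeWt G α x y + edgeWt G α y x
  symm x y := add_comm _ _
  nonneg x y := by unfold edgeWt; split_ifs <;> positivity

theorem hashVal_eq (c n : ℕ) (a : ℕ → ℕ) (e : Fin n × Fin n) :
    hashVal c n a (e.1 * n + e.2) =
      (ev (fun i : Fin (Imp.deg c n) => (a i : ZMod (prm n))) (enc e)).val := by
  rw [hashVal, ← ZMod.val_natCast, ev, enc, Finset.sum_range]
  push_cast
  rfl

theorem nbrs_eq (hc : 1 ≤ c) (a : ℕ → ℕ) (v : Fin n) :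
    nbrs c a G.Adj v (len n - drop c n (outDeg G.Adj v)) =
      sampledNbrs G (fun i : Fin (Imp.deg c n) => (a i : ZMod (prm n))) v := by
  have hn : 1 ≤ n := by have := v.2; omega
  have h1 : drop c n (outDeg G.Adj v) ≤ len n := drop_le_len hc hn (outDeg_le v)
  have h2 : thr n (len n - drop c n (outDeg G.Adj v)) = cutoff G c v := by
    rw [thr, cutoff, Nat.sub_sub_self h1]
  ext w
  rw [mem_nbrs, h2, hashVal_eq c n a (v, w)]
  have h3 : w ∈ sampledNbrs G (fun i : Fin (Imp.deg c n) => (a i : ZMod (prm n))) v ↔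
      G.Adj v w ∧ Sampled G (fun i : Fin (Imp.deg c n) => (a i : ZMod (prm n))) v w := by
    simp [sampledNbrs]
  rw [h3, Sampled]

theorem edgeWt_eq_zero {v u : Fin n} (h : ¬ G.Adj v u) : edgeWt G α v u = 0 :=
  if_neg fun h' => h h'.2.1.1

theorem sum_edgeOut (hc : 1 ≤ c) (a : ℕ → ℕ) (g : ℕ × ℕ × ℕ × ℕ → ℝ) (v u : Fin n) :
    ((StreamAlg.blocks (edgeOut c a G.Adj v u)).map g).sum = open scoped Classical in
      if Owns G v u ∧ Sampled G (fun i : Fin (Imp.deg c n) => (a i : ZMod (prm n))) v u then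
        g (v, u, prm n, cutoff G c v) else 0 := by
  classical
  rw [edgeOut, nbrs_eq G hc]
  by_cases h : Owns G v u ∧ Sampled G (fun i : Fin (Imp.deg c n) => (a i : ZMod (prm n))) v u
  · rw [if_pos h, if_pos ⟨by simpa [sampledNbrs] using ⟨h.1.1, h.2⟩, h.1.2⟩]
    simp [StreamAlg.blocks, cutoff]
  · rw [if_neg h, if_neg]
    · simp [StreamAlg.blocks]
    · rintro ⟨h1, h2⟩
      have h1 := (Finset.mem_filter.1 h1).2
      exact h ⟨⟨h1.1, h2⟩, h1.2⟩

theorem wgraph_ext {V : Type} {H H' : WGraph V} (h : ∀ x y, H.wt x y = H'.wt x y) : H = H' := by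
  obtain ⟨w, _, _⟩ := H
  obtain ⟨w', _, _⟩ := H'
  have : w = w' := funext fun x => funext fun y => h x y
  subst this; rfl

/-- The output of the algorithm describes the sampled graph. -/
theorem decode_graphOut (hc : 1 ≤ c) (a : ℕ → ℕ) :
    StreamAlg.decode n (graphOut c a G.Adj) =
      sparsifier G fun i : Fin (Imp.deg c n) => (a i : ZMod (prm n)) := by
  classical
  set α := fun i : Fin (Imp.deg c n) => (a i : ZMod (prm n)) with hα
  refine wgraph_ext fun x y => ?_
  simp only [StreamAlg.decode, sparsifier]
  set g : ℕ × ℕ × ℕ × ℕ → ℝ := fun q =>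
    if (q.1 = (x : ℕ) ∧ q.2.1 = (y : ℕ)) ∨ (q.1 = (y : ℕ) ∧ q.2.1 = (x : ℕ))
    then (q.2.2.1 : ℝ) / q.2.2.2 else 0 with hg
  rw [graphOut, sum_blocks_flatMap _ (vertexOut_length c a G.Adj)]
  have h1 : ∀ v, ((StreamAlg.blocks (vertexOut c a G.Adj v)).map g).sum =
      ∑ u, if (v = x ∧ u = y) ∨ (v = y ∧ u = x) then edgeWt G α v u else 0 := by
    intro v
    rw [vertexOut, nbrs_eq G hc]
    by_cases h : (sampledNbrs G α v).card ≤ 2 * lam c n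
    · rw [if_pos h, sum_blocks_flatMap _ (edgeOut_length c a G.Adj v)]
      refine Finset.sum_congr rfl fun u _ => ?_
      rw [sum_edgeOut G hc, edgeWt]
      simp only [hg, Fin.val_inj, ← hα, show (sampledNbrs G α v).card ≤ 2 * lam c n from h, true_and]
      split_ifs <;> rfl
    · symm
      rw [if_neg h]
      simp only [StreamAlg.blocks, List.map_nil, List.sum_nil]
      refine Finset.sum_eq_zero fun u _ => ?_
      have h0 : edgeWt G α v u = 0 := if_neg fun h' => h h'.1
      rw [h0, ite_self]
  rw [Finset.sum_congr rfl fun v _ => h1 v]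
  by_cases hxy : x = y
  · subst hxy
    have h2 := edgeWt_eq_zero G α (G.loopless.irrefl x)
    rw [h2, add_zero]
    refine Finset.sum_eq_zero fun v _ => Finset.sum_eq_zero fun u _ => ?_
    split_ifs with h
    · have : v = x ∧ u = x := by tauto
      rw [this.1, this.2, h2]
    · rfl
  · have h2 : ∀ v u, (if (v = x ∧ u = y) ∨ (v = y ∧ u = x) then edgeWt G α v u else 0) =
        (if v = x then if u = y then edgeWt G α v u else 0 else 0) +
          (if v = y then if u = x then edgeWt G α v u else 0 else 0) := by
      intro v u
      by_cases a1 : v = x <;> by_cases a2 : v = y <;> by_cases a3 : u = x <;> by_cases a4 : u = y <;>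
        simp_all
    simp only [h2, Finset.sum_add_distrib]
    congr 1 <;> simp

theorem isSubgraph_sparsifier : (sparsifier G α).IsSubgraph (WGraph.ofSimple G) := by
  intro u v h
  have h1 : ¬ G.Adj u v := by
    intro h1
    simp [WGraph.ofSimple, h1] at h
  have h2 : ¬ G.Adj v u := fun h2 => h1 h2.symm
  simp only [sparsifier]
  rw [edgeWt_eq_zero G α h1, edgeWt_eq_zero G α h2, add_zero]

end Graph

section Cut

variable {n : ℕ}

open scoped Classical in
/-- The ordered pairs of elements of `C` of which exactly one lies in `S`. -/
noncomputable def cross (C S : Finset (Fin n)) : Finset (Fin n × Fin n) :=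
  {e | e.1 ∈ C ∧ e.2 ∈ C ∧ ¬ (e.1 ∈ S ↔ e.2 ∈ S)}

theorem mem_cross {C S : Finset (Fin n)} {e : Fin n × Fin n} :
    e ∈ cross C S ↔ e.1 ∈ C ∧ e.2 ∈ C ∧ ¬ (e.1 ∈ S ↔ e.2 ∈ S) := by
  simp [cross]

/-- Self loops do not contribute to cuts, so that a cut of an induced graph only sees the edges
inside `C`. -/
theorem cut_induceLoops (H : WGraph (Fin n)) (w : Fin n → Fin n → ℝ)
    (hw : ∀ x y, H.wt x y = w x y + w y x) (C : Finset (Fin n)) (S : Finset C) :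
    (H.induceLoops C).cut S =
      ∑ e ∈ cross C (S.map (Function.Embedding.subtype _)), w e.1 e.2 := by
  classical
  set S' := S.map (Function.Embedding.subtype _) with hS'
  have h1 : (H.induceLoops C).cut S = ∑ u ∈ S', ∑ v ∈ C \ S', H.wt u v := by
    have h2 : C \ S' = Sᶜ.map (Function.Embedding.subtype _) := by
      ext x
      by_cases hx : x ∈ C <;> simp [hS', hx]
    rw [h2, hS', Finset.sum_map]
    unfold WGraph.cut
    refine Finset.sum_congr rfl fun u hu => ?_
    rw [Finset.sum_map]
    refine Finset.sum_congr (by congr!) fun v hv => ?_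
    have : u ≠ v := by
      rintro rfl
      simp at hv; exact hv hu
    simp [WGraph.induceLoops, this]
  have hsub : S' ⊆ C := by
    intro x hx
    simp only [hS', Finset.mem_map, Function.Embedding.subtype_apply] at hx
    obtain ⟨y, _, rfl⟩ := hx
    exact y.2
  have h3 : cross C S' = S' ×ˢ (C \ S') ∪ (C \ S') ×ˢ S' := by
    ext e
    have a1 := @hsub e.1
    have a2 := @hsub e.2
    simp only [mem_cross, Finset.mem_union, Finset.mem_product, Finset.mem_sdiff]
    tauto
  have h4 : Disjoint (S' ×ˢ (C \ S')) ((C \ S') ×ˢ S') := by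
    rw [Finset.disjoint_left]
    intro e
    simp only [Finset.mem_product, Finset.mem_sdiff]
    tauto
  rw [h1, h3, Finset.sum_union h4, Finset.sum_product, Finset.sum_product_right,
    ← Finset.sum_add_distrib]
  refine Finset.sum_congr rfl fun u _ => ?_
  rw [← Finset.sum_add_distrib]
  exact Finset.sum_congr rfl fun v _ => hw u v

/-- The additional self loops preserve the volume. -/
theorem vol_induceLoops (H : WGraph (Fin n)) (C : Finset (Fin n)) (S : Finset C) :
    (H.induceLoops C).vol S = ∑ v ∈ S.map (Function.Embedding.subtype _), H.degree v := by
  classical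
  rw [Finset.sum_map]
  refine Finset.sum_congr rfl fun u _ => ?_
  simp only [WGraph.degree, WGraph.induceLoops, Finset.sum_add_distrib,
    Function.Embedding.subtype_apply]
  have h1 : ∑ x : C, H.wt u x = ∑ x ∈ C, H.wt u x := Finset.sum_coe_sort C fun x => H.wt u x
  rw [h1, ← Finset.sum_add_sum_compl C]
  exact congrArg₂ (· + ·) rfl ((Finset.sum_eq_single u (fun b _ hb => if_neg hb.symm)
    (fun h => absurd (Finset.mem_univ u) h)).trans ((if_pos rfl).trans (by congr!)))

theorem degree_ofSimple (G : SimpleGraph (Fin n)) (v : Fin n) :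
    (WGraph.ofSimple G).degree v = outDeg G.Adj v := by
  classical
  simp only [WGraph.degree, WGraph.ofSimple, outDeg, Finset.sum_boole]

end Cut

section Levels

variable {c n : ℕ} (G : SimpleGraph (Fin n))

theorem owns_le {v u : Fin n} (h : Owns G v u) : outDeg G.Adj v ≤ outDeg G.Adj u := by
  have h1 := h.2
  have h2 := u.2
  by_contra h3
  have : (outDeg G.Adj u + 1) * n ≤ outDeg G.Adj v * n := Nat.mul_le_mul_right _ (by omega)
  rw [add_mul] at this
  omega

open scoped Classical in
/-- Every edge is owned by exactly one of its endpoints. -/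
theorem ofSimple_wt (x y : Fin n) : (WGraph.ofSimple G).wt x y =
    (if Owns G x y then (1 : ℝ) else 0) + if Owns G y x then (1 : ℝ) else 0 := by
  simp only [WGraph.ofSimple]
  by_cases h : G.Adj x y
  · have hxy : (x : ℕ) ≠ y := fun h' => h.ne (Fin.ext h')
    have h3 : outDeg G.Adj x * n + x ≠ outDeg G.Adj y * n + y := fun h' =>
      hxy ((row_inj x.2 y.2).1 h').2
    rcases lt_or_gt_of_ne h3 with h4 | h4
    · rw [if_pos h, if_pos ⟨h, h4⟩, if_neg fun h' => absurd h'.2 (by omega), add_zero]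
    · rw [if_pos h, if_neg fun h' => absurd h'.2 (by omega), if_pos ⟨h.symm, h4⟩, zero_add]
  · rw [if_neg h, if_neg fun h' => h h'.1, if_neg fun h' => h h'.1.symm, add_zero]

open scoped Classical in
/-- The edges inside `C` that cross `S` and whose owners have a degree in `[2 ^ i, 2 ^ (i + 1))`. -/
noncomputable def level (i : ℕ) (C S : Finset (Fin n)) : Finset (Fin n × Fin n) :=
  {e ∈ cross C S | Owns G e.1 e.2 ∧ Nat.log 2 (outDeg G.Adj e.1) = i}

theorem mem_level {i : ℕ} {C S : Finset (Fin n)} {e : Fin n × Fin n} :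
    e ∈ level G i C S ↔
      e ∈ cross C S ∧ Owns G e.1 e.2 ∧ Nat.log 2 (outDeg G.Adj e.1) = i := by
  simp [level]

theorem outDeg_pos {v u : Fin n} (h : G.Adj v u) : 0 < outDeg G.Adj v := by
  classical
  unfold outDeg
  exact Finset.card_pos.2 ⟨u, by simpa using h⟩

theorem level_bounds {i : ℕ} {C S : Finset (Fin n)} {e : Fin n × Fin n} (h : e ∈ level G i C S) :
    2 ^ i ≤ outDeg G.Adj e.1 ∧ outDeg G.Adj e.1 < 2 ^ (i + 1) := by
  rw [mem_level] at h
  have := outDeg_pos G h.2.1.1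
  exact (Nat.log_eq_iff (Or.inr ⟨by norm_num, this.ne'⟩)).1 h.2.2

open scoped Classical in
/-- Only the vertices of degree at least `2 ^ i` are incident to edges of level `i`. -/
theorem level_filter (i : ℕ) (C S : Finset (Fin n)) :
    level G i C (S.filter fun v => 2 ^ i ≤ outDeg G.Adj v) = level G i C S := by
  ext e
  have key : Owns G e.1 e.2 → Nat.log 2 (outDeg G.Adj e.1) = i →
      2 ^ i ≤ outDeg G.Adj e.1 ∧ 2 ^ i ≤ outDeg G.Adj e.2 := by
    intro h1 h2
    have h3 : 2 ^ i ≤ outDeg G.Adj e.1 := by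
      rw [← h2]; exact Nat.pow_log_le_self 2 (outDeg_pos G h1.1).ne'
    exact ⟨h3, h3.trans (owns_le G h1)⟩
  simp only [mem_level, mem_cross, Finset.mem_filter]
  constructor
  · rintro ⟨⟨h1, h2, h3⟩, h4, h5⟩
    have := key h4 h5
    exact ⟨⟨h1, h2, by tauto⟩, h4, h5⟩
  · rintro ⟨⟨h1, h2, h3⟩, h4, h5⟩
    have := key h4 h5
    exact ⟨⟨h1, h2, by tauto⟩, h4, h5⟩

theorem sum_level (C S : Finset (Fin n)) (f : Fin n × Fin n → ℝ) :
    ∑ i ∈ Finset.range (len n), ∑ e ∈ level G i C S, f e = open scoped Classical in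
      ∑ e ∈ cross C S, if Owns G e.1 e.2 then f e else 0 := by
  classical
  rw [← Finset.sum_filter]
  rw [← Finset.sum_fiberwise_of_maps_to (s := (cross C S).filter fun e => Owns G e.1 e.2)
    (t := Finset.range (len n)) (g := fun e => Nat.log 2 (outDeg G.Adj e.1))]
  · refine Finset.sum_congr rfl fun i _ => Finset.sum_congr ?_ fun _ _ => rfl
    ext e
    simp [mem_level, and_assoc]
  · intro e he
    simp only [Finset.mem_filter] at he
    have h1 := outDeg_pos G he.2.1
    have h2 := outDeg_le (D := G.Adj) e.1
    rw [Finset.mem_range]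
    exact Nat.log_lt_of_lt_pow h1.ne' (lt_of_le_of_lt h2 (Nat.lt_size_self n))

variable (α : Fin (Imp.deg c n) → ZMod (prm n))

/-- No vertex has too many sampled neighbours. -/
def Light : Prop := ∀ v, (sampledNbrs G α v).card ≤ 2 * lam c n

/-- All cuts inside `C` are approximated, at each level separately. -/
def Accurate (δ ε : ℝ) (C : Finset (Fin n)) : Prop :=
  ∀ i < len n, ∀ S ⊆ C, S.Nonempty → (∀ v ∈ S, 2 ^ i ≤ outDeg G.Adj v) →
    |∑ e ∈ level G i C S, dev G c e (ev α (enc e))| ≤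
      δ * (level G i C S).card + ε / len n * ∑ v ∈ S, (outDeg G.Adj v : ℝ)

variable {G α}

theorem edgeWt_eq (hc : 1 ≤ c) (hl : Light G α) (v u : Fin n) :
    edgeWt G α v u = open scoped Classical in
      if Owns G v u then 1 + dev G c (v, u) (ev α (enc (v, u))) else 0 := by
  classical
  have h1 : (0 : ℝ) < cutoff G c v := by exact_mod_cast cutoff_pos G hc v
  have h2 := card_pos' (p := prm n)
  by_cases h : Owns G v u
  · rw [if_pos h, edgeWt, dev]
    by_cases h' : (ev α (enc (v, u))).val < cutoff G c v
    · rw [if_pos ⟨hl v, h, h'⟩, if_pos h']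
      field_simp; ring
    · rw [if_neg fun h'' => h' h''.2.2, if_neg h']
      field_simp; ring
  · rw [if_neg h, edgeWt, if_neg fun h' => h h'.2.1]

/-- If no vertex is overloaded and all levels are accurate, then the errors of the levels add up to
the error of the cut: the relative errors to `δ w(S)`, and the `len n` additive errors, each for the
volume of a subset of `S`, to at most `ε Vol(S)`. -/
theorem isCutSparsifier (hc : 1 ≤ c) {δ ε : ℝ} (hε : 0 ≤ ε) (hl : Light G α)
    {C : Finset (Fin n)} (ha : Accurate G α δ ε C) :
    WGraph.IsCutSparsifier δ ε ((sparsifier G α).induceLoops C)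
      ((WGraph.ofSimple G).induceLoops C) := by
  classical
  intro S
  set S' := S.map (Function.Embedding.subtype _) with hS'
  have hsub : S' ⊆ C := by
    intro x hx
    simp only [hS', Finset.mem_map, Function.Embedding.subtype_apply] at hx
    obtain ⟨y, _, rfl⟩ := hx
    exact y.2
  have h1 : ((WGraph.ofSimple G).induceLoops C).cut S =
      ∑ i ∈ Finset.range (len n), ((level G i C S').card : ℝ) := by
    rw [cut_induceLoops _ _ (ofSimple_wt G)]
    have := sum_level G C S' fun _ => 1
    simp only [Finset.sum_const, nsmul_eq_mul, mul_one] at this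
    rw [this]
  have h2 : ((sparsifier G α).induceLoops C).cut S =
      ∑ i ∈ Finset.range (len n), ((level G i C S').card +
        ∑ e ∈ level G i C S', dev G c e (ev α (enc e))) := by
    rw [cut_induceLoops _ (edgeWt G α) (fun _ _ => rfl)]
    have := sum_level G C S' fun e => 1 + dev G c e (ev α (enc e))
    simp only [Finset.sum_add_distrib, Finset.sum_const, nsmul_eq_mul, mul_one] at this ⊢
    rw [this]
    exact Finset.sum_congr rfl fun e _ => edgeWt_eq hc hl e.1 e.2
  have h3 : ((WGraph.ofSimple G).induceLoops C).vol S = ∑ v ∈ S', (outDeg G.Adj v : ℝ) := by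
    rw [vol_induceLoops]
    exact Finset.sum_congr rfl fun v _ => degree_ofSimple G v
  set vol := ∑ v ∈ S', (outDeg G.Adj v : ℝ) with hvol
  have hvol0 : 0 ≤ vol := Finset.sum_nonneg fun _ _ => Nat.cast_nonneg _
  have h4 : ∀ i ∈ Finset.range (len n), |∑ e ∈ level G i C S', dev G c e (ev α (enc e))| ≤
      δ * (level G i C S').card + ε / len n * vol := by
    intro i hi
    rw [← level_filter G i C S']
    rcases (S'.filter fun v => 2 ^ i ≤ outDeg G.Adj v).eq_empty_or_nonempty with h | h
    · have h0 : level G i C (S'.filter fun v => 2 ^ i ≤ outDeg G.Adj v) = ∅ := by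
        ext e; simp [mem_level, mem_cross, h]
      rw [h0]
      simp only [Finset.sum_empty, abs_zero, Finset.card_empty, Nat.cast_zero, mul_zero, zero_add]
      positivity
    · refine (ha i (Finset.mem_range.1 hi) _ ((Finset.filter_subset _ _).trans hsub) h
        fun v hv => (Finset.mem_filter.1 hv).2).trans ?_
      have : ∑ v ∈ S'.filter (fun v => 2 ^ i ≤ outDeg G.Adj v), (outDeg G.Adj v : ℝ) ≤ vol :=
        Finset.sum_le_sum_of_subset_of_nonneg (Finset.filter_subset _ _)
          fun _ _ _ => Nat.cast_nonneg _
      gcongr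
  have h5 : |∑ i ∈ Finset.range (len n), ∑ e ∈ level G i C S', dev G c e (ev α (enc e))| ≤
      δ * ∑ i ∈ Finset.range (len n), ((level G i C S').card : ℝ) + ε * vol := by
    refine (Finset.abs_sum_le_sum_abs _ _).trans ((Finset.sum_le_sum h4).trans ?_)
    rw [Finset.sum_add_distrib, ← Finset.mul_sum, Finset.sum_const, Finset.card_range,
      nsmul_eq_mul, ← mul_assoc]
    refine add_le_add le_rfl (mul_le_mul_of_nonneg_right ?_ hvol0)
    rcases (len n).eq_zero_or_pos with h0 | h0
    · rw [h0]; simpa using hε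
    · have : (0 : ℝ) < len n := by exact_mod_cast h0
      rw [mul_div_cancel₀ _ this.ne']
  rw [h1, h2, h3, Finset.sum_add_distrib]
  rw [abs_le] at h5
  constructor <;> linarith [h5.1, h5.2]

end Levels

end Sparsify

/-! ### The number of bad hash polynomials -/

namespace Sparsify

open Imp PolyHash

section Union

variable {c n m : ℕ} {δ ε : ℝ} (G : SimpleGraph (Fin n))

/-- The conditions on the parameters: unless everything is sampled, the expected number of sampled
edges of a vertex is large compared with the number `m` of moments, the number of levels, and the
precision. -/
structure Params (c n m : ℕ) (δ ε : ℝ) : Prop where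
  hc : 1 ≤ c
  hm : 1 ≤ m
  hδ : 0 < δ
  hδ1 : δ ≤ 1
  hε : 0 < ε
  hε1 : ε ≤ 1
  large : lam c n < n → 768 * (m : ℝ) * len n ≤ lam c n * (δ * ε)
  small : (n : ℝ) * (1 / 8) ^ m ≤ 1

theorem Params.lam_large (h : Params c n m δ ε) (hn : 1 ≤ n) (hl : lam c n < n) :
    768 * (m : ℝ) ≤ lam c n := by
  have h1 := h.large hl
  have h2 : (1 : ℝ) ≤ len n := by exact_mod_cast (Nat.size_pos.2 hn : 0 < Nat.size n)
  have h3 : δ * ε ≤ 1 := mul_le_one₀ h.hδ1 h.hε.le h.hε1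
  have h4 : 768 * (m : ℝ) * 1 ≤ 768 * m * len n := by gcongr
  have h5 : (lam c n : ℝ) * (δ * ε) ≤ lam c n * 1 := by gcongr
  linarith

/-- The hash polynomial has enough coefficients for the moments of order `2 m s`. -/
theorem Params.le_deg (h : Params c n m δ ε) (hn : 1 ≤ n) (hl : lam c n < n) {s : ℕ} (hs : s ≤ n) :
    2 * (m * s) ≤ Imp.deg c n := by
  have h1 : (m : ℝ) ≤ lam c n := by
    have := h.lam_large hn hl
    have : (0 : ℝ) ≤ m := Nat.cast_nonneg m
    linarith
  have h1 : m ≤ lam c n := by exact_mod_cast h1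
  calc 2 * (m * s) ≤ 2 * (lam c n * n) := by gcongr
    _ = _ := by rw [Imp.deg]; ring

open scoped Classical in
/-- The number of polynomials for which a given vertex has too many sampled neighbours. -/
theorem card_heavy_le (h : Params c n m δ ε) (v : Fin n) :
    ((Finset.univ.filter fun α : Fin (Imp.deg c n) → ZMod (prm n) =>
      ¬ (sampledNbrs G α v).card ≤ 2 * lam c n).card : ℝ) ≤
        (1 / 8) ^ m * (prm n : ℝ) ^ Imp.deg c n := by
  have hn : 1 ≤ n := by have := v.2; omega
  set N : Finset (Fin n) := Finset.univ.filter fun w => G.Adj v w with hN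
  have hNc : N.card = outDeg G.Adj v := by rw [outDeg]
  have hsub : ∀ α : Fin (Imp.deg c n) → ZMod (prm n),
      sampledNbrs G α v = N.filter fun w => Sampled G α v w := by
    intro α; ext w; simp [sampledNbrs, hN]
  by_cases hd : outDeg G.Adj v ≤ lam c n
  · rw [Finset.filter_false_of_mem]
    · simp only [Finset.card_empty, Nat.cast_zero]; positivity
    · intro α _
      rw [not_not, hsub]
      have := Finset.card_filter_le N fun w => Sampled G α v w
      omega
  · push Not at hd
    have hl : lam c n < n := lt_of_lt_of_le hd (outDeg_le v)
    have hlam := h.lam_large hn hl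
    have hlam0 : (0 : ℝ) < lam c n := by exact_mod_cast lam_pos h.hc hn
    have hd0 : (0 : ℝ) < outDeg G.Adj v := by exact_mod_cast lt_of_le_of_lt (Nat.zero_le _) hd
    have hm0 : (0 : ℝ) ≤ m := Nat.cast_nonneg m
    have hT : (0 : ℝ) < cutoff G c v := by exact_mod_cast cutoff_pos G h.hc v
    set d : ℝ := (outDeg G.Adj v : ℝ) with hdd
    set D : Finset (Fin n × Fin n) := N.map (Function.Embedding.sectR v (Fin n)) with hD
    have hDc : (D.card : ℝ) = d := by rw [hD, Finset.card_map, hNc]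
    refine le_trans (Nat.cast_le.2 (Finset.card_le_card fun α => ?_))
      (card_dev_le G h.hc h.hm (by simpa using h.le_deg hn hl hn) (D := D) (t := d)
        (M := 3 * d / lam c n) (by positivity) ?_ ?_ ?_)
    · simp only [Finset.mem_filter, Finset.mem_univ, true_and, not_le]
      intro hα
      have h1 : ∑ e ∈ D, dev G c e (ev α (enc e)) =
          (prm n : ℝ) / cutoff G c v * (sampledNbrs G α v).card - d := by
        rw [hD, Finset.sum_map, hsub]
        simp only [dev, Function.Embedding.sectR_apply]
        rw [← Finset.mul_sum, Finset.sum_sub_distrib, Finset.sum_const, hNc, nsmul_eq_mul,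
          Finset.sum_boole, mul_sub]
        have hp := card_pos' (p := prm n)
        congr 1
        · refine congrArg _ (congrArg Nat.cast (congrArg Finset.card (Finset.filter_congr fun _ _ => Iff.rfl)))
        · rw [hdd]; field_simp
      have h2 : (2 * lam c n : ℝ) ≤ (sampledNbrs G α v).card := by exact_mod_cast hα.le
      have h3 : d ≤ (prm n : ℝ) / cutoff G c v * lam c n := by
        rw [div_mul_eq_mul_div, le_div_iff₀ hT]
        have : (outDeg G.Adj v * cutoff G c v : ℝ) ≤ lam c n * prm n := by
          exact_mod_cast mul_cutoff_le G v
        linarith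
      have h4 : (prm n : ℝ) / cutoff G c v * (2 * lam c n) ≤
          (prm n : ℝ) / cutoff G c v * (sampledNbrs G α v).card := by gcongr
      rw [h1]
      exact le_trans (by linarith) (le_abs_self _)
    · intro e he
      obtain ⟨w, _, rfl⟩ := Finset.mem_map.1 he
      exact prm_div_cutoff_le G h.hc le_rfl
    · rw [mul_div_assoc', div_le_iff₀ hlam0]
      nlinarith
    · rw [hDc, div_mul_eq_mul_div, mul_div_assoc', div_le_iff₀ hlam0]
      nlinarith [mul_pos hd0 hd0]

open scoped Classical in
/-- The number of polynomials for which a given cut is not approximated at a given level. -/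
theorem card_inaccurate_le (h : Params c n m δ ε) (i : ℕ) (C S : Finset (Fin n))
    (hS : S.Nonempty) (hd : ∀ v ∈ S, 2 ^ i ≤ outDeg G.Adj v) :
    ((Finset.univ.filter fun α : Fin (Imp.deg c n) → ZMod (prm n) =>
      ¬ |∑ e ∈ level G i C S, dev G c e (ev α (enc e))| ≤
        δ * (level G i C S).card + ε / len n * ∑ v ∈ S, (outDeg G.Adj v : ℝ)).card : ℝ) ≤
          ((1 / 8) ^ m) ^ S.card * (prm n : ℝ) ^ Imp.deg c n := by
  have hS1 : 1 ≤ S.card := hS.card_pos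
  obtain ⟨v₀, -⟩ := hS
  have hn : 1 ≤ n := by have := v₀.2; omega
  have hL : (0 : ℝ) < len n := by exact_mod_cast (Nat.size_pos.2 hn : 0 < Nat.size n)
  have hδ := h.hδ
  have hε := h.hε
  set k : ℝ := ((level G i C S).card : ℝ) with hk
  set V : ℝ := ∑ v ∈ S, (outDeg G.Adj v : ℝ) with hV
  have hk0 : 0 ≤ k := Nat.cast_nonneg _
  have hV0 : (2 : ℝ) ^ i * S.card ≤ V := by
    rw [hV, mul_comm, ← nsmul_eq_mul]
    exact Finset.card_nsmul_le_sum _ _ _ fun v hv => by exact_mod_cast hd v hv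
  have hs0 : (1 : ℝ) ≤ S.card := by exact_mod_cast hS1
  have hVpos : 0 < V := lt_of_lt_of_le (by positivity) hV0
  by_cases hl : lam c n < n
  · have hlam := h.large hl
    have hlam0 : (0 : ℝ) < lam c n := by exact_mod_cast lam_pos h.hc hn
    have hm0 : (0 : ℝ) ≤ m := Nat.cast_nonneg m
    have hε1 : 96 * (m : ℝ) * len n ≤ lam c n * ε := by
      have h1 : lam c n * (δ * ε) ≤ lam c n * (1 * ε) := by have := h.hδ1; gcongr
      have : 0 ≤ (m : ℝ) * len n := by positivity
      linarith
    rw [← pow_mul]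
    refine le_trans (Nat.cast_le.2 (Finset.card_le_card fun α => ?_))
      (card_dev_le G h.hc (Nat.mul_pos h.hm hS1)
        (h.le_deg hn hl (by simpa using S.card_le_univ)) (D := level G i C S)
        (t := δ * k + ε / len n * V) (M := 3 * 2 ^ (i + 1) / lam c n) (by positivity) ?_ ?_ ?_)
    · simp only [Finset.mem_filter, Finset.mem_univ, true_and, not_le]
      exact fun h => h.le
    · intro e he
      exact prm_div_cutoff_le G h.hc (by exact_mod_cast (level_bounds G he).2.le)
    · have h1 : 16 * ((m * S.card : ℕ) : ℝ) * (3 * 2 ^ (i + 1) / lam c n) =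
          96 * m * len n * (2 ^ i * S.card) / (lam c n * len n) := by
        push_cast; field_simp; ring
      have h2 : 96 * m * len n * (2 ^ i * S.card) / (lam c n * len n) ≤
          lam c n * ε * V / (lam c n * len n) := by gcongr
      have h3 : lam c n * ε * V / (lam c n * len n) = ε / len n * V := by field_simp
      rw [h1]
      have : 0 ≤ δ * k := by positivity
      linarith
    · have h1 : 256 * ((m * S.card : ℕ) : ℝ) * (3 * 2 ^ (i + 1) / lam c n * k) =
          2 * (768 * m * len n) * (2 ^ i * S.card * k) / (lam c n * len n) := by
        push_cast; field_simp; ring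
      have h2 : 2 * (768 * m * len n) * (2 ^ i * S.card * k) / (lam c n * len n) ≤
          2 * (lam c n * (δ * ε)) * (V * k) / (lam c n * len n) := by gcongr
      have h3 : 2 * (lam c n * (δ * ε)) * (V * k) / (lam c n * len n) =
          2 * ((δ * k) * (ε / len n * V)) := by field_simp
      rw [h1]
      nlinarith [sq_nonneg (δ * k), sq_nonneg (ε / len n * V)]
  · have hl : lam c n = n := le_antisymm (lam_le c n) (not_lt.1 hl)
    rw [Finset.filter_false_of_mem]
    · simp only [Finset.card_empty, Nat.cast_zero]; positivity
    · intro α _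
      rw [not_not, Finset.sum_eq_zero fun e _ =>
        dev_eq_zero G (cutoff_eq G ((outDeg_le _).trans hl.ge)) _, abs_zero]
      positivity

/-- The sum over all subsets is `(1 + x) ^ |C|`, which is close to one. -/
theorem sum_powerset_le {ι : Type*} [DecidableEq ι] (C : Finset ι) {x : ℝ} (hx : 0 ≤ x)
    (h : C.card * x ≤ 1) :
    ∑ S ∈ C.powerset.filter Finset.Nonempty, x ^ S.card ≤ 2 * (C.card * x) := by
  have h1 := Finset.sum_pow_mul_eq_add_pow x 1 C
  simp only [one_pow, mul_one] at h1
  have h2 : C.powerset.filter Finset.Nonempty = C.powerset.erase ∅ := by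
    ext S; simp [Finset.nonempty_iff_ne_empty, and_comm]
  have h3 := Finset.sum_erase_add C.powerset (fun S => x ^ S.card) (Finset.empty_mem_powerset C)
  rw [h2]
  have h4 : (x + 1) ^ C.card ≤ Real.exp (C.card * x) := by
    rw [Real.exp_nat_mul]
    exact pow_le_pow_left₀ (by linarith) (Real.add_one_le_exp x) _
  have h5 := Real.abs_exp_sub_one_le (x := C.card * x) (by rwa [abs_of_nonneg (by positivity)])
  rw [abs_of_nonneg (by positivity : 0 ≤ C.card * x)] at h5
  have h6 := (abs_le.1 h5).2
  simp only [Finset.card_empty, pow_zero] at h3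
  linarith

open scoped Classical in
/-- The union bound over all vertices, all levels, and all cuts inside the parts. -/
theorem card_bad_le (h : Params c n m δ ε) (hn : 1 ≤ n)
    {parts : Finset (Finset (Fin n))} (hparts : ∑ C ∈ parts, C.card ≤ n) :
    ((Finset.univ.filter fun α : Fin (Imp.deg c n) → ZMod (prm n) =>
      ¬ (Light G α ∧ ∀ C ∈ parts, Accurate G α δ ε C)).card : ℝ) ≤
        3 * len n * (n * (1 / 8) ^ m) * (prm n : ℝ) ^ Imp.deg c n := by
  set x : ℝ := (1 / 8) ^ m with hx
  have hx0 : 0 ≤ x := by positivity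
  set Q : ℝ := (prm n : ℝ) ^ Imp.deg c n with hQ
  have hQ0 : 0 ≤ Q := by positivity
  set A : Fin n → Finset (Fin (Imp.deg c n) → ZMod (prm n)) := fun v =>
    Finset.univ.filter fun α => ¬ (sampledNbrs G α v).card ≤ 2 * lam c n with hA
  set B : ℕ → Finset (Fin n) → Finset (Fin n) → Finset (Fin (Imp.deg c n) → ZMod (prm n)) :=
    fun i C S => if ∀ v ∈ S, 2 ^ i ≤ outDeg G.Adj v then
      Finset.univ.filter fun α => ¬ |∑ e ∈ level G i C S, dev G c e (ev α (enc e))| ≤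
        δ * (level G i C S).card + ε / len n * ∑ v ∈ S, (outDeg G.Adj v : ℝ) else ∅ with hB
  have hBc : ∀ i C, ∀ S ∈ (C.powerset.filter Finset.Nonempty), ((B i C S).card : ℝ) ≤
      x ^ S.card * Q := by
    intro i C S hS
    simp only [hB]
    split_ifs with h1
    · exact card_inaccurate_le G h i C S (Finset.mem_filter.1 hS).2 h1
    · simp only [Finset.card_empty, Nat.cast_zero]; positivity
  have hsub : (Finset.univ.filter fun α : Fin (Imp.deg c n) → ZMod (prm n) =>
      ¬ (Light G α ∧ ∀ C ∈ parts, Accurate G α δ ε C)) ⊆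
      Finset.univ.biUnion A ∪ parts.biUnion fun C => (Finset.range (len n)).biUnion fun i =>
        (C.powerset.filter Finset.Nonempty).biUnion (B i C) := by
    intro α hα
    have hα := (Finset.mem_filter.1 hα).2
    rw [not_and_or] at hα
    rw [Finset.mem_union]
    rcases hα with hα | hα
    · left
      rw [Light] at hα
      push Not at hα
      obtain ⟨v, hv⟩ := hα
      exact Finset.mem_biUnion.2 ⟨v, Finset.mem_univ _, by simpa [hA] using hv⟩
    · right
      push Not at hα
      obtain ⟨C, hC, hα⟩ := hα
      rw [Accurate] at hα
      push Not at hα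
      obtain ⟨i, hi, S, hS, hS1, hS2, hS3⟩ := hα
      refine Finset.mem_biUnion.2 ⟨C, hC, Finset.mem_biUnion.2 ⟨i, Finset.mem_range.2 hi,
        Finset.mem_biUnion.2 ⟨S, Finset.mem_filter.2 ⟨Finset.mem_powerset.2 hS, hS1⟩, ?_⟩⟩⟩
      simp only [hB]
      rw [if_pos hS2]
      simpa using hS3
  have h1 : ((Finset.univ.biUnion A).card : ℝ) ≤ n * (x * Q) := by
    refine le_trans (Nat.cast_le.2 Finset.card_biUnion_le) ?_
    push_cast
    refine (Finset.sum_le_sum fun v _ => card_heavy_le G h v).trans ?_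
    rw [Finset.sum_const, Finset.card_univ, Fintype.card_fin, nsmul_eq_mul]
  have h2 : ∀ C ∈ parts, (((Finset.range (len n)).biUnion fun i =>
      (C.powerset.filter Finset.Nonempty).biUnion (B i C)).card : ℝ) ≤
        len n * (2 * (C.card * x) * Q) := by
    intro C hC
    refine le_trans (Nat.cast_le.2 Finset.card_biUnion_le) ?_
    push_cast
    rw [← Finset.card_range (len n), ← nsmul_eq_mul, Finset.card_range]
    refine (Finset.sum_le_card_nsmul _ _ (2 * (C.card * x) * Q) fun i _ => ?_).trans
      (by rw [Finset.card_range])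
    refine le_trans (Nat.cast_le.2 Finset.card_biUnion_le) ?_
    push_cast
    refine (Finset.sum_le_sum (hBc i C)).trans ?_
    rw [← Finset.sum_mul]
    refine mul_le_mul_of_nonneg_right (sum_powerset_le C hx0 (le_trans ?_ h.small)) hQ0
    have : (C.card : ℝ) ≤ n := by exact_mod_cast (by simpa using C.card_le_univ)
    gcongr
  have h3 : ((parts.biUnion fun C => (Finset.range (len n)).biUnion fun i =>
      (C.powerset.filter Finset.Nonempty).biUnion (B i C)).card : ℝ) ≤
        len n * (2 * (n * x) * Q) := by
    refine le_trans (Nat.cast_le.2 Finset.card_biUnion_le) ?_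
    push_cast
    refine (Finset.sum_le_sum h2).trans ?_
    have h4 : ∑ C ∈ parts, (C.card : ℝ) ≤ n := by exact_mod_cast hparts
    rw [← Finset.mul_sum, ← Finset.sum_mul, ← Finset.mul_sum, ← Finset.sum_mul]
    gcongr
  refine le_trans (Nat.cast_le.2 ((Finset.card_le_card hsub).trans (Finset.card_union_le _ _))) ?_
  push_cast
  have hL : (1 : ℝ) ≤ len n := by exact_mod_cast (Nat.size_pos.2 hn : 0 < Nat.size n)
  have h5 : 1 * (n * (x * Q)) ≤ len n * (n * (x * Q)) := by gcongr
  linarith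

end Union

end Sparsify

/-! ### The distribution of the hash polynomial -/

namespace Sparsify

open Imp PolyHash

section Coins

instance : IsProbabilityMeasure StreamAlg.coinLaw := by
  unfold StreamAlg.coinLaw; infer_instance

theorem coinLaw_cylinder (N : ℕ) (b : ℕ → Bool) :
    StreamAlg.coinLaw.real {ω | ∀ t < N, ω t = b t} = (1 / 2) ^ N := by
  have h1 : {ω : ℕ → Bool | ∀ t < N, ω t = b t} =
      Set.pi (Finset.range N : Set ℕ) fun t => {b t} := by
    ext ω; simp [Set.mem_pi]
  have h2 : ∀ x : Bool, (PMF.uniformOfFintype Bool).toMeasure {x} = 2⁻¹ := by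
    intro x
    rw [PMF.toMeasure_apply_singleton _ _ (MeasurableSet.singleton x), PMF.uniformOfFintype_apply]
    simp
  rw [h1, Measure.real, StreamAlg.coinLaw,
    Measure.infinitePi_pi _ fun t _ => MeasurableSet.singleton _]
  simp [h2]

theorem testBit_of_blockVal_eq {ω : ℕ → Bool} {s m y : ℕ} (h : blockVal ω s m = y) {j : ℕ}
    (hj : j < m) : ω (s + j) = y.testBit (m - 1 - j) := by
  induction m generalizing y with
  | zero => omega
  | succ m ih =>
    rw [blockVal] at h
    have h1 := Bool.toNat_le (ω (s + m))
    rcases Nat.lt_succ_iff_lt_or_eq.1 hj with hj | rfl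
    · rw [ih (y := y / 2) (by omega) hj, Nat.testBit_div_two]
      congr 1; omega
    · rw [Nat.add_sub_cancel, Nat.sub_self, Nat.testBit_zero]
      cases hb : ω (s + j)
      · simp only [hb, Bool.toNat_false] at h; simp; omega
      · simp only [hb, Bool.toNat_true] at h; simp; omega

/-- Disjoint blocks of coins are independent, and each value of a block has probability at most
`2 ^ (-m)`. -/
theorem coinLaw_blocks_le (k m : ℕ) (y : Fin k → ℕ) :
    StreamAlg.coinLaw.real {ω | ∀ i : Fin k, blockVal ω ((k - 1 - i) * m) m = y i} ≤
      (1 / 2) ^ (k * m) := by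
  rw [← coinLaw_cylinder (k * m) fun t =>
    if h : k - 1 - t / m < k then (y ⟨_, h⟩).testBit (m - 1 - t % m) else false]
  refine measureReal_mono fun ω hω t ht => ?_
  have hm : 0 < m := Nat.pos_of_mul_pos_left (lt_of_le_of_lt (Nat.zero_le _) ht)
  have h1 : t / m < k := Nat.div_lt_of_lt_mul (by rwa [mul_comm])
  have h2 : k - 1 - t / m < k := by generalize t / m = d at h1 ⊢; omega
  have h3 := testBit_of_blockVal_eq (hω ⟨_, h2⟩) (Nat.mod_lt t hm)
  rw [dif_pos h2, ← h3]
  have h4 : k - 1 - (k - 1 - t / m) = t / m := by generalize t / m = d at h1 ⊢; omega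
  simp only [h4]
  rw [Nat.div_add_mod']

theorem card_residue_le (p N : ℕ) [NeZero p] (a : ZMod p) :
    (Finset.univ.filter fun y : Fin N => ((y : ℕ) : ZMod p) = a).card ≤ N / p + 1 := by
  have hp : 0 < p := Nat.pos_of_neZero p
  rw [← Finset.card_range (N / p + 1)]
  refine Finset.card_le_card_of_injOn (fun y => (y : ℕ) / p) (fun y _ => ?_) ?_
  · rw [Finset.mem_coe, Finset.mem_range]
    exact Nat.lt_succ_of_le (Nat.div_le_div_right y.2.le)
  · intro y hy z hz h
    have hy : ((y : ℕ) : ZMod p) = a := by simpa using hy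
    have hz : ((z : ℕ) : ZMod p) = a := by simpa using hz
    have h1 : (y : ℕ) % p = z % p := (ZMod.natCast_eq_natCast_iff' _ _ _).1 (hy.trans hz.symm)
    refine Fin.ext ?_
    rw [← Nat.div_add_mod (y : ℕ) p, ← Nat.div_add_mod (z : ℕ) p, h1]
    have h : (y : ℕ) / p = z / p := h
    rw [h]

theorem card_residues_le (p N k : ℕ) [NeZero p] (B : Finset (Fin k → ZMod p)) :
    (Finset.univ.filter fun y : Fin k → Fin N => (fun i => ((y i : ℕ) : ZMod p)) ∈ B).card ≤
      B.card * (N / p + 1) ^ k := by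
  classical
  refine Finset.card_le_mul_card_image_of_maps_to 
    (f := fun (y : Fin k → Fin N) (i : Fin k) => ((y i : ℕ) : ZMod p))
    (fun y hy => (Finset.mem_filter.1 hy).2) _ (fun a _ => ?_) |>.trans (le_of_eq (mul_comm _ _))
  refine (Finset.card_le_card (t := Fintype.piFinset fun i =>
    Finset.univ.filter fun y : Fin N => ((y : ℕ) : ZMod p) = a i) fun y hy => ?_).trans ?_
  · rw [Fintype.mem_piFinset]
    intro i
    simpa using congrFun (Finset.mem_filter.1 hy).2 i
  · rw [Fintype.card_piFinset]
    exact (Finset.prod_le_pow_card _ _ _ fun i _ => card_residue_le p N (a i)).trans (by simp)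

/-- The coefficients of the random polynomial, as elements of the field. -/
def randomCoefs (c n : ℕ) (ω : ℕ → Bool) (i : Fin (Imp.deg c n)) : ZMod (prm n) :=
  (coefs ω c n i : ZMod (prm n))

theorem measurable_blockVal (s m : ℕ) : Measurable fun ω => blockVal ω s m := by
  induction m with
  | zero => exact measurable_const
  | succ m ih =>
    have h1 : Measurable fun ω : ℕ → Bool => (blockVal ω s m, ω (s + m)) :=
      ih.prodMk (measurable_pi_apply _)
    exact (Measurable.of_discrete (f := fun q : ℕ × Bool => 2 * q.1 + q.2.toNat)).comp h1

theorem measurable_comp_randomCoefs (c n : ℕ) {β : Type*} [MeasurableSpace β]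
    (f : (Fin (Imp.deg c n) → ZMod (prm n)) → β) : Measurable fun ω => f (randomCoefs c n ω) := by
  have h1 : Measurable fun ω : ℕ → Bool => fun i : Fin (Imp.deg c n) =>
      blockVal ω ((Imp.deg c n - 1 - i) * width n) (width n) :=
    measurable_pi_iff.2 fun i => measurable_blockVal _ _
  exact (Measurable.of_discrete (f := fun y : Fin (Imp.deg c n) → ℕ =>
    f fun i => ((y i % prm n : ℕ) : ZMod (prm n)))).comp h1

/-- The blocks of coins are long enough for reduction modulo `prm n` to change the law of all
coefficients together by a bounded factor only. -/
theorem deg_mul_prm_le (c n : ℕ) : Imp.deg c n * prm n ≤ 2 ^ width n := by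
  have h1 : n < 2 ^ len n := Nat.lt_size_self n
  have h2 : n + 2 ≤ 2 * 2 ^ len n := by have := Nat.one_le_two_pow (n := len n); omega
  have h3 := lam_le c n
  calc Imp.deg c n * prm n ≤ 2 * n * n * (4 * (n + 2) * (n + 2)) :=
        Nat.mul_le_mul (Nat.mul_le_mul_left _ h3) (prm_le n)
    _ ≤ 2 * 2 ^ len n * 2 ^ len n * (4 * (2 * 2 ^ len n) * (2 * 2 ^ len n)) := by gcongr
    _ = 2 ^ (4 * len n) * 32 := by ring
    _ ≤ 2 ^ (4 * len n) * 128 := by omega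
    _ = 2 ^ width n := by rw [width, pow_add]; norm_num

/-- The random polynomial is almost uniformly distributed. -/
theorem coinLaw_randomCoefs_le (c n : ℕ) (B : Finset (Fin (Imp.deg c n) → ZMod (prm n))) :
    StreamAlg.coinLaw.real {ω | randomCoefs c n ω ∈ B} ≤
      3 * (B.card / (prm n : ℝ) ^ Imp.deg c n) := by
  classical
  set N := 2 ^ width n with hN
  set Y := Finset.univ.filter fun y : Fin (Imp.deg c n) → Fin N =>
    (fun i => ((y i : ℕ) : ZMod (prm n))) ∈ B with hY
  have h1 : {ω | randomCoefs c n ω ∈ B} ⊆ ⋃ y ∈ Y, {ω | ∀ i : Fin (Imp.deg c n),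
      blockVal ω ((Imp.deg c n - 1 - i) * width n) (width n) = (y i : ℕ)} := by
    intro ω hω
    simp only [Set.mem_iUnion]
    refine ⟨fun i => ⟨_, blockVal_lt ω ((Imp.deg c n - 1 - i) * width n) (width n)⟩, ?_, fun i => rfl⟩
    rw [hY, Finset.mem_filter]
    refine ⟨Finset.mem_univ _, ?_⟩
    convert (show randomCoefs c n ω ∈ B from hω) using 2 with i
    rw [randomCoefs, coefs, ZMod.natCast_mod]
  have h2 : StreamAlg.coinLaw.real {ω | randomCoefs c n ω ∈ B} ≤
      Y.card * (1 / 2) ^ (Imp.deg c n * width n) := by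
    refine (measureReal_mono h1 (measure_ne_top _ _)).trans ((measureReal_biUnion_finset_le _ _).trans ?_)
    rw [← nsmul_eq_mul]
    exact Finset.sum_le_card_nsmul _ _ _ fun y _ => coinLaw_blocks_le (Imp.deg c n) (width n) fun i => (y i : ℕ)
  have hp := card_pos' (p := prm n)
  have hN0 : (0 : ℝ) < N := by positivity
  have h3 : (Y.card : ℝ) ≤ B.card * (N / prm n + 1) ^ Imp.deg c n := by
    have h4 : (Y.card : ℝ) ≤ B.card * ((N / prm n + 1 : ℕ) : ℝ) ^ Imp.deg c n := by
      exact_mod_cast card_residues_le (prm n) N (Imp.deg c n) B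
    refine h4.trans ?_
    push_cast
    have : ((N / prm n : ℕ) : ℝ) ≤ N / prm n := Nat.cast_div_le
    gcongr
  have h5 : (N / prm n + 1 : ℝ) ^ Imp.deg c n * (1 / 2) ^ (Imp.deg c n * width n) =
      (1 + prm n / N) ^ Imp.deg c n / (prm n : ℝ) ^ Imp.deg c n := by
    have : (1 / 2 : ℝ) ^ (Imp.deg c n * width n) = (1 / N) ^ Imp.deg c n := by
      rw [mul_comm, pow_mul, hN]; push_cast; rw [one_div_pow]
    rw [this, ← mul_pow, ← div_pow]
    congr 1
    field_simp
  have h6 : (1 + prm n / N : ℝ) ^ Imp.deg c n ≤ 3 := by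
    have h7 : (1 + prm n / N : ℝ) ^ Imp.deg c n ≤ Real.exp (Imp.deg c n * (prm n / N)) := by
      rw [Real.exp_nat_mul]
      refine pow_le_pow_left₀ (by positivity) ?_ _
      rw [add_comm]; exact Real.add_one_le_exp _
    have h8 : (Imp.deg c n * (prm n / N) : ℝ) ≤ 1 := by
      rw [mul_div_assoc', div_le_one hN0]
      exact_mod_cast deg_mul_prm_le c n
    have := Real.exp_le_exp.2 h8
    have := Real.exp_one_lt_d9
    linarith
  calc _ ≤ (Y.card : ℝ) * (1 / 2) ^ (Imp.deg c n * width n) := h2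
    _ ≤ B.card * (N / prm n + 1) ^ Imp.deg c n * (1 / 2) ^ (Imp.deg c n * width n) := by gcongr
    _ = B.card * ((1 + prm n / N) ^ Imp.deg c n / (prm n : ℝ) ^ Imp.deg c n) := by rw [mul_assoc, h5]
    _ ≤ B.card * (3 / (prm n : ℝ) ^ Imp.deg c n) := by gcongr
    _ = _ := by ring

end Coins

/-- The output is a power cut sparsifier distribution. -/
theorem isPowerCutSparsifierDist {c n m : ℕ} {δ ε q : ℝ} (G : SimpleGraph (Fin n))
    (h : Params c n m δ ε) (hn : 1 ≤ n) (hq : 9 * len n * (n * (1 / 8 : ℝ) ^ m) ≤ q) :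
    WGraph.IsPowerCutSparsifierDist δ ε q (WGraph.ofSimple G)
      (StreamAlg.coinLaw.map fun ω => StreamAlg.decode n (graphOut c (coefs ω c n) G.Adj)) := by
  classical
  have h1 : (fun ω => StreamAlg.decode n (graphOut c (coefs ω c n) G.Adj)) =
      fun ω => sparsifier G (randomCoefs c n ω) :=
    funext fun ω => decode_graphOut G h.hc (coefs ω c n)
  rw [h1]
  have h2 := measurable_comp_randomCoefs c n (sparsifier (c := c) G)
  have key : ∀ parts : Finset (Finset (Fin n)), ∑ C ∈ parts, C.card ≤ n → 1 - q ≤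
      (StreamAlg.coinLaw.map fun ω => sparsifier G (randomCoefs c n ω)).real
        {H | ∀ C ∈ parts, WGraph.IsCutSparsifier δ ε (H.induceLoops C)
          ((WGraph.ofSimple G).induceLoops C)} := by
    intro parts hparts
    rw [map_measureReal_apply h2 trivial]
    set B := Finset.univ.filter fun α : Fin (Imp.deg c n) → ZMod (prm n) =>
      ¬ (Light G α ∧ ∀ C ∈ parts, Accurate G α δ ε C) with hB
    have h3 : {ω | randomCoefs c n ω ∈ B}ᶜ ⊆ (fun ω => sparsifier G (randomCoefs c n ω)) ⁻¹'
        {H | ∀ C ∈ parts, WGraph.IsCutSparsifier δ ε (H.induceLoops C)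
          ((WGraph.ofSimple G).induceLoops C)} := by
      intro ω hω C hC
      have hω : Light G (randomCoefs c n ω) ∧
          ∀ C ∈ parts, Accurate G (randomCoefs c n ω) δ ε C := by
        by_contra h'
        exact hω (Finset.mem_filter.2 ⟨Finset.mem_univ _, h'⟩)
      exact isCutSparsifier h.hc h.hε.le hω.1 (hω.2 C hC)
    refine le_trans ?_ (measureReal_mono h3)
    have hm : MeasurableSet {ω | randomCoefs c n ω ∈ B} :=
      measurableSet_setOfPred.2 (measurable_comp_randomCoefs c n fun α => α ∈ B)
    rw [probReal_compl_eq_one_sub hm]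
    have h4 := coinLaw_randomCoefs_le c n B
    have h5 := card_bad_le G h hn hparts
    have hp : (0 : ℝ) < (prm n : ℝ) ^ Imp.deg c n := pow_pos (card_pos' (p := prm n)) _
    have h6 : (B.card : ℝ) / (prm n : ℝ) ^ Imp.deg c n ≤ 3 * len n * (n * (1 / 8) ^ m) := by
      rw [div_le_iff₀ hp]; exact h5
    linarith
  refine ⟨Measure.isProbabilityMeasure_map h2.aemeasurable, ?_, fun P => key _ (le_of_eq ?_)⟩
  · rw [ae_map_iff h2.aemeasurable trivial]
    exact Filter.Eventually.of_forall fun ω => isSubgraph_sparsifier G _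
  · exact (@Finpartition.sum_card_parts _ (fun a b => Classical.propDecidable (a = b)) _ P).trans
      (by simp)

end Sparsify

/-! ### The choice of the parameters -/

namespace Sparsify

open Imp PolyHash

section Bounds

variable {c n : ℕ}

theorem one_le_len (hn : 1 ≤ n) : 1 ≤ len n := Nat.size_pos.2 hn

theorem add_two_le_two_pow (n : ℕ) : n + 2 ≤ 2 ^ (len n + 1) := by
  have h1 : n < 2 ^ len n := Nat.lt_size_self n
  rw [pow_succ]; omega

theorem size_V_le (c n : ℕ) : Nat.size (lim c n).V ≤ c + 4 * len n + 17 := by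
  rw [Nat.size_le]
  have h1 := add_two_le_two_pow n
  have h2 : c + 1 < 2 ^ (c + 1) := Nat.lt_two_pow_self
  calc (lim c n).V = (c + 1) * (2 ^ 12 * (n + 2) ^ 4) := by simp only [lim, quad]; ring
    _ ≤ (c + 1) * (2 ^ 12 * (2 ^ (len n + 1)) ^ 4) := by gcongr
    _ < 2 ^ (c + 1) * (2 ^ 12 * (2 ^ (len n + 1)) ^ 4) := by gcongr
    _ = 2 ^ (c + 4 * len n + 17) := by ring

theorem size_A_le (c n : ℕ) : Nat.size (3 * (lim c n).A + 64) ≤ 3 * len n + 11 := by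
  rw [Nat.size_le]
  have h1 := add_two_le_two_pow n
  have h2 : len n + 1 ≤ n + 2 := by have := len_le n; omega
  have h3 : 2 * lam c n + 1 ≤ 2 * (n + 2) := by have := lam_le c n; omega
  calc 3 * (lim c n).A + 64 = 3 * (n * (len n + 1) * (2 * lam c n + 1)) + 64 := rfl
    _ ≤ 3 * ((n + 2) * (n + 2) * (2 * (n + 2))) + 64 * (n + 2) ^ 3 := by
        have : 1 ≤ (n + 2) ^ 3 := Nat.one_le_pow _ _ (by omega)
        gcongr <;> omega
    _ ≤ 2 ^ 7 * (n + 2) ^ 3 := by nlinarith [Nat.zero_le ((n + 2) ^ 3)]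
    _ ≤ 2 ^ 7 * (2 ^ (len n + 1)) ^ 3 := by gcongr
    _ < 2 * (2 ^ 7 * (2 ^ (len n + 1)) ^ 3) := lt_two_mul_self (by positivity)
    _ = 2 ^ (3 * len n + 11) := by ring

theorem size_W_le (c n : ℕ) : Nat.size (lim c n).W ≤ 2 * len n + 6 := by
  rw [Nat.size_le]
  have h1 := add_two_le_two_pow n
  calc (lim c n).W = 4 * (n + 2) * (n + 2) + 1 := rfl
    _ ≤ 2 ^ 3 * (n + 2) ^ 2 := by nlinarith
    _ ≤ 2 ^ 3 * (2 ^ (len n + 1)) ^ 2 := by gcongr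
    _ < 2 * (2 ^ 3 * (2 ^ (len n + 1)) ^ 2) := lt_two_mul_self (by positivity)
    _ = 2 ^ (2 * len n + 6) := by ring

/-- The dominant part is `n (len n + 1)` sketches of `2 lam c n + 1` numbers of `O(len n)` bits. -/
theorem bits_le (hc : 1 ≤ c) (hn : 1 ≤ n) : (lim c n).bits ≤ 2500 * (c * n * len n ^ 4) := by
  have hL := one_le_len hn
  have h1 : (lim c n).A ≤ 6 * (c * n * len n ^ 3) := by
    have h2 : lam c n ≤ c * len n * len n := min_le_left _ _
    have h3 := lam_pos hc hn
    calc n * (len n + 1) * (2 * lam c n + 1) ≤ n * (2 * len n) * (3 * (c * len n * len n)) :=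
          Nat.mul_le_mul (Nat.mul_le_mul_left _ (by omega)) (by omega)
      _ = _ := by ring
  have h2 : Nat.size (3 * (lim c n).A + 64) + Nat.size (lim c n).W ≤ 22 * len n := by
    have := size_A_le c n
    have := size_W_le c n
    omega
  have h3 : 6 + Nat.size (lim c n).V ≤ 28 * (c * n * len n ^ 4) := by
    have h4 := size_V_le c n
    have h5 : c ≤ c * n * len n ^ 4 := by
      rw [mul_assoc]; exact Nat.le_mul_of_pos_right _ (by positivity)
    have h6 : len n ≤ c * n * len n ^ 4 := by
      calc len n = len n ^ 1 := (pow_one _).symm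
        _ ≤ len n ^ 4 := Nat.pow_le_pow_right hL (by norm_num)
        _ ≤ _ := Nat.le_mul_of_pos_left _ (by positivity)
    omega
  calc (lim c n).bits ≤ 64 * (28 * (c * n * len n ^ 4)) +
        3 * (6 * (c * n * len n ^ 3)) * (22 * len n) :=
      Nat.add_le_add (Nat.mul_le_mul_left _ h3) (Nat.mul_le_mul (Nat.mul_le_mul_left _ h1) h2)
    _ = 2188 * (c * n * len n ^ 4) := by ring
    _ ≤ _ := by gcongr; norm_num

theorem timeBound_le (hc : 1 ≤ c) (hn : 1 ≤ n) :
    timeBound c n ≤ 3 * progTime * (663552 * (c * n) ^ 4) ^ 9 := by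
  have h1 : (lim c n).V ≤ 663552 * (c * n) ^ 4 := by
    calc (lim c n).V = (c + 1) * (4096 * (n + 2) ^ 4) := by simp only [lim, quad]; ring
      _ ≤ (2 * c ^ 4) * (4096 * (3 * n) ^ 4) := by
          have : c ≤ c ^ 4 := Nat.le_self_pow (by norm_num) c
          gcongr <;> omega
      _ = _ := by ring
  have h2 : (lim c n).unit ≤ 3 * (lim c n).V := by
    have h3 : Nat.size (lim c n).V ≤ (lim c n).V := Nat.size_le.2 Nat.lt_two_pow_self
    have := (lim c n).hV
    unfold Lim.unit; omega
  calc timeBound c n ≤ progTime * (lim c n).V ^ 8 * (3 * (lim c n).V) :=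
        Nat.mul_le_mul_left _ h2
    _ = 3 * progTime * (lim c n).V ^ 9 := by ring
    _ ≤ _ := by gcongr

theorem len_le_log (hn : 1 ≤ n) : (len n : ℝ) ≤ 3 * Real.log (n + 1) := by
  have hL := one_le_len hn
  have hn0 : (1 : ℝ) ≤ n := by exact_mod_cast hn
  have h1 : (2 : ℝ) ^ (len n - 1) ≤ n := by
    exact_mod_cast Nat.lt_size.1 (Nat.sub_lt hL one_pos)
  have h2 : ((len n - 1 : ℕ) : ℝ) * Real.log 2 ≤ Real.log (n + 1) := by
    rw [← Real.log_pow]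
    exact Real.log_le_log (by positivity) (by linarith)
  have h3 : Real.log 2 ≤ Real.log (n + 1) := Real.log_le_log (by norm_num) (by linarith)
  have h4 := Real.log_two_gt_d9
  rw [Nat.cast_sub hL, Nat.cast_one] at h2
  nlinarith

end Bounds

/-- The moments are of order proportional to `s * len n`, where `s` bounds the exponent of the error
probability. -/
theorem params_of_le {c n s : ℕ} {δ ε : ℝ} (hn : 1 ≤ n) (hs : 1 ≤ s) (hδ : 0 < δ)
    (hδ1 : δ ≤ 1) (hε : 0 < ε) (hε1 : ε ≤ 1) (hc : 2304 * (s : ℝ) ≤ c * (δ * ε)) :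
    Params c n (3 * s * len n) δ ε where
  hc := by
    rcases Nat.eq_zero_or_pos c with rfl | h
    · have : (1 : ℝ) ≤ s := by exact_mod_cast hs
      norm_num at hc; linarith
    · exact h
  hm := Nat.mul_pos (by omega) (one_le_len hn)
  hδ := hδ
  hδ1 := hδ1
  hε := hε
  hε1 := hε1
  large := by
    intro h
    have h1 : lam c n = c * len n * len n := by
      unfold lam at h ⊢
      exact min_eq_left (by by_contra h'; rw [min_eq_right (by omega)] at h; omega)
    rw [h1]
    push_cast
    have : (0 : ℝ) ≤ (len n : ℝ) * len n := by positivity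
    nlinarith
  small := by
    have h1 : (n : ℝ) ≤ 2 ^ len n := by exact_mod_cast (Nat.lt_size_self n).le
    have h2 : (2 : ℝ) ^ len n ≤ 8 ^ (3 * s * len n) := by
      calc (2 : ℝ) ^ len n ≤ 8 ^ len n := by gcongr; norm_num
        _ ≤ _ := pow_le_pow_right₀ (by norm_num) (Nat.le_mul_of_pos_left _ (by omega))
    rw [one_div_pow, mul_one_div, div_le_one (by positivity)]
    exact h1.trans h2

/-- The failure probability in the union bound, multiplied by three for the deviation of the law of
the coefficients from the uniform one. -/
theorem error_le {n s : ℕ} {C : ℝ} (hn : 1 ≤ n) (hs : 1 ≤ s) (hC : C ≤ s) :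
    9 * len n * (n * (1 / 8 : ℝ) ^ (3 * s * len n)) ≤ (n : ℝ) ^ (-C) := by
  have hn0 : (1 : ℝ) ≤ n := by exact_mod_cast hn
  have h1 : (n : ℝ) ^ C ≤ 2 ^ (s * len n) := by
    calc (n : ℝ) ^ C ≤ (n : ℝ) ^ (s : ℝ) := Real.rpow_le_rpow_of_exponent_le hn0 hC
      _ = (n : ℝ) ^ s := Real.rpow_natCast _ _
      _ ≤ (2 ^ len n) ^ s := by
          gcongr; exact_mod_cast (Nat.lt_size_self n).le
      _ = _ := by rw [← pow_mul, mul_comm]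
  have h2 : (9 * len n * n : ℝ) ≤ 2 ^ (8 * s * len n) := by
    have h3 : (9 : ℝ) ≤ 2 ^ (4 * len n) := by
      calc (9 : ℝ) ≤ 2 ^ (4 * 1) := by norm_num
        _ ≤ _ := pow_le_pow_right₀ (by norm_num) (by have := one_le_len hn; omega)
    have h4 : (len n : ℝ) ≤ 2 ^ len n := by exact_mod_cast Nat.lt_two_pow_self.le
    have h5 : (n : ℝ) ≤ 2 ^ len n := by exact_mod_cast (Nat.lt_size_self n).le
    calc (9 * len n * n : ℝ) ≤ 2 ^ (4 * len n) * 2 ^ len n * 2 ^ len n := by gcongr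
      _ = 2 ^ (6 * len n) := by ring
      _ ≤ _ := pow_le_pow_right₀ (by norm_num) (Nat.mul_le_mul_right _ (by omega))
  have h3 : (0 : ℝ) < (n : ℝ) ^ C := by positivity
  rw [Real.rpow_neg (by positivity), one_div_pow, ← one_div, le_div_iff₀ h3]
  calc 9 * len n * (n * (1 / (8 : ℝ) ^ (3 * s * len n))) * (n : ℝ) ^ C =
        (9 * len n * n) * (n : ℝ) ^ C / (8 : ℝ) ^ (3 * s * len n) := by ring
    _ ≤ 2 ^ (8 * s * len n) * 2 ^ (s * len n) / (8 : ℝ) ^ (3 * s * len n) := by gcongr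
    _ = 1 := by
        rw [div_eq_one_iff_eq (by positivity), ← pow_add,
          show (8 : ℝ) = 2 ^ 3 by norm_num, ← pow_mul]
        congr 1; ring

end Sparsify

open Imp Sparsify in
theorem theorem3 :
    ∃ K k : ℕ, ∀ C ε δ : ℝ, 0 < C → 0 < ε → ε < 1 → 0 < δ → δ < 1 →
      ∃ A : StreamAlg, ∀ n : ℕ, 1 ≤ n →
        ∀ (σ : List (Update n)) (G : SimpleGraph (Fin n)), IsDynamicStream σ G →
          ∃ out : (ℕ → Bool) → List ℕ,
            (∀ ω : ℕ → Bool, A.Outputs ω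
              (K * (n * max C 1 / (ε * δ)) ^ k)
              (K * (n * max C 1 / (ε * δ)) * Real.log (n + 1) ^ k) σ (out ω)) ∧
            WGraph.IsPowerCutSparsifierDist δ ε ((n : ℝ) ^ (-C)) (WGraph.ofSimple G)
              (StreamAlg.coinLaw.map fun ω => StreamAlg.decode n (out ω)) := by
  obtain ⟨K₁, hK₁⟩ : ∃ K₁ : ℕ, (K₁ : ℝ) = 3 * progTime * (663552 * 4610 ^ 4) ^ 9 :=
    ⟨3 * progTime * (663552 * 4610 ^ 4) ^ 9, by norm_num⟩
  obtain ⟨K₂, hK₂⟩ : ∃ K₂ : ℕ, (K₂ : ℝ) = 2500 * 4610 * 3 ^ 4 * 2 ^ 32 :=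
    ⟨2500 * 4610 * 3 ^ 4 * 2 ^ 32, by norm_num⟩
  refine ⟨K₁ + K₂, 36, ?_⟩
  intro C ε δ _ hε hε1 hδ hδ1
  have hM : (1 : ℝ) ≤ max C 1 := le_max_right _ _
  set s := ⌈max C 1⌉₊ with hs
  have hs1 : 1 ≤ s := Nat.one_le_ceil_iff.2 (by linarith)
  have hsC : C ≤ s := (le_max_left _ _).trans (Nat.le_ceil _)
  have hs2 : (s : ℝ) ≤ 2 * max C 1 := by
    have := (Nat.ceil_lt_add_one (show 0 ≤ max C 1 by linarith)).le
    linarith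
  have hεδ : 0 < ε * δ := mul_pos hε hδ
  have hεδ1 : ε * δ ≤ 1 := mul_le_one₀ hε1.le hδ.le hδ1.le
  -- the factor `2304 = 3 * 768` comes from `Params.large` for the order `3 * s * len n` of moments
  set c := ⌈2304 * (s : ℝ) / (ε * δ)⌉₊ with hc
  have hc1 : 2304 * (s : ℝ) ≤ c * (δ * ε) := by
    rw [mul_comm δ, ← div_le_iff₀ hεδ]; exact Nat.le_ceil _
  set R := max C 1 / (ε * δ) with hR
  have hR1 : 1 ≤ R := by rw [hR, one_le_div hεδ]; linarith
  have hcR : (c : ℝ) ≤ 4610 * R := by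
    have h1 : (c : ℝ) ≤ 2304 * s / (ε * δ) + 1 := (Nat.ceil_lt_add_one (by positivity)).le
    have h2 : 2304 * s / (ε * δ) ≤ 2304 * (2 * max C 1) / (ε * δ) := by gcongr
    have h3 : 2304 * (2 * max C 1) / (ε * δ) = 4608 * R := by rw [hR]; ring
    linarith
  refine ⟨alg c, fun n hn σ G hσ => ⟨fun ω => graphOut c (coefs ω c n) G.Adj, fun ω => ?_, ?_⟩⟩
  · have hp := params_of_le hn hs1 hδ hδ1.le hε hε1.le hc1
    have hX : n * max C 1 / (ε * δ) = n * R := by rw [hR]; ring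
    have hn0 : (1 : ℝ) ≤ n := by exact_mod_cast hn
    have hX1 : 1 ≤ n * R := one_le_mul_of_one_le_of_one_le hn0 hR1
    have hcn : (c * n : ℝ) ≤ 4610 * (n * R) := by nlinarith
    rw [hX]
    set X := n * R
    set l := Real.log (n + 1)
    have hl := len_le_log hn
    have hl1 : 1 ≤ 2 * l := by
      have h1 : Real.log 2 ≤ l := Real.log_le_log (by norm_num) (by linarith)
      have := Real.log_two_gt_d9
      linarith
    have hl0 : 0 ≤ l := by linarith
    refine alg_outputs hp.hc hn ?_ ?_ ω hσ
    · have h1 : (timeBound c n : ℝ) ≤ 3 * progTime * (663552 * (c * n) ^ 4) ^ 9 := by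
        exact_mod_cast timeBound_le hp.hc hn
      have h2 : 3 * progTime * (663552 * (c * n : ℝ) ^ 4) ^ 9 ≤
          3 * progTime * (663552 * (4610 * X) ^ 4) ^ 9 := by gcongr
      have h3 : 3 * progTime * (663552 * (4610 * X) ^ 4) ^ 9 =
          K₁ * X ^ 36 := by rw [hK₁]; ring
      have h4 : 0 ≤ K₂ * X ^ 36 := by positivity
      refine h1.trans (h2.trans (h3.le.trans ?_))
      push_cast
      rw [add_mul]
      exact le_add_of_nonneg_right h4
    -- only `l ^ 4` is needed; the other factors of `l ^ 36` are absorbed because `2 * l ≥ 1`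
    · have h1 : ((lim c n).bits : ℝ) ≤ 2500 * (c * n * (len n : ℝ) ^ 4) := by
        exact_mod_cast bits_le hp.hc hn
      have h2 : 2500 * (c * n * (len n : ℝ) ^ 4) ≤ 2500 * (4610 * X * (3 * l) ^ 4) := by gcongr
      have h3 : 2500 * (4610 * X * (3 * l) ^ 4) * 1 ≤
          2500 * (4610 * X * (3 * l) ^ 4) * (2 * l) ^ 32 := by
        gcongr
        exact one_le_pow₀ hl1
      have h4 : 2500 * (4610 * X * (3 * l) ^ 4) * (2 * l) ^ 32 =
          K₂ * X * l ^ 36 := by rw [hK₂]; ring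
      have h5 : 0 ≤ K₁ * X * l ^ 36 := by positivity
      rw [mul_one] at h3
      refine h1.trans (h2.trans (h3.trans (h4.le.trans ?_)))
      push_cast
      rw [add_mul, add_mul]
      exact le_add_of_nonneg_left h5
  · exact isPowerCutSparsifierDist G (params_of_le hn hs1 hδ hδ1.le hε hε1.le hc1) hn
      (error_le hn hs1 hsC)
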